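/- **Words, diagrams.** Let $n\ge 0$. Let $\mathcal D_n$ be the set of words $\sigma=\sigma_1\cdots\sigma_{2n}$ on $\{0,1\}$ with as many $0$s as $1$s and such that every prefix has at least as many $0$s as $1$s. A word is identified with the Ferrers diagram lying above and to the left of the lattice path with a North step for each $0$ and an East step for each $1$; write $\alpha\le\pi$ if the diagram of $\alpha$ is contained in that of $\pi$, and $\pi/\alpha$ for the set of cells of $\pi$ not in $\alpha$. For $\alpha\le\pi$, $\pi/\alpha$ is a horizontal strip if no two of its cells are in the same column. A word $\pi\in\mathcal D_n$ is also identified with the noncrossing matching of $\{1,\dots,2n\}$ obtained by reading it as a parenthesis word ($0$ opening, $1$ closing). Let $\mathbf 0_n=0^n1^n$. **Fully packed loops in a triangle.** Let $\mathcal T^n$ be the graph whose vertices are the $(x,y)\in\mathbb Z^2$ with $x\ge y\ge 0$ and $x+y\le 4n-2$, with an edge between any two vertices at distance $1$, and with in addition $2n$ external half edges, the $i$-th one attached from below to $(2i-2,0)$, $1\le i\le 2n$. Put $L_i=(i-1,i-1)$ and $R_i=(2n-2+i,2n-i)$ for $1\le i\le 2n$. For $\sigma,\tau,\pi\in\mathcal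 D_n$ let $t_{\sigma,\tau}^{\pi}$ be the number of subgraphs $f$ of $\mathcal T^n$ such that: * $f$ contains all the external edges, and every vertex other than the $L_i$ and the $R_i$ has degree $2$ in $f$ (external edges count for the degree); * $f$ contains the edge from $L_i$ to its right neighbour for $1\le i<2n$ and the edge from $R_i$ to its left neighbour for $1<i\le 2n$; * the vertical edge below $L_i$ (the external edge if $i=1$) belongs to $f$ if and only if $\sigma_i=0$, and the vertical edge below $R_i$ (the external edge if $i=2n$) belongs to $f$ if and only if $\tau_i=1$; * for $i<j$, the $i$-th and the $j$-th external edge are in the same component of $f$ if and only if $\{i,j\}$ is a pair of the matching $\pi$; * each $L_i$ with $\sigma_i=1$ is connected in $f$ (possibly by a path reduced to one vertex) to an $R_j$ with $\tau_j=0$. **The coefficients.** Let $\mathbf b$ and $\mathbf t$ be the complex matrices with rows and columns indexed by $\mathcal D_n$ given by $\mathbf b_{\sigma\tau}=1$ if $\sigma\le\tau$ and $\tau/\sigma$ is a horizontal strip, $\mathbf b_{\sigma\tau}=0$ otherwise, and $\mathbf t_{\sigma\pi}=t_{\sigma,\mathbf 0_n}^{\pi}$. **Proposition.** The matrix $\mathbf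 t$ is invertible; let $\mathbf c=(c_{\alpha\pi})=\mathbf t^{-1}\,\mathbf b\,\mathbf t$. Let $\alpha,\pi\in\mathcal D_n$ with $\alpha\le\pi$. 1. If $\pi/\alpha$ consists of one cell, or of two disconnected cells (two distinct cells that do not share an edge), then $c_{\alpha\pi}=1$. 2. If $\pi/\alpha$ consists of $a\ge 2$ cells in the same row, or of $a\ge 2$ cells in the same column, then $c_{\alpha\pi}=0$. -/

import Mathlib

namespace TFPL

/-- Words of length `2 * n` on the alphabet `{0, 1}`; the letters are indexed by `0, …, 2n - 1`. -/
abbrev Word (n : ℕ) : Type := Fin (2 * n) → Fin 2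

/-- The number of letters equal to `e` among the letters of index `< k`. -/
def countBefore {n : ℕ} (w : Word n) (e : Fin 2) (k : ℕ) : ℕ :=
  (Finset.univ.filter fun j : Fin (2 * n) => j.val < k ∧ w j = e).card

/-- The number of letters equal to `e` among the letters of index `> k`. -/
def countAfter {n : ℕ} (w : Word n) (e : Fin 2) (k : ℕ) : ℕ :=
  (Finset.univ.filter fun j : Fin (2 * n) => k < j.val ∧ w j = e).card

/-- As many `0`s as `1`s in total, and at least as many `0`s as `1`s in each prefix. -/
def IsDyck {n : ℕ} (w : Word n) : Prop :=
  countBefore w 0 (2 * n) = countBefore w 1 (2 * n) ∧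
    ∀ k, k ≤ 2 * n → countBefore w 1 k ≤ countBefore w 0 k

instance {n : ℕ} : DecidablePred (IsDyck (n := n)) := fun w => by
  unfold IsDyck; infer_instance

/-- The set of Dyck words of length `2 * n`. -/
abbrev D (n : ℕ) : Type := {w : Word n // IsDyck w}

/-- The word `0^n 1^n`. -/
def zeroWord (n : ℕ) : Word n := fun j => if j.val < n then 0 else 1

theorem zeroWord_isDyck (n : ℕ) : IsDyck (zeroWord n) := by
  have h0 : ∀ k, k ≤ 2 * n → countBefore (zeroWord n) 0 k = min k n := by
    intro k hk
    rw [countBefore, ← Finset.card_range (min k n)]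
    refine Finset.card_bij (fun j _ => j.val) ?_ ?_ ?_
    · intro j hj
      have hj' := (Finset.mem_filter.mp hj).2
      by_cases h : j.val < n
      · simp [hj'.1, h]
      · simp [zeroWord, h] at hj'
    · intro a _ b _ h
      exact Fin.ext h
    · intro b hb
      simp only [Finset.mem_range, lt_min_iff] at hb
      exact ⟨⟨b, by omega⟩, by simp [zeroWord, hb.1, hb.2], rfl⟩
  have h1 : ∀ k, k ≤ 2 * n → countBefore (zeroWord n) 1 k = k - n := by
    intro k hk
    rw [countBefore, ← Nat.card_Ico n k]
    refine Finset.card_bij (fun j _ => j.val) ?_ ?_ ?_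
    · intro j hj
      have hj' := (Finset.mem_filter.mp hj).2
      by_cases h : j.val < n
      · simp [zeroWord, h] at hj'
      · simp only [Finset.mem_Ico]
        omega
    · intro a _ b _ h
      exact Fin.ext h
    · intro b hb
      simp only [Finset.mem_Ico] at hb
      exact ⟨⟨b, by omega⟩, by simp [zeroWord, hb.1, hb.2], rfl⟩
  refine ⟨?_, fun k hk => ?_⟩
  · rw [h0 _ le_rfl, h1 _ le_rfl]
    omega
  · rw [h0 _ hk, h1 _ hk]
    omega

/-- `0^n 1^n` as a Dyck word: the empty diagram. -/
def zero (n : ℕ) : D n := ⟨zeroWord n, zeroWord_isDyck n⟩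

/-- The Ferrers diagram of a word, drawn from the lattice path with a North step for each `0` and
an East step for each `1`: the region above and to the left of the path.  A cell `(r, c)` is in
row `r` (from the top) and column `c` (from the left), both counted from `0`.  Column `c` lies over
the East step given by the `1` that has `c` other `1`s before it; the number of its cells is the
number of North steps after this East step. -/
def diagram {n : ℕ} (w : Word n) : Finset (ℕ × ℕ) :=
  (Finset.range (2 * n) ×ˢ Finset.range (2 * n)).filter fun p =>
    ∃ i : Fin (2 * n), w i = 1 ∧ countBefore w 1 i = p.2 ∧ p.1 < countAfter w 0 i

/-- The order on words: inclusion of diagrams. -/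
def DiagLE {n : ℕ} (s t : Word n) : Prop := diagram s ⊆ diagram t

/-- The cells of the skew shape `t / s`. -/
def skew {n : ℕ} (t s : Word n) : Finset (ℕ × ℕ) := diagram t \ diagram s

/-- `t / s` is a horizontal strip: `s ≤ t` and no two cells of `t / s` are in the same column. -/
def IsHorizontalStrip {n : ℕ} (s t : Word n) : Prop :=
  DiagLE s t ∧ ∀ p ∈ skew t s, ∀ q ∈ skew t s, p.2 = q.2 → p = q

/-- Two cells that share an edge. -/
def AdjacentCells (p q : ℕ × ℕ) : Prop :=
  (p.1 = q.1 ∧ (p.2 + 1 = q.2 ∨ q.2 + 1 = p.2)) ∨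
    (p.2 = q.2 ∧ (p.1 + 1 = q.1 ∨ q.1 + 1 = p.1))

/-- For `i < j`: the letters `i` and `j` are paired in the noncrossing matching of a Dyck word
(the parenthesis `0` opened at `i` is closed by the `1` at `j`). -/
def Matched {n : ℕ} (w : Word n) (i j : Fin (2 * n)) : Prop :=
  i < j ∧
    (∀ k : Fin (2 * n), i ≤ k → k < j →
      (Finset.univ.filter fun l => i ≤ l ∧ l ≤ k ∧ w l = 1).card <
        (Finset.univ.filter fun l => i ≤ l ∧ l ≤ k ∧ w l = 0).card) ∧
    (Finset.univ.filter fun l => i ≤ l ∧ l ≤ j ∧ w l = 1).card =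
      (Finset.univ.filter fun l => i ≤ l ∧ l ≤ j ∧ w l = 0).card

/-- The vertices of the triangle: `x ≥ y ≥ 0` and `x + y ≤ 4n - 2`. -/
def InTriangle (n : ℕ) (p : ℤ × ℤ) : Prop :=
  0 ≤ p.2 ∧ p.2 ≤ p.1 ∧ p.1 + p.2 ≤ 4 * (n : ℤ) - 2

/-- The `i`-th vertex of the left boundary, from bottom to top. -/
def leftV {n : ℕ} (i : Fin (2 * n)) : ℤ × ℤ := ((i.val : ℤ), (i.val : ℤ))

/-- The `i`-th vertex of the right boundary, from top to bottom. -/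
def rightV {n : ℕ} (i : Fin (2 * n)) : ℤ × ℤ :=
  (2 * (n : ℤ) - 1 + (i.val : ℤ), 2 * (n : ℤ) - 1 - (i.val : ℤ))

/-- The outer end of the `i`-th external edge, a vertical half edge below the vertex `(2i, 0)`. -/
def extV {n : ℕ} (i : Fin (2 * n)) : ℤ × ℤ := (2 * (i.val : ℤ), -1)

/-- The triangle as a graph: the edges of the square grid between vertices of the triangle, and the
`2n` external edges on the bottom. (The points of `ℤ × ℤ` that are neither in the triangle nor
outer ends of external edges are isolated.) -/
def triangleGraph (n : ℕ) : SimpleGraph (ℤ × ℤ) :=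
  SimpleGraph.fromRel fun p q =>
    (InTriangle n p ∧ InTriangle n q ∧ (q = p + (1, 0) ∨ q = p + (0, 1))) ∨
      ∃ i : Fin (2 * n), p = extV i ∧ q = extV i + (0, 1)

/-- `f` is a fully packed loop configuration of the triangle with left, right and bottom boundary
data `s`, `t`, `p`.  The left and the right boundary data prescribe the edges at the vertices of
these boundaries: the horizontal edges are always present, and the vertical edge below the `i`-th
left (right) vertex is present exactly if `s i = 0` (if `t i = 1`). -/
structure IsTFPL {n : ℕ} (s t p : Word n) (f : SimpleGraph (ℤ × ℤ)) : Prop where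
  subgraph : f ≤ triangleGraph n
  /-- Each vertex that is not on the left or on the right boundary has degree two. -/
  degree_two : ∀ v : ℤ × ℤ, 0 ≤ v.2 → v.2 < v.1 → v.1 + v.2 < 4 * (n : ℤ) - 2 →
    (f.neighborSet v).ncard = 2
  external : ∀ i : Fin (2 * n), f.Adj (extV i) (extV i + (0, 1))
  left_horizontal : ∀ i : Fin (2 * n), i.val + 1 < 2 * n → f.Adj (leftV i) (leftV i + (1, 0))
  left_vertical : ∀ i : Fin (2 * n), f.Adj (leftV i) (leftV i - (0, 1)) ↔ s i = 0
  right_horizontal : ∀ i : Fin (2 * n), 0 < i.val → f.Adj (rightV i) (rightV i - (1, 0))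
  right_vertical : ∀ i : Fin (2 * n), f.Adj (rightV i) (rightV i - (0, 1)) ↔ t i = 1
  /-- The external edges are connected by `f` according to the matching of `p`. -/
  bottom : ∀ i j : Fin (2 * n), i < j → (f.Reachable (extV i) (extV j) ↔ Matched p i j)
  /-- The paths that start on the left boundary end on the right boundary. -/
  crossing : ∀ i : Fin (2 * n), s i = 1 →
    ∃ j : Fin (2 * n), t j = 0 ∧ f.Reachable (leftV i) (rightV j)

theorem triangleGraph_edgeSet_finite (n : ℕ) : (triangleGraph n).edgeSet.Finite := by
  have hb : ∀ p q, (triangleGraph n).Adj p q → p ∈ Set.Icc ((0 : ℤ), (-1 : ℤ)) (4 * n, 4 * n) := by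
    intro p q h
    simp only [triangleGraph, SimpleGraph.fromRel_adj, InTriangle, extV] at h
    obtain ⟨_, (h | ⟨i, h, h'⟩) | (h | ⟨i, h, h'⟩)⟩ := h
    · exact ⟨⟨by dsimp; omega, by dsimp; omega⟩, ⟨by dsimp; omega, by dsimp; omega⟩⟩
    · have := i.isLt
      subst h
      exact ⟨⟨by dsimp; omega, by dsimp; omega⟩, ⟨by dsimp; omega, by dsimp; omega⟩⟩
    · exact ⟨⟨by dsimp; omega, by dsimp; omega⟩, ⟨by dsimp; omega, by dsimp; omega⟩⟩
    · have := i.isLt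
      subst h'
      exact ⟨⟨by dsimp; omega, by dsimp; omega⟩, ⟨by dsimp; omega, by dsimp; omega⟩⟩
  have hf : (Set.Icc ((0 : ℤ), (-1 : ℤ)) (4 * n, 4 * n)).Finite := Set.finite_Icc _ _
  refine ((hf.prod hf).image fun x : (ℤ × ℤ) × (ℤ × ℤ) => s(x.1, x.2)).subset ?_
  intro e
  induction e using Sym2.ind with
  | _ p q =>
    intro h
    rw [SimpleGraph.mem_edgeSet] at h
    exact ⟨(p, q), ⟨hb p q h, hb q p h.symm⟩, rfl⟩

/-- There are finitely many configurations, so that their `Nat.card` is their number. -/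
instance {n : ℕ} (s t p : Word n) : Finite {f : SimpleGraph (ℤ × ℤ) // IsTFPL s t p f} := by
  have : Finite {E : Set (Sym2 (ℤ × ℤ)) // E ⊆ (triangleGraph n).edgeSet} :=
    (triangleGraph_edgeSet_finite n).finite_subsets
  refine Finite.of_injective
    (fun f : {f : SimpleGraph (ℤ × ℤ) // IsTFPL s t p f} =>
      (⟨f.1.edgeSet, SimpleGraph.edgeSet_mono f.2.subgraph⟩ :
        {E : Set (Sym2 (ℤ × ℤ)) // E ⊆ (triangleGraph n).edgeSet})) ?_
  intro f g h
  exact Subtype.ext (SimpleGraph.edgeSet_injective (congrArg Subtype.val h))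

/-- The number of fully packed loop configurations of the triangle with left, right and bottom
boundary data `s`, `t`, `p`. -/
noncomputable def tNum {n : ℕ} (s t p : D n) : ℕ :=
  Nat.card {f : SimpleGraph (ℤ × ℤ) // IsTFPL s.1 t.1 p.1 f}

open Classical in
/-- The matrix `b`: the entry `(s, t)` is `1` if `t / s` is a horizontal strip, and `0` if not. -/
noncomputable def bMatrix (n : ℕ) : Matrix (D n) (D n) ℂ :=
  Matrix.of fun s t => if IsHorizontalStrip s.1 t.1 then 1 else 0

/-- The matrix `t`: the entry `(s, p)` is the number of configurations with left, right and bottom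
boundary data `s`, `0^n 1^n`, `p`. -/
noncomputable def tMatrix (n : ℕ) : Matrix (D n) (D n) ℂ :=
  Matrix.of fun s p => (tNum s (zero n) p : ℂ)

/-- The matrix `c = t⁻¹ b t`. -/
noncomputable def cMatrix (n : ℕ) : Matrix (D n) (D n) ℂ :=
  (tMatrix n)⁻¹ * bMatrix n * tMatrix n

end TFPL

/-! The coefficients are found by solving `t c = b t` on small intervals of the order, so only a few
entries of `t` are needed: the diagonal ones and those for two words differing by a row or a column
of cells.

Counting configurations. Cut the triangle along its antidiagonals. An inner vertex has degree two,
so its number of edges to the left and below (two, one or none: the states `S`, `I`, `E`) determines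
its number of edges to the right and above. Give each path a colour: the arc of `p` to which its
external edge belongs, or the left boundary vertex where it starts. Requiring that paths meet only
when their colours agree turns the global connectivity conditions into a local rule, and
configurations correspond to sequences of words of states (`Runs`, `tNum_eq_encard`). In one
direction the colours come from the connected components, because a path has at most two ends. In
the other direction the colours force the required connections, because a finite component has an
even number of vertices of odd degree.

Values of `t`. As long as the letters of `s` and `p` agree, the word on an even antidiagonal is a
block of `S` followed by one `I` for each pending colour, and every step is forced; hence `t` has
diagonal entries 1. At the letter where a bump begins, an arc closes although no left path starts:
either the arc is closed at once and a gap `E` opens in the block, or its two ends go on side by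
side as a pair. At the letter where the bump ends, the defect becomes at most one displaced `I`
(row) or one displaced `S` (column), which must reach its place before the last antidiagonal because
the right boundary is `0^n 1^n`. Pascal, hockey-stick and Vandermonde identities sum the branches to
`(2n - 2 - u).choose a` for a bump of `a` cells, where `u` is the number of `1`s before it
(`tNum_bump`). The formula is the same for rows and columns. Counting colours modulo 2 on each
antidiagonal gives triangularity (`co_le_of_mem_runs`), hence invertibility.

Solving for `c`. Prefix counts of `1`s describe the diagrams diagonal by diagonal, so the words
between `s` and `p` form a chain for a row or a column (`Bump.exists_chain`), and a square for two
disconnected cells. Put `x = 2n - 2 - u`. For a bump with `a ≥ 2`, induction reduces the left side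
of `t c = b t` to `x.choose a + x.choose (a - 1) + c`, while the right side is `(x + 1).choose a`: a
diagonal sum of binomials for a row, two surviving terms for a column. Thus `c = 0`; for `a = 1` the
same equation gives `c = 1` (`cMatrix_of_bump`). In the square, opposite sides have equal entries of
`t` and the entry of `t` for the whole shape cancels, leaving `c = 1` (`cMatrix_of_two_cells`). -/

namespace TFPL

/-- The state of a vertex with respect to the edges to its left and below: `S` if there are two
of them, `I c` if there is one, belonging to a path of colour `c`, and `E` if there is none. -/
inductive Sym (C : Type) where
  | S : Sym C
  | I : C → Sym C
  | E : Sym C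

open TFPL.Sym

/-! ### From one antidiagonal to the next: moves of blocks of states -/

section Half

variable {C : Type}

/-- The state of a vertex that is reached at most from below. -/
def carrySym : Option C → Sym C
  | none => E
  | some c => I c

@[simp] theorem carrySym_none : carrySym (none : Option C) = E := rfl
@[simp] theorem carrySym_some (c : C) : carrySym (some c) = I c := rfl

/-- `Half w k T`: the states `w` on an antidiagonal, read from bottom to top, can be followed by
the states `T` on the next one, where `k` is the colour of the edge entering its lowest vertex
from below.  The vertex number `y` of the first antidiagonal is adjacent to the vertices number `y`
and `y + 1` of the second one. -/
def Half : List (Sym C) → Option C → List (Sym C) → Prop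
  | [], k, T => T = [carrySym k]
  | S :: w, k, T => ∃ T', T = carrySym k :: T' ∧ Half w none T'
  | I c :: w, none, T =>
      (∃ T', T = I c :: T' ∧ Half w none T') ∨ ∃ T', T = E :: T' ∧ Half w (some c) T'
  | I c :: w, some d, T =>
      (c = d ∧ ∃ T', T = S :: T' ∧ Half w none T') ∨ ∃ T', T = I d :: T' ∧ Half w (some c) T'
  | E :: w, none, T => ∃ c T', T = I c :: T' ∧ Half w (some c) T'
  | E :: w, some d, T => ∃ T', T = S :: T' ∧ Half w (some d) T'

theorem half_I_none {c : C} {w T : List (Sym C)} : Half (I c :: w) none T ↔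
    (∃ T', T = I c :: T' ∧ Half w none T') ∨ ∃ T', T = E :: T' ∧ Half w (some c) T' := Iff.rfl

theorem half_I_some {c d : C} {w T : List (Sym C)} : Half (I c :: w) (some d) T ↔
    (c = d ∧ ∃ T', T = S :: T' ∧ Half w none T') ∨ ∃ T', T = I d :: T' ∧ Half w (some c) T' :=
  Iff.rfl

/-- A block of `S`. -/
abbrev Sw (C : Type) (a : ℕ) : List (Sym C) := List.replicate a S
/-- A block of `E`. -/
abbrev Ew (C : Type) (a : ℕ) : List (Sym C) := List.replicate a E
/-- A block of `I` with the given colours. -/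
abbrev Iw (K : List C) : List (Sym C) := K.map I

theorem half_Sw (a : ℕ) (w T : List (Sym C)) :
    Half (Sw C a ++ w) none T ↔ ∃ T', T = Ew C a ++ T' ∧ Half w none T' := by
  induction a generalizing T with
  | zero => simp
  | succ a ih =>
    simp only [List.replicate_succ, List.cons_append, Half, carrySym_none, ih]
    constructor
    · rintro ⟨_, rfl, T', rfl, h⟩; exact ⟨T', rfl, h⟩
    · rintro ⟨T', rfl, h⟩; exact ⟨_, rfl, T', rfl, h⟩

theorem half_Ew (a : ℕ) (d : C) (w T : List (Sym C)) :
    Half (Ew C a ++ w) (some d) T ↔ ∃ T', T = Sw C a ++ T' ∧ Half w (some d) T' := by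
  induction a generalizing T with
  | zero => simp
  | succ a ih =>
    simp only [List.replicate_succ, List.cons_append, Half, ih]
    constructor
    · rintro ⟨_, rfl, T', rfl, h⟩; exact ⟨T', rfl, h⟩
    · rintro ⟨T', rfl, h⟩; exact ⟨_, rfl, T', rfl, h⟩

/-- A path entering from below cannot join the path it meets, whose colour differs, so that path
turns up. The block shifts by one place and its last colour leaves at the top. -/
theorem half_Iw_some {A A' : List C} {d e : C} (hn : (d :: A).Nodup) (h : d :: A = A' ++ [e])
    (w T : List (Sym C)) :
    Half (Iw A ++ w) (some d) T ↔ ∃ T', T = Iw A' ++ T' ∧ Half w (some e) T' := by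
  induction A generalizing d A' T with
  | nil =>
    have : A' = [] ∧ d = e := by
      cases A' <;> simp_all
    obtain ⟨rfl, rfl⟩ := this
    simp
  | cons c A ih =>
    obtain _ | ⟨x, A''⟩ := A'
    · simp at h
    · simp only [List.cons_append, List.cons.injEq] at h
      obtain ⟨rfl, h⟩ := h
      have hne : c ≠ d := by rintro rfl; simp at hn
      have hn' : (c :: A).Nodup := hn.of_cons
      simp only [List.map_cons, List.cons_append, Half, hne, false_and, false_or, ih hn' h]
      constructor
      · rintro ⟨_, rfl, T', rfl, h⟩; exact ⟨T', rfl, h⟩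
      · rintro ⟨T', rfl, h⟩; exact ⟨_, rfl, T', rfl, h⟩

theorem half_Iw_some_end {A : List C} {d : C} (hn : (d :: A).Nodup) (T : List (Sym C)) :
    Half (Iw A) (some d) T ↔ T = Iw (d :: A) := by
  obtain ⟨A', e, h⟩ : ∃ A' e, d :: A = A' ++ [e] :=
    ⟨_, _, (List.dropLast_append_getLast (List.cons_ne_nil d A)).symm⟩
  have := half_Iw_some hn h [] T
  rw [List.append_nil] at this
  rw [this, h]
  simp [Half]

theorem half_Iw_some_S {A : List C} {d : C} (hn : (d :: A).Nodup) (w T : List (Sym C)) :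
    Half (Iw A ++ S :: w) (some d) T ↔ ∃ T', T = Iw (d :: A) ++ T' ∧ Half w none T' := by
  obtain ⟨A', e, h⟩ : ∃ A' e, d :: A = A' ++ [e] :=
    ⟨_, _, (List.dropLast_append_getLast (List.cons_ne_nil d A)).symm⟩
  rw [half_Iw_some hn h, h]
  simp [Half]

/-- Once one path of the block turns up, leaving an `E` behind, all the paths above it are pushed up
too. So the only choice is the place of at most one gap. -/
theorem half_Iw_none {A : List C} (hn : A.Nodup) (w T : List (Sym C)) :
    Half (Iw A ++ w) none T ↔ (∃ T', T = Iw A ++ T' ∧ Half w none T') ∨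
      ∃ A₁ A₂ e T', A = A₁ ++ A₂ ++ [e] ∧ T = Iw A₁ ++ E :: Iw A₂ ++ T' ∧ Half w (some e) T' := by
  induction A generalizing T with
  | nil => simp
  | cons c A ih =>
    have hn' := hn.of_cons
    simp only [List.map_cons, List.cons_append, Half, ih hn']
    constructor
    · rintro (⟨_, rfl, ⟨T', rfl, h⟩ | ⟨A₁, A₂, e, T', rfl, rfl, h⟩⟩ | ⟨T', rfl, h⟩)
      · exact .inl ⟨T', rfl, h⟩
      · exact .inr ⟨c :: A₁, A₂, e, T', by simp, by simp, h⟩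
      · obtain ⟨A', e, he⟩ : ∃ A' e, c :: A = A' ++ [e] :=
          ⟨_, _, (List.dropLast_append_getLast (List.cons_ne_nil c A)).symm⟩
        obtain ⟨T'', rfl, h'⟩ := (half_Iw_some hn he w T').1 h
        exact .inr ⟨[], A', e, T'', by simpa using he, by simp, h'⟩
    · rintro (⟨T', rfl, h⟩ | ⟨A₁, A₂, e, T', h1, rfl, h⟩)
      · exact .inl ⟨_, rfl, .inl ⟨T', rfl, h⟩⟩
      · obtain _ | ⟨x, A₁⟩ := A₁
        · refine .inr ⟨_, rfl, ?_⟩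
          rw [List.nil_append] at h1
          exact (half_Iw_some hn h1 w _).2 ⟨T', rfl, h⟩
        · simp only [List.cons_append, List.cons.injEq] at h1
          obtain ⟨rfl, rfl⟩ := h1
          exact .inl ⟨Iw A₁ ++ E :: Iw A₂ ++ T', by simp, .inr ⟨A₁, A₂, e, T', rfl, rfl, h⟩⟩

/-- An `S` has no outgoing edge, so its place absorbs the path pushed out of the block, and nothing
goes on above it. If no path turns up, the gap is the place of the `S` itself. -/
theorem half_Iw_none_S {A : List C} (hn : A.Nodup) (w T : List (Sym C)) :
    Half (Iw A ++ S :: w) none T ↔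
      ∃ A₁ A₂ T', A = A₁ ++ A₂ ∧ T = Iw A₁ ++ E :: Iw A₂ ++ T' ∧ Half w none T' := by
  rw [half_Iw_none hn]
  simp only [Half]
  constructor
  · rintro (⟨_, rfl, T', rfl, h⟩ | ⟨A₁, A₂, e, _, rfl, rfl, T', rfl, h⟩)
    · exact ⟨A, [], T', by simp, by simp, h⟩
    · exact ⟨A₁, A₂ ++ [e], T', by simp, by simp, h⟩
  · rintro ⟨A₁, A₂, T', rfl, rfl, h⟩
    obtain rfl | ⟨A₂, e, rfl⟩ := A₂.eq_nil_or_concat'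
    · exact .inl ⟨E :: T', by simp, T', rfl, h⟩
    · exact .inr ⟨A₁, A₂, e, I e :: T', by simp, by simp, T', rfl, h⟩

theorem half_Iw_none_end {A : List C} (hn : A.Nodup) (T : List (Sym C)) :
    Half (Iw A) none T ↔ ∃ A₁ A₂, A = A₁ ++ A₂ ∧ T = Iw A₁ ++ E :: Iw A₂ := by
  have := half_Iw_none hn [] T
  rw [List.append_nil] at this
  rw [this]
  simp only [Half]
  constructor
  · rintro (⟨_, rfl, rfl⟩ | ⟨A₁, A₂, e, _, rfl, rfl, rfl⟩)
    · exact ⟨A, [], by simp, by simp⟩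
    · exact ⟨A₁, A₂ ++ [e], by simp, by simp⟩
  · rintro ⟨A₁, A₂, rfl, rfl⟩
    obtain rfl | ⟨A₂, e, rfl⟩ := A₂.eq_nil_or_concat'
    · exact .inl ⟨[E], by simp, rfl⟩
    · exact .inr ⟨A₁, A₂, e, [I e], by simp, by simp, rfl⟩

theorem half_Iw_some_top {A : List C} {d : C} (hn : (d :: A).Nodup) (V : List (Sym C)) :
    ¬ Half (Iw A) (some d) (V ++ [E]) := by
  rw [half_Iw_some_end hn]
  intro h
  have := congrArg List.getLast? h
  obtain ⟨A', e, h⟩ : ∃ A' e, d :: A = A' ++ [e] :=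
    ⟨_, _, (List.dropLast_append_getLast (List.cons_ne_nil d A)).symm⟩
  rw [h] at this
  simp at this

theorem half_Iw_none_top {A : List C} (hn : A.Nodup) (V : List (Sym C)) :
    Half (Iw A) none (V ++ [E]) ↔ V = Iw A := by
  rw [half_Iw_none_end hn]
  constructor
  · rintro ⟨A₁, A₂, rfl, h⟩
    obtain rfl | ⟨A₂, e, rfl⟩ := A₂.eq_nil_or_concat'
    · simpa using h
    · have := congrArg List.getLast? h
      simp [List.getLast?_append, List.getLast?_cons] at this
  · rintro rfl
    exact ⟨A, [], by simp, by simp⟩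

theorem half_Iw_none_top_I {A : List C} (hn : A.Nodup) (T : List (Sym C)) :
    (Half (Iw A) none T ∧ ∃ V c, T = V ++ [I c]) ↔
      ∃ A₁ A₂, A = A₁ ++ A₂ ∧ A₂ ≠ [] ∧ T = Iw A₁ ++ E :: Iw A₂ := by
  rw [half_Iw_none_end hn]
  constructor
  · rintro ⟨⟨A₁, A₂, rfl, rfl⟩, V, c, h⟩
    refine ⟨A₁, A₂, rfl, ?_, rfl⟩
    rintro rfl
    have := congrArg List.getLast? h
    simp at this
  · rintro ⟨A₁, A₂, rfl, h, rfl⟩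
    refine ⟨⟨A₁, A₂, rfl, rfl⟩, ?_⟩
    obtain rfl | ⟨A₂, e, rfl⟩ := A₂.eq_nil_or_concat'
    · exact absurd rfl h
    · exact ⟨Iw A₁ ++ E :: Iw A₂, e, by simp⟩

/-- An `E` below a nonempty block of `I`, with nothing above. -/
theorem half_E_Iw_none_top {c : C} {A : List C} (hn : (c :: A).Nodup) (V : List (Sym C)) :
    Half (E :: Iw (c :: A)) none (V ++ [E]) ↔ V = I c :: S :: Iw A := by
  have hA := hn.of_cons
  simp only [Half, List.map_cons]
  constructor
  · rintro ⟨x, T', h, ⟨rfl, T'', rfl, h2⟩ | ⟨T'', rfl, h2⟩⟩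
    · obtain rfl | ⟨T'', e, rfl⟩ := T''.eq_nil_or_concat'
      · rcases A with _ | ⟨_, _⟩ <;> simp [Half] at h2
      · obtain ⟨rfl, h3⟩ : V = I c :: S :: T'' ∧ E = e := by
          have h : V ++ [E] = (I c :: S :: T'') ++ [e] := by simpa using h
          simpa using List.append_inj' h rfl
        subst h3
        rw [(half_Iw_none_top hA T'').1 (by simpa using h2)]
    · exfalso
      obtain rfl | ⟨T'', e, rfl⟩ := T''.eq_nil_or_concat'
      · rcases A with _ | ⟨_, _⟩ <;> simp [Half] at h2
      · obtain ⟨rfl, h3⟩ : V = I x :: I x :: T'' ∧ E = e := by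
          have h : V ++ [E] = (I x :: I x :: T'') ++ [e] := by simpa using h
          simpa using List.append_inj' h rfl
        subst h3
        exact half_Iw_some_top hn _ (by simpa using h2)
  · rintro rfl
    exact ⟨c, _, rfl, .inl ⟨rfl, _, rfl, (half_Iw_none_top hA _).2 rfl⟩⟩

/-- Both edges leaving the `E` have the colour `d` of the entering path; the upper one joins nothing
in the block and pushes a path out at the top. -/
theorem half_E_Iw_some_top {c d : C} {A : List C} (hn : (c :: A).Nodup) (hd : d ∉ c :: A)
    (V : List (Sym C)) : ¬ Half (E :: Iw (c :: A)) (some d) (V ++ [E]) := by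
  simp only [Half, List.map_cons]
  have hcd : c ≠ d := by rintro rfl; simp at hd
  rintro ⟨T', h, ⟨h', -⟩ | ⟨T'', rfl, h2⟩⟩
  · exact hcd h'
  · obtain rfl | ⟨T'', e, rfl⟩ := T''.eq_nil_or_concat'
    · rcases A with _ | ⟨_, _⟩ <;> simp [Half] at h2
    · obtain ⟨rfl, h3⟩ : V = S :: I d :: T'' ∧ E = e := by
        have h : V ++ [E] = (S :: I d :: T'') ++ [e] := by simpa using h
        simpa using List.append_inj' h rfl
      subst h3
      exact half_Iw_some_top hn _ (by simpa using h2)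

end Half

end TFPL

namespace TFPL

open TFPL.Sym

/-! ### Double steps between even antidiagonals: ordinary words -/

section Lines

variable {C : Type}

theorem Half.ne_nil {w : List (Sym C)} {k : Option C} {T : List (Sym C)} (h : Half w k T) :
    T ≠ [] := by
  rintro rfl
  cases w with
  | nil => simp [Half] at h
  | cons s w => cases s <;> cases k <;> simp [Half] at h

/-- If a prefix of the targets is known, then so is a prefix of the targets but the last one. -/
theorem half_top_iff {w X V : List (Sym C)} {k : Option C} :
    (∃ T, V ++ [E] = X ++ T ∧ Half w k T) ↔ ∃ V', V = X ++ V' ∧ Half w k (V' ++ [E]) := by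
  constructor
  · rintro ⟨T, h, hT⟩
    obtain rfl | ⟨T, e, rfl⟩ := T.eq_nil_or_concat'
    · exact absurd rfl hT.ne_nil
    · rw [← List.append_assoc] at h
      obtain ⟨rfl, h'⟩ := List.append_inj' h rfl
      obtain rfl : E = e := by simpa using h'
      exact ⟨T, rfl, hT⟩
  · rintro ⟨V', rfl, h⟩
    exact ⟨_, by simp, h⟩

theorem half_Sw_top (a : ℕ) (w O : List (Sym C)) :
    Half (Sw C a ++ w) none (O ++ [E]) ↔ ∃ O', O = Ew C a ++ O' ∧ Half w none (O' ++ [E]) := by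
  rw [half_Sw, half_top_iff]

theorem half_base_top {K : List C} (hn : K.Nodup) (a : ℕ) (O : List (Sym C)) :
    Half (Sw C a ++ Iw K) none (O ++ [E]) ↔ O = Ew C a ++ Iw K := by
  rw [half_Sw_top]
  simp only [half_Iw_none_top hn, exists_eq_right]

theorem half_col_top {A : List C} (hn : A.Nodup) (a : ℕ) (w O : List (Sym C)) :
    Half (Sw C a ++ (Iw A ++ S :: w)) none (O ++ [E]) ↔
      ∃ A₁ A₂ O', A = A₁ ++ A₂ ∧ O = Ew C a ++ (Iw A₁ ++ E :: (Iw A₂ ++ O')) ∧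
        Half w none (O' ++ [E]) := by
  rw [half_Sw_top]
  constructor
  · rintro ⟨O', rfl, h⟩
    rw [half_Iw_none_S hn] at h
    obtain ⟨A₁, A₂, T', rfl, h1, h2⟩ := h
    obtain ⟨V, rfl, h3⟩ := half_top_iff.1 ⟨T', h1, h2⟩
    exact ⟨A₁, A₂, V, rfl, by simp, h3⟩
  · rintro ⟨A₁, A₂, O', rfl, rfl, h⟩
    exact ⟨_, rfl, (half_Iw_none_S hn _ _).2 ⟨A₁, A₂, O' ++ [E], rfl, by simp, h⟩⟩

/-- With nothing leaving at the top, a gap is filled without choice: the upper edge of the `E` must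
join the next path, so the new path has its colour `c`, and an `S` appears just above. -/
theorem half_Iw_E_top {B D : List C} {c : C} (hn : (B ++ c :: D).Nodup) (O : List (Sym C)) :
    Half (Iw B ++ E :: Iw (c :: D)) none (O ++ [E]) ↔ O = Iw B ++ I c :: S :: Iw D := by
  have hB := hn.of_append_left
  have hD := hn.of_append_right
  rw [half_Iw_none hB]
  constructor
  · rintro (⟨T, h1, h2⟩ | ⟨A₁, A₂, e, T, rfl, h1, h2⟩)
    · obtain ⟨V, rfl, h3⟩ := half_top_iff.1 ⟨T, h1, h2⟩
      rw [half_E_Iw_none_top hD] at h3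
      rw [h3]
    · obtain ⟨V, rfl, h3⟩ := half_top_iff.1 ⟨T, h1, h2⟩
      refine absurd h3 (half_E_Iw_some_top hD ?_ _)
      exact List.disjoint_of_nodup_append hn (by simp)
  · rintro rfl
    exact .inl ⟨_, by simp, (half_E_Iw_none_top hD (I c :: S :: Iw D)).2 rfl⟩

/-- A lone `I` among `S`s either goes right or climbs one place; the `S` above then stops it. -/
theorem half_row_top {K : List C} (hn : K.Nodup) (a k : ℕ) (c : C) (O : List (Sym C)) :
    Half (Sw C a ++ I c :: (Sw C (k + 1) ++ Iw K)) none (O ++ [E]) ↔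
      O = Ew C a ++ I c :: (Ew C (k + 1) ++ Iw K) ∨
      O = Ew C (a + 1) ++ I c :: (Ew C k ++ Iw K) := by
  rw [half_Sw_top]
  simp only [Half]
  constructor
  · rintro ⟨O', rfl, h | ⟨T, h1, T', rfl, h2⟩⟩
    · obtain ⟨V, rfl, h3⟩ := (half_top_iff (X := [I c])).1 h
      rw [half_base_top hn] at h3
      left; simp [h3]
    · obtain ⟨V, rfl, h3⟩ := (half_top_iff (X := [E, I c])).1 ⟨T', h1, h2⟩
      replace h3 := (half_base_top hn _ _).1 h3
      right; simp [h3, List.replicate_succ']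
  · rintro (rfl | rfl)
    · exact ⟨_, rfl, .inl ⟨Ew C (k + 1) ++ Iw K ++ [E], by simp, (half_base_top hn (k + 1) _).2 rfl⟩⟩
    · exact ⟨E :: I c :: (Ew C k ++ Iw K), by simp [List.replicate_succ'],
        .inr ⟨I c :: (Ew C k ++ Iw K ++ [E]), by simp, _, rfl, (half_base_top hn k _).2 rfl⟩⟩

/-- Two paths of the same colour may be joined. -/
theorem half_pair_top {A K : List C} {x : C} (hn : (A ++ x :: K).Nodup) (a : ℕ)
    (O : List (Sym C)) :
    Half (Sw C a ++ (Iw A ++ I x :: I x :: Iw K)) none (O ++ [E]) ↔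
      O = Ew C a ++ (Iw A ++ I x :: I x :: Iw K) ∨
      ∃ A₁ A₂, A = A₁ ++ A₂ ∧ O = Ew C a ++ (Iw A₁ ++ E :: (Iw A₂ ++ S :: Iw K)) := by
  have hA := hn.of_append_left
  have hx := hn.of_append_right
  have hK := hx.of_cons
  have key : ∀ V : List (Sym C), Half (I x :: Iw K) none (V ++ [E]) ↔ V = I x :: Iw K :=
    half_Iw_none_top hx
  have key' : ∀ V : List (Sym C), Half (I x :: Iw K) (some x) (V ++ [E]) ↔ V = S :: Iw K := by
    intro V
    simp only [Half, true_and]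
    constructor
    · rintro (h | h)
      · obtain ⟨V, rfl, h3⟩ := (half_top_iff (X := [S])).1 h
        rw [half_Iw_none_top hK] at h3
        simp [h3]
      · obtain ⟨V, rfl, h3⟩ := (half_top_iff (X := [I x])).1 h
        exact absurd h3 (half_Iw_some_top hx _)
    · rintro rfl
      exact .inl ⟨_, rfl, (half_Iw_none_top hK _).2 rfl⟩
  rw [half_Sw_top]
  constructor
  · rintro ⟨O', rfl, h⟩
    obtain ⟨T, h1, h2⟩ | ⟨A₁, A₂, e, T, rfl, h1, h2⟩ := (half_Iw_none hA _ _).1 h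
    · obtain ⟨V, rfl, h3⟩ := half_top_iff.1 ⟨T, h1, h2⟩
      rw [half_I_none] at h3
      obtain h | h := h3
      · obtain ⟨V, rfl, h3⟩ := (half_top_iff (X := [I x])).1 h
        rw [key] at h3
        left; simp [h3]
      · obtain ⟨V, rfl, h3⟩ := (half_top_iff (X := [E])).1 h
        rw [key'] at h3
        right; exact ⟨A, [], by simp, by simp [h3]⟩
    · obtain ⟨V, rfl, h3⟩ := half_top_iff.1 ⟨T, h1, h2⟩
      rw [half_I_some] at h3
      have hne : x ≠ e := by
        rintro rfl
        exact List.disjoint_of_nodup_append hn (a := x) (by simp) (by simp)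
      obtain ⟨h, -⟩ | h := h3
      · exact absurd h hne
      · obtain ⟨V, rfl, h3⟩ := (half_top_iff (X := [I e])).1 h
        rw [key'] at h3
        right; exact ⟨A₁, A₂ ++ [e], by simp, by simp [h3]⟩
  · rintro (rfl | ⟨A₁, A₂, rfl, rfl⟩)
    · refine ⟨_, rfl, (half_Iw_none hA _ _).2 (.inl ⟨I x :: (I x :: Iw K ++ [E]), by simp, ?_⟩)⟩
      exact .inl ⟨_, rfl, (key _).2 rfl⟩
    · refine ⟨_, rfl, (half_Iw_none hA _ _).2 ?_⟩
      obtain rfl | ⟨A₂, e, rfl⟩ := A₂.eq_nil_or_concat'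
      · exact .inl ⟨E :: (S :: Iw K ++ [E]), by simp, .inr ⟨_, rfl, (key' _).2 rfl⟩⟩
      · exact .inr ⟨A₁, A₂, e, I e :: (S :: Iw K ++ [E]), by simp, by simp,
          .inr ⟨_, rfl, (key' _).2 rfl⟩⟩

/-- One step of the transfer: `s` and `p` tell whether the letters of the left and of the bottom
boundary are `1`, `b` is the colour of the external edge and `l` the colour of the path starting on
the left boundary. -/
structure Stp (C : Type) where
  s : Bool
  p : Bool
  b : C
  l : C

/-- What happens at the vertex of the left boundary. -/
def Fin' (st : Stp C) (T W' : List (Sym C)) : Prop :=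
  if st.s then ∃ V, T = V ++ [E] ∧ W' = V ++ [I st.l] else W' = T ∧ ∃ V c, T = V ++ [I c]

/-- The states `W` on an even antidiagonal can be followed by `O` and `W'` on the next two. -/
def Line (st : Stp C) (W O W' : List (Sym C)) : Prop :=
  Half W none (O ++ [E]) ∧ ∃ T, Half O (some st.b) T ∧ Fin' st T W'

/-- An entering path pushes the last path of the block into the vertical edge below the left
boundary vertex, which is present only for the letter `0`. -/
theorem fin_some {st : Stp C} {D : List C} {d : C} (hn : (d :: D).Nodup) (X W' : List (Sym C)) :
    (∃ T, Half (Iw D) (some d) T ∧ Fin' st (X ++ T) W') ↔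
      st.s = false ∧ W' = X ++ Iw (d :: D) := by
  obtain ⟨A', e, h⟩ : ∃ A' e, d :: D = A' ++ [e] :=
    ⟨_, _, (List.dropLast_append_getLast (List.cons_ne_nil d D)).symm⟩
  simp only [half_Iw_some_end hn, exists_eq_left]
  rw [h]
  cases hs : st.s
  · simp only [Fin', hs, Bool.false_eq_true, if_false, true_and, and_iff_left_iff_imp]
    rintro -
    exact ⟨X ++ Iw A', e, by simp⟩
  · simp only [Fin', hs, if_true, Bool.true_eq_false, false_and, iff_false]
    rintro ⟨V, h, -⟩
    have := congrArg List.getLast? h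
    simp [List.getLast?_append] at this

/-- The possible ends of the states after a step, above `X`, if there is a block of paths of
colours `D` and no edge entering this block. -/
def Out (st : Stp C) (D : List C) (X W' : List (Sym C)) : Prop :=
  if st.s then W' = X ++ Iw (D ++ [st.l])
  else ∃ D₁ D₂, D = D₁ ++ D₂ ∧ D₂ ≠ [] ∧ W' = X ++ (Iw D₁ ++ E :: Iw D₂)

/-- For the letter `1` nothing may reach the top, so the block stays. For the letter `0` something
must, so a gap opens below a nonempty part of the block. -/
theorem fin_none {st : Stp C} {D : List C} (hn : D.Nodup) (X W' : List (Sym C)) :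
    (∃ T, Half (Iw D) none T ∧ Fin' st (X ++ T) W') ↔ Out st D X W' := by
  cases hs : st.s
  · simp only [Fin', Out, hs, Bool.false_eq_true, if_false]
    constructor
    · rintro ⟨T, h, rfl, V, c, h'⟩
      obtain rfl | ⟨T, e, rfl⟩ := T.eq_nil_or_concat'
      · exact absurd rfl h.ne_nil
      · rw [← List.append_assoc] at h'
        obtain ⟨-, h'⟩ := List.append_inj' h' rfl
        obtain ⟨A₁, A₂, h1, h2, h3⟩ := (half_Iw_none_top_I hn _).1 ⟨h, T, c, by rw [h']⟩
        exact ⟨A₁, A₂, h1, h2, by rw [h3]⟩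
    · rintro ⟨A₁, A₂, h1, h2, rfl⟩
      obtain ⟨h4, V, c, h5⟩ := (half_Iw_none_top_I hn _).2 ⟨A₁, A₂, h1, h2, rfl⟩
      exact ⟨_, h4, rfl, X ++ V, c, by rw [h5]; simp⟩
  · simp only [Fin', Out, hs, if_true]
    constructor
    · rintro ⟨T, h, V, h1, rfl⟩
      obtain ⟨V, rfl, h3⟩ := half_top_iff.1 ⟨T, h1.symm, h⟩
      rw [half_Iw_none_top hn] at h3
      simp [h3]
    · rintro rfl
      exact ⟨Iw D ++ [E], (half_Iw_none_top hn _).2 rfl, X ++ Iw D, by simp, by simp⟩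

/-- The first half is forced and turns each `S` into `E`. In the second half the external path
climbs through the `E`s, restoring each to `S`, and pushes the whole block. -/
theorem line_base_push {st : Stp C} {K : List C} (hs : st.s = false) (hn : (st.b :: K).Nodup)
    (a : ℕ) (O W' : List (Sym C)) :
    Line st (Sw C a ++ Iw K) O W' ↔
      O = Ew C a ++ Iw K ∧ W' = Sw C a ++ Iw (st.b :: K) := by
  have hK := hn.of_cons
  rw [Line, half_base_top hK]
  refine and_congr_right ?_
  rintro rfl
  have := fin_some (st := st) hn (Sw C a) W'
  simp only [hs, true_and] at this
  rw [← this]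
  simp only [half_Ew]
  constructor
  · rintro ⟨_, ⟨T, rfl, h⟩, h'⟩; exact ⟨T, h, h'⟩
  · rintro ⟨T, h, h'⟩; exact ⟨_, ⟨T, rfl, h⟩, h'⟩

/-- The first path of a block meets the path of the same colour entering from below, or not. -/
theorem half_Ew_pop {K : List C} {b : C} (a : ℕ) (w T : List (Sym C)) :
    Half (Ew C a ++ Iw (b :: K) ++ w) (some b) T ↔
      (∃ T', T = Sw C (a + 1) ++ T' ∧ Half (Iw K ++ w) none T') ∨
      ∃ T', T = Sw C a ++ I b :: T' ∧ Half (Iw K ++ w) (some b) T' := by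
  rw [List.append_assoc, half_Ew]
  simp only [List.map_cons, List.cons_append, Half, true_and]
  constructor
  · rintro ⟨_, rfl, ⟨T, rfl, h⟩ | ⟨T, rfl, h⟩⟩
    · exact .inl ⟨T, by simp [List.replicate_succ'], h⟩
    · exact .inr ⟨T, rfl, h⟩
  · rintro (⟨T, rfl, h⟩ | ⟨T, rfl, h⟩)
    · exact ⟨_, by simp [List.replicate_succ'], .inl ⟨T, rfl, h⟩⟩
    · exact ⟨_, rfl, .inr ⟨T, rfl, h⟩⟩

/-- The external path meets the other end of its arc. Joining it adds an `S` and leaves the rest of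
the block without an entering path; otherwise the two ends remain next to each other and the block
is pushed, which needs the letter `0` on the left. -/
theorem line_base_pop_aux {st : Stp C} {K : List C} (hn : (st.b :: K).Nodup)
    (a : ℕ) (O W' : List (Sym C)) :
    Line st (Sw C a ++ Iw (st.b :: K)) O W' ↔ O = Ew C a ++ Iw (st.b :: K) ∧
      (Out st K (Sw C (a + 1)) W' ∨ (st.s = false ∧ W' = Sw C a ++ Iw (st.b :: st.b :: K))) := by
  have hK := hn.of_cons
  rw [Line, half_base_top hn]
  refine and_congr_right ?_
  rintro rfl
  have h1 := fin_some (st := st) hn (Sw C a ++ [I st.b]) W'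
  have h2 := fin_none (st := st) hK (Sw C (a + 1)) W'
  have h3 := fun T => half_Ew_pop (K := K) (b := st.b) a [] T
  simp only [List.append_nil] at h3
  simp only [h3, ← h2]
  have : (st.s = false ∧ W' = Sw C a ++ Iw (st.b :: st.b :: K)) ↔
      (st.s = false ∧ W' = Sw C a ++ [I st.b] ++ Iw (st.b :: K)) := by simp
  rw [this, ← h1]
  constructor
  · rintro ⟨_, ⟨T, rfl, h⟩ | ⟨T, rfl, h⟩, h'⟩
    · exact .inl ⟨T, h, h'⟩
    · exact .inr ⟨T, h, by simpa using h'⟩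
  · rintro (⟨T, h, h'⟩ | ⟨T, h, h'⟩)
    · exact ⟨_, .inl ⟨T, rfl, h⟩, h'⟩
    · exact ⟨_, .inr ⟨T, rfl, h⟩, by simpa using h'⟩

theorem line_base_pop {st : Stp C} {K : List C} (hs : st.s = true) (hn : (st.b :: K).Nodup)
    (a : ℕ) (O W' : List (Sym C)) :
    Line st (Sw C a ++ Iw (st.b :: K)) O W' ↔ O = Ew C a ++ Iw (st.b :: K) ∧
      W' = Sw C (a + 1) ++ Iw (K ++ [st.l]) := by
  rw [line_base_pop_aux hn]
  simp [Out, hs]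

/-- The step at the first letter where the left and the bottom boundary differ. -/
theorem line_base_open {st : Stp C} {K : List C} (hs : st.s = false) (hn : (st.b :: K).Nodup)
    (a : ℕ) (O W' : List (Sym C)) :
    Line st (Sw C a ++ Iw (st.b :: K)) O W' ↔ O = Ew C a ++ Iw (st.b :: K) ∧
      ((∃ A B, K = A ++ B ∧ B ≠ [] ∧ W' = Sw C (a + 1) ++ (Iw A ++ E :: Iw B)) ∨
        W' = Sw C a ++ Iw (st.b :: st.b :: K)) := by
  rw [line_base_pop_aux hn]
  simp [Out, hs]

end Lines

end TFPL

namespace TFPL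

open TFPL.Sym

/-! ### Double steps: a displaced `I`, a pair of ends of one arc, an opening step with a displaced
`S` -/

section Lines

variable {C : Type}

theorem fin_row_push {st : Stp C} {c : C} {K : List C} (hn : (st.b :: c :: K).Nodup) (a k : ℕ)
    (W' : List (Sym C)) :
    (∃ T, Half (Ew C a ++ I c :: (Ew C k ++ Iw K)) (some st.b) T ∧ Fin' st T W') ↔
      st.s = false ∧ W' = Sw C a ++ I st.b :: (Sw C k ++ Iw (c :: K)) := by
  have hne : c ≠ st.b := by rintro h; simp [h] at hn
  have := fin_some (st := st) hn.of_cons (Sw C a ++ I st.b :: Sw C k) W'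
  have h2 : Sw C a ++ I st.b :: (Sw C k ++ Iw (c :: K)) =
    (Sw C a ++ I st.b :: Sw C k) ++ Iw (c :: K) := by simp
  rw [h2, ← this]
  simp only [half_Ew, half_I_some, hne, false_and, false_or]
  constructor
  · rintro ⟨_, ⟨_, rfl, _, rfl, T, rfl, h⟩, h'⟩
    exact ⟨T, h, by simpa using h'⟩
  · rintro ⟨T, h, h'⟩
    exact ⟨_, ⟨_, rfl, _, rfl, T, rfl, h⟩, by simpa using h'⟩

/-- The new path takes the displaced place; the path that was there climbs through the `E`s and
joins the block. The only freedom is the climb in the first half. -/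
theorem line_row_push {st : Stp C} {c : C} {K : List C} (hs : st.s = false)
    (hn : (st.b :: c :: K).Nodup) (a k : ℕ) (O W' : List (Sym C)) :
    Line st (Sw C a ++ I c :: (Sw C (k + 1) ++ Iw K)) O W' ↔
      (O = Ew C a ++ I c :: (Ew C (k + 1) ++ Iw K) ∧
        W' = Sw C a ++ I st.b :: (Sw C (k + 1) ++ Iw (c :: K))) ∨
      (O = Ew C (a + 1) ++ I c :: (Ew C k ++ Iw K) ∧
        W' = Sw C (a + 1) ++ I st.b :: (Sw C k ++ Iw (c :: K))) := by
  rw [Line, half_row_top hn.of_cons.of_cons, or_and_right]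
  refine or_congr (and_congr_right ?_) (and_congr_right ?_)
  · rintro rfl
    rw [fin_row_push hn]; simp [hs]
  · rintro rfl
    rw [fin_row_push hn]; simp [hs]

theorem fin_row_pop {st : Stp C} {d : C} {K : List C} (hs : st.s = true)
    (hn : (st.b :: d :: K).Nodup) (a k : ℕ) (W' : List (Sym C)) :
    (∃ T, Half (Ew C a ++ I st.b :: (Ew C k ++ Iw (d :: K))) (some st.b) T ∧ Fin' st T W') ↔
      W' = Sw C (a + 1) ++ I d :: (Sw C k ++ Iw (K ++ [st.l])) := by
  have hd := hn.of_cons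
  have hK := hd.of_cons
  have h0 : ∀ T, Half (Ew C a ++ I st.b :: (Ew C k ++ Iw (d :: K))) (some st.b) T ↔ _ :=
    fun T => half_Ew a st.b _ T
  simp only [h0, half_I_some, true_and]
  constructor
  · rintro ⟨_, ⟨_, rfl, ⟨T, rfl, h⟩ | ⟨T, rfl, h⟩⟩, h'⟩
    · obtain _ | k := k
      · have := (fin_none hd (Sw C (a + 1)) W').1
          ⟨T, h, by simpa [List.replicate_succ'] using h'⟩
        simpa [Out, hs] using this
      -- After the arc is closed, the lowest `E` opens a path of some colour `x`. Its upper edge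
      -- runs through the other `E`s and must join the first path of the block, so `x = d`; else it
      -- would reach the top, which the letter `1` forbids.
      · obtain ⟨x, T, rfl, h⟩ := h
        obtain ⟨T, rfl, h1⟩ := (half_Ew k x _ T).1 h
        obtain ⟨rfl, T, rfl, h2⟩ | ⟨T, rfl, h2⟩ := half_I_some.1 h1
        · have := (fin_none hK (Sw C (a + 1) ++ I d :: Sw C (k + 1)) W').1
            ⟨T, h2, by simpa [List.replicate_succ'] using h'⟩
          simpa [Out, hs] using this
        · have := (fin_some hd (Sw C (a + 1) ++ I x :: (Sw C k ++ [I x])) W').1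
            ⟨T, h2, by simpa [List.replicate_succ'] using h'⟩
          simp [hs] at this
    · obtain ⟨T, rfl, h1⟩ := (half_Ew k st.b _ T).1 h
      have := (fin_some hn (Sw C a ++ I st.b :: Sw C k) W').1 ⟨T, h1, by simpa using h'⟩
      simp [hs] at this
  · rintro rfl
    obtain _ | k := k
    · obtain ⟨T, h, h'⟩ := (fin_none hd (Sw C (a + 1)) _).2
        (show Out st (d :: K) (Sw C (a + 1)) (Sw C (a + 1) ++ Iw (d :: K ++ [st.l])) by
          simp [Out, hs])
      exact ⟨_, ⟨_, rfl, .inl ⟨T, rfl, h⟩⟩, by simpa [List.replicate_succ'] using h'⟩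
    · obtain ⟨T, h, h'⟩ := (fin_none hK (Sw C (a + 1) ++ I d :: Sw C (k + 1)) _).2
        (show Out st K (Sw C (a + 1) ++ I d :: Sw C (k + 1))
            (Sw C (a + 1) ++ I d :: Sw C (k + 1) ++ Iw (K ++ [st.l])) by simp [Out, hs])
      refine ⟨_, ⟨_, rfl, .inl ⟨I d :: (Sw C k ++ S :: T), rfl, d, _, rfl, ?_⟩⟩,
        by simpa [List.replicate_succ'] using h'⟩
      exact (half_Ew k d _ _).2 ⟨S :: T, by simp, half_I_some.2 (.inl ⟨rfl, T, rfl, h⟩)⟩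

theorem line_row_pop {st : Stp C} {d : C} {K : List C} (hs : st.s = true)
    (hn : (st.b :: d :: K).Nodup) (a k : ℕ) (O W' : List (Sym C)) :
    Line st (Sw C a ++ I st.b :: (Sw C (k + 1) ++ Iw (d :: K))) O W' ↔
      (O = Ew C a ++ I st.b :: (Ew C (k + 1) ++ Iw (d :: K)) ∧
        W' = Sw C (a + 1) ++ I d :: (Sw C (k + 1) ++ Iw (K ++ [st.l]))) ∨
      (O = Ew C (a + 1) ++ I st.b :: (Ew C k ++ Iw (d :: K)) ∧
        W' = Sw C (a + 2) ++ I d :: (Sw C k ++ Iw (K ++ [st.l]))) := by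
  rw [Line, half_row_top hn.of_cons, or_and_right]
  refine or_congr (and_congr_right ?_) (and_congr_right ?_)
  · rintro rfl
    rw [fin_row_pop hs hn]
  · rintro rfl
    rw [fin_row_pop hs hn]

/-- The second half of a step for two paths of the same colour that are to be joined. -/
theorem fin_pair {st : Stp C} {x : C} {K : List C} (hs : st.s = true) (hb : x ≠ st.b)
    (hn : (x :: K).Nodup) (a k : ℕ) (W' : List (Sym C)) :
    (∃ T, Half (Ew C a ++ I x :: (Ew C k ++ I x :: Iw K)) (some st.b) T ∧ Fin' st T W') ↔
      W' = Sw C a ++ I st.b :: (Sw C (k + 1) ++ Iw (K ++ [st.l])) := by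
  have hK := hn.of_cons
  have := fin_none (st := st) hK (Sw C a ++ I st.b :: Sw C (k + 1)) W'
  simp only [Out, hs, if_true] at this
  rw [show Sw C a ++ I st.b :: (Sw C (k + 1) ++ Iw (K ++ [st.l])) =
    Sw C a ++ I st.b :: Sw C (k + 1) ++ Iw (K ++ [st.l]) by simp, ← this]
  simp only [half_Ew, half_I_some, hb, false_and, false_or, true_and]
  constructor
  · rintro ⟨_, ⟨_, rfl, _, rfl, _, rfl, ⟨T, rfl, h⟩ | ⟨T, rfl, h⟩⟩, h'⟩
    · exact ⟨T, h, by simpa [List.replicate_succ'] using h'⟩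
    · have := (fin_some hn (Sw C a ++ I st.b :: (Sw C k ++ [I x])) W').1
        ⟨T, h, by simpa [List.replicate_succ'] using h'⟩
      simp [hs] at this
  · rintro ⟨T, h, h'⟩
    exact ⟨_, ⟨_, rfl, _, rfl, _, rfl, .inl ⟨T, rfl, h⟩⟩, by simpa [List.replicate_succ'] using h'⟩

/-- For the left letter `1` nothing may reach the top, so the two ends of colour `x` must join now.
The external path takes the place of the lower end, which may have climbed one place in the first
half. -/
theorem line_pair_row {st : Stp C} {x : C} {K : List C} (hs : st.s = true) (hb : x ≠ st.b)
    (hn : (x :: K).Nodup) (a k : ℕ) : ∃ O₁ O₂ : List (Sym C), ∀ O W',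
    Line st (Sw C a ++ I x :: (Sw C k ++ I x :: Iw K)) O W' ↔
      (O = O₁ ∧ W' = Sw C a ++ I st.b :: (Sw C (k + 1) ++ Iw (K ++ [st.l]))) ∨
      (O = O₂ ∧ W' = Sw C (a + 1) ++ I st.b :: (Sw C k ++ Iw (K ++ [st.l]))) := by
  have hK := hn.of_cons
  obtain _ | k := k
  -- With no `S` between the ends, climbing one place means joining already in the first half.
  · refine ⟨Ew C a ++ I x :: I x :: Iw K, Ew C a ++ E :: S :: Iw K, fun O W' => ?_⟩
    have h0 := half_pair_top (A := []) hn a O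
    have h1 := fin_pair hs hb hn a 0 W'
    simp only [List.nil_append, List.nil_eq, List.append_eq_nil_iff, List.map_nil,
      List.replicate_zero] at h0 h1 ⊢
    rw [Line, h0, or_and_right]
    refine or_congr (and_congr_right ?_) ?_
    · rintro rfl
      exact h1
    · have h2 : (∃ A₁ A₂ : List C, (A₁ = [] ∧ A₂ = []) ∧
          O = Ew C a ++ (Iw A₁ ++ E :: (Iw A₂ ++ S :: Iw K))) ↔ O = Ew C a ++ E :: S :: Iw K := by
        constructor
        · rintro ⟨_, _, ⟨rfl, rfl⟩, rfl⟩; simp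
        · rintro rfl; exact ⟨[], [], by simp⟩
      rw [h2]
      refine and_congr_right ?_
      rintro rfl
      have := fin_none (st := st) hK (Sw C (a + 1) ++ [I st.b]) W'
      simp only [Out, hs, if_true] at this
      rw [show Sw C (a + 1) ++ I st.b :: Iw (K ++ [st.l]) =
        Sw C (a + 1) ++ [I st.b] ++ Iw (K ++ [st.l]) by simp, ← this]
      simp only [half_Ew, Half]
      constructor
      · rintro ⟨_, ⟨_, rfl, _, rfl, T, rfl, h⟩, h'⟩
        exact ⟨T, h, by simpa [List.replicate_succ'] using h'⟩
      · rintro ⟨T, h, h'⟩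
        exact ⟨_, ⟨_, rfl, _, rfl, T, rfl, h⟩, by simpa [List.replicate_succ'] using h'⟩
  · refine ⟨Ew C a ++ I x :: (Ew C (k + 1) ++ I x :: Iw K),
      Ew C (a + 1) ++ I x :: (Ew C k ++ I x :: Iw K), fun O W' => ?_⟩
    have h0 := half_row_top hn a k x O
    have h0' : Half (Sw C a ++ I x :: (Sw C (k + 1) ++ I x :: Iw K)) none (O ++ [E]) ↔ _ := h0
    rw [Line, h0', or_and_right]
    refine or_congr (and_congr_right ?_) (and_congr_right ?_)
    · rintro rfl
      exact fin_pair hs hb hn a _ W'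
    · rintro rfl
      exact fin_pair hs hb hn _ _ W'

/-- The paths below the first gap after a step that opens a new arc. -/
theorem half_push_prefix {A A' : List C} {b e : C} (hn : (b :: A).Nodup) (h : b :: A = A' ++ [e])
    (a : ℕ) (w T : List (Sym C)) :
    Half (Ew C a ++ (Iw A ++ E :: w)) (some b) T ↔
      ∃ T', T = Sw C a ++ (Iw A' ++ S :: T') ∧ Half w (some e) T' := by
  rw [half_Ew]
  simp only [half_Iw_some hn h, Half]
  constructor
  · rintro ⟨_, rfl, _, rfl, T, rfl, h⟩; exact ⟨T, rfl, h⟩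
  · rintro ⟨T, rfl, h⟩; exact ⟨_, rfl, _, rfl, T, rfl, h⟩

theorem take_drop_cons {A A₁ A₂ A' : List C} {b e : C} (hA : A = A₁ ++ A₂)
    (h : b :: A₁ = A' ++ [e]) :
    (b :: A).take A₁.length = A' ∧ (b :: A).drop A₁.length = e :: A₂ := by
  have hl : A₁.length = A'.length := by
    have := congrArg List.length h
    simpa using this
  have : b :: A = A' ++ e :: A₂ := by
    rw [hA, ← List.cons_append, h]; simp
  rw [this, hl]
  simp

theorem exists_split_iff {A : List C} {p : List C → List C → Prop} :
    (∃ A₁ A₂, A = A₁ ++ A₂ ∧ p A₁ A₂) ↔ ∃ j ≤ A.length, p (A.take j) (A.drop j) := by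
  constructor
  · rintro ⟨A₁, A₂, rfl, h⟩
    exact ⟨A₁.length, by simp, by simpa using h⟩
  · rintro ⟨j, -, h⟩
    exact ⟨_, _, (List.take_append_drop j A).symm, h⟩

/-- The first half opens a gap above `j` paths, the upper ones moving into the place of the `S`. The
entering path shifts everything below the gap and turns it into the new `S`. -/
theorem line_col_push {st : Stp C} {A K : List C} (hs : st.s = false)
    (hn : (st.b :: (A ++ K)).Nodup) (a : ℕ) : ∃ Oj : ℕ → List (Sym C), ∀ O W',
    Line st (Sw C a ++ (Iw A ++ S :: Iw K)) O W' ↔ ∃ j ≤ A.length, O = Oj j ∧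
      W' = Sw C a ++ (Iw ((st.b :: A).take j) ++ S :: Iw ((st.b :: A).drop j ++ K)) := by
  have hAK := hn.of_cons
  have hA := hAK.of_append_left
  have hK := hAK.of_append_right
  refine ⟨fun j => Ew C a ++ (Iw (A.take j) ++ E :: (Iw (A.drop j) ++ Iw K)), fun O W' => ?_⟩
  refine Iff.trans ?_ ((exists_split_iff (A := A)
    (p := fun A₁ A₂ => O = Ew C a ++ (Iw A₁ ++ E :: (Iw A₂ ++ Iw K)) ∧
    W' = Sw C a ++ (Iw ((st.b :: A).take A₁.length) ++
      S :: Iw ((st.b :: A).drop A₁.length ++ K)))).trans ?_)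
  · rw [Line, half_col_top hA]
    simp only [half_Iw_none_top hK]
    have key : ∀ A₁ A₂, A = A₁ ++ A₂ →
        ((∃ T, Half (Ew C a ++ (Iw A₁ ++ E :: (Iw A₂ ++ Iw K))) (some st.b) T ∧ Fin' st T W') ↔
          W' = Sw C a ++ (Iw ((st.b :: A).take A₁.length) ++
            S :: Iw ((st.b :: A).drop A₁.length ++ K))) := by
      intro A₁ A₂ hA12
      obtain ⟨A', e, h⟩ : ∃ A' e, st.b :: A₁ = A' ++ [e] :=
        ⟨_, _, (List.dropLast_append_getLast (List.cons_ne_nil _ _)).symm⟩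
      obtain ⟨h1, h2⟩ := take_drop_cons hA12 h
      have hn2 : (A' ++ (e :: (A₂ ++ K))).Nodup := by
        have : A' ++ (e :: (A₂ ++ K)) = st.b :: (A ++ K) := by
          rw [hA12, List.append_assoc,
            show st.b :: (A₁ ++ (A₂ ++ K)) = (st.b :: A₁) ++ (A₂ ++ K) from rfl, h]
          simp
        rwa [this]
      have hn1 : (st.b :: A₁).Nodup := by
        rw [hA12] at hn
        exact hn.sublist (by simp)
      have := fin_some (st := st) hn2.of_append_right (Sw C a ++ (Iw A' ++ [S])) W'
      rw [hs] at this
      simp only [true_and] at this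
      rw [h1, h2, show Sw C a ++ (Iw A' ++ S :: Iw (e :: A₂ ++ K)) =
        Sw C a ++ (Iw A' ++ [S]) ++ Iw (e :: (A₂ ++ K)) by simp, ← this]
      simp only [half_push_prefix hn1 h, List.map_append]
      constructor
      · rintro ⟨_, ⟨T, rfl, h⟩, h'⟩; exact ⟨T, h, by simpa using h'⟩
      · rintro ⟨T, h, h'⟩; exact ⟨_, ⟨T, rfl, h⟩, by simpa using h'⟩
    constructor
    · rintro ⟨⟨A₁, A₂, _, h1, rfl, rfl⟩, h⟩
      exact ⟨A₁, A₂, h1, rfl, (key A₁ A₂ h1).1 h⟩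
    · rintro ⟨A₁, A₂, h1, rfl, h⟩
      exact ⟨⟨A₁, A₂, _, h1, rfl, rfl⟩, (key A₁ A₂ h1).2 h⟩
  · refine exists_congr fun j => and_congr_right fun hj => ?_
    rw [List.length_take, min_eq_left hj]

end Lines

end TFPL

namespace TFPL

open TFPL.Sym

/-! ### Double steps: closing steps with a displaced `S`, gaps, pairs under new arcs -/

section Lines

variable {C : Type}

theorem half_Iw_E_some_top {B D : List C} {c d : C} (hn : (d :: (B ++ c :: D)).Nodup)
    (V : List (Sym C)) : ¬ Half (Iw B ++ E :: Iw (c :: D)) (some d) (V ++ [E]) := by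
  obtain ⟨A', e, h⟩ : ∃ A' e, d :: B = A' ++ [e] :=
    ⟨_, _, (List.dropLast_append_getLast (List.cons_ne_nil _ _)).symm⟩
  have hn1 : (d :: B).Nodup := hn.sublist (by simp)
  have hn2 : ((d :: B) ++ c :: D).Nodup := hn
  rw [half_Iw_some hn1 h, half_top_iff]
  rintro ⟨V', -, h3⟩
  refine half_E_Iw_some_top hn2.of_append_right ?_ _ h3
  exact List.disjoint_of_nodup_append hn2 (by rw [h]; simp)

theorem fin_true {st : Stp C} (hs : st.s = true) (w X W' : List (Sym C)) (k : Option C) :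
    (∃ T, Half w k T ∧ Fin' st (X ++ T) W') ↔
      ∃ V, Half w k (V ++ [E]) ∧ W' = X ++ V ++ [I st.l] := by
  simp only [Fin', hs, if_true]
  constructor
  · rintro ⟨T, h, V, h1, rfl⟩
    obtain ⟨V, rfl, h3⟩ := half_top_iff.1 ⟨T, h1.symm, h⟩
    exact ⟨V, h3, rfl⟩
  · rintro ⟨V, h, rfl⟩
    exact ⟨_, h, X ++ V, by simp, rfl⟩

/-- If the gap is lowest, the external path turns it into `S` and then joins its arc just above.
Otherwise it joins first, and the gap must be filled by the colour of the next path, as in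
`half_Iw_E_top`. -/
theorem fin_col_pop {st : Stp C} {A₁ G Q : List C} (hs : st.s = true)
    (hn : (A₁ ++ G).Nodup) (hG : G ≠ []) (hQ : A₁ ++ G = st.b :: Q) (a : ℕ) (W' : List (Sym C)) :
    (∃ T, Half (Ew C a ++ (Iw A₁ ++ E :: Iw G)) (some st.b) T ∧ Fin' st T W') ↔
      W' = Sw C (a + 1) ++ (Iw (Q.take A₁.length) ++ S :: Iw (Q.drop A₁.length ++ [st.l])) := by
  obtain _ | ⟨b, A₁⟩ := A₁
  · simp only [List.nil_append] at hQ
    subst hQ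
    have hQ : Q.Nodup := hn.of_cons
    have h1 := fin_none (st := st) hQ (Sw C (a + 2)) W'
    simp only [Out, hs, if_true] at h1
    have h2 := fin_some (st := st) hn (Sw C (a + 1) ++ [I st.b]) W'
    simp only [hs] at h2
    have h3 := fun T => half_Ew_pop (K := Q) (b := st.b) (a + 1) [] T
    have h4 : Sw C (a + 1) ++ (Iw (Q.take 0) ++ S :: Iw (Q.drop 0 ++ [st.l])) =
      Sw C (a + 2) ++ Iw (Q ++ [st.l]) := by
      simp [List.replicate_succ' (n := a + 1)]
    rw [List.length_nil, h4, ← h1]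
    have h5 : Ew C a ++ (Iw [] ++ E :: Iw (st.b :: Q)) = Ew C (a + 1) ++ Iw (st.b :: Q) := by
      simp [List.replicate_succ' (n := a)]
    simp only [List.append_nil] at h3
    rw [h5]
    simp only [h3]
    constructor
    · rintro ⟨_, ⟨T, rfl, h⟩ | ⟨T, rfl, h⟩, h'⟩
      · exact ⟨T, h, h'⟩
      · exact absurd (h2.1 ⟨T, h, by simpa using h'⟩) (by simp)
    · rintro ⟨T, h, h'⟩
      exact ⟨_, .inl ⟨T, rfl, h⟩, h'⟩
  · obtain _ | ⟨c, G⟩ := G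
    · exact absurd rfl hG
    · simp only [List.cons_append, List.cons.injEq] at hQ
      obtain ⟨rfl, rfl⟩ := hQ
      have hn' : (A₁ ++ c :: G).Nodup := hn.of_cons
      have h3 := fun T => half_Ew_pop (K := A₁) (b := st.b) a (E :: Iw (c :: G)) T
      have h5 : Ew C a ++ (Iw (st.b :: A₁) ++ E :: Iw (c :: G)) =
        Ew C a ++ Iw (st.b :: A₁) ++ E :: Iw (c :: G) := by simp
      have h1 := fin_true hs (Iw A₁ ++ E :: Iw (c :: G)) (Sw C (a + 1)) W' none
      have h2 := fin_true hs (Iw A₁ ++ E :: Iw (c :: G)) (Sw C a ++ [I st.b]) W' (some st.b)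
      simp only [half_Iw_E_top hn'] at h1
      simp only [half_Iw_E_some_top hn] at h2
      have h4 : Sw C (a + 1) ++ (Iw ((A₁ ++ c :: G).take (st.b :: A₁).length) ++
          S :: Iw ((A₁ ++ c :: G).drop (st.b :: A₁).length ++ [st.l])) =
          Sw C (a + 1) ++ (Iw A₁ ++ I c :: S :: Iw G) ++ [I st.l] := by
        have : (st.b :: A₁).length = (A₁ ++ [c]).length := by simp
        rw [this, show A₁ ++ c :: G = (A₁ ++ [c]) ++ G by simp, List.take_left', List.drop_left']
          <;> simp
      rw [h4, h5]
      simp only [exists_eq_left] at h1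
      rw [← h1]
      simp only [h3]
      constructor
      · rintro ⟨_, ⟨T, rfl, h⟩ | ⟨T, rfl, h⟩, h'⟩
        · exact ⟨T, h, h'⟩
        · exact absurd (h2.1 ⟨T, h, by simpa using h'⟩) (by simp)
      · rintro ⟨T, h, h'⟩
        exact ⟨_, .inl ⟨T, rfl, h⟩, h'⟩

theorem line_col_pop {st : Stp C} {A K Q : List C} (hs : st.s = true) (hn : (A ++ K).Nodup)
    (hK0 : K ≠ []) (hQ : A ++ K = st.b :: Q) (a : ℕ) : ∃ Oj : ℕ → List (Sym C), ∀ O W',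
    Line st (Sw C a ++ (Iw A ++ S :: Iw K)) O W' ↔ ∃ j ≤ A.length, O = Oj j ∧
      W' = Sw C (a + 1) ++ (Iw (Q.take j) ++ S :: Iw (Q.drop j ++ [st.l])) := by
  have hA := hn.of_append_left
  have hK := hn.of_append_right
  refine ⟨fun j => Ew C a ++ (Iw (A.take j) ++ E :: (Iw (A.drop j) ++ Iw K)), fun O W' => ?_⟩
  refine Iff.trans ?_ ((exists_split_iff (A := A)
    (p := fun A₁ A₂ => O = Ew C a ++ (Iw A₁ ++ E :: (Iw A₂ ++ Iw K)) ∧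
    W' = Sw C (a + 1) ++ (Iw (Q.take A₁.length) ++
      S :: Iw (Q.drop A₁.length ++ [st.l])))).trans ?_)
  · rw [Line, half_col_top hA]
    simp only [half_Iw_none_top hK]
    have key : ∀ A₁ A₂, A = A₁ ++ A₂ →
        ((∃ T, Half (Ew C a ++ (Iw A₁ ++ E :: (Iw A₂ ++ Iw K))) (some st.b) T ∧ Fin' st T W') ↔
          W' = Sw C (a + 1) ++ (Iw (Q.take A₁.length) ++
      S :: Iw (Q.drop A₁.length ++ [st.l]))) := by
      intro A₁ A₂ hA12
      rw [hA12, List.append_assoc] at hn hQ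
      rw [← List.map_append]
      exact fin_col_pop hs hn (by simp [hK0]) hQ a W'
    constructor
    · rintro ⟨⟨A₁, A₂, _, h1, rfl, rfl⟩, h⟩
      exact ⟨A₁, A₂, h1, rfl, (key A₁ A₂ h1).1 h⟩
    · rintro ⟨A₁, A₂, h1, rfl, h⟩
      exact ⟨⟨A₁, A₂, _, h1, rfl, rfl⟩, (key A₁ A₂ h1).2 h⟩
  · refine exists_congr fun j => and_congr_right fun hj => ?_
    rw [List.length_take, min_eq_left hj]

theorem fin_push_S {st : Stp C} {A₁ G D : List C} (hn : (st.b :: (A₁ ++ G)).Nodup)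
    (hD : D.Nodup) (a : ℕ) (W' : List (Sym C)) :
    (∃ T, Half (Ew C a ++ (Iw A₁ ++ E :: (Iw G ++ S :: Iw D))) (some st.b) T ∧ Fin' st T W') ↔
      Out st D (Sw C a ++ (Iw ((st.b :: (A₁ ++ G)).take A₁.length) ++
        S :: Iw ((st.b :: (A₁ ++ G)).drop A₁.length))) W' := by
  obtain ⟨A', e, h⟩ : ∃ A' e, st.b :: A₁ = A' ++ [e] :=
    ⟨_, _, (List.dropLast_append_getLast (List.cons_ne_nil _ _)).symm⟩
  obtain ⟨h1, h2⟩ := take_drop_cons (rfl : A₁ ++ G = A₁ ++ G) h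
  have hn2 : (A' ++ (e :: G)).Nodup := by
    have : A' ++ (e :: G) = (st.b :: A₁) ++ G := by rw [h]; simp
    rwa [this]
  have hn1 : (st.b :: A₁).Nodup := hn.sublist (by simp)
  rw [h1, h2, ← fin_none hD]
  simp only [half_push_prefix hn1 h, half_Iw_some_S hn2.of_append_right]
  constructor
  · rintro ⟨_, ⟨_, rfl, T, rfl, h⟩, h'⟩; exact ⟨T, h, by simpa using h'⟩
  · rintro ⟨T, h, h'⟩; exact ⟨_, ⟨_, rfl, T, rfl, h⟩, by simpa using h'⟩

/-- The gap is filled in the first half, which leaves an `S` above `c`; this `S` absorbs the push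
caused by the external path. So the block `D` above it evolves freely, described by `Out`: a new gap
opens in `D` for the letter `0` and none for `1`. -/
theorem line_gap_push {st : Stp C} {A B D : List C} {c : C}
    (hn : (st.b :: (A ++ B ++ c :: D)).Nodup) (a : ℕ) : ∃ Oj : ℕ → List (Sym C), ∀ O W',
    Line st (Sw C a ++ (Iw A ++ S :: (Iw B ++ E :: Iw (c :: D)))) O W' ↔
      ∃ j ≤ A.length, O = Oj j ∧ Out st D (Sw C a ++ (Iw ((st.b :: A).take j) ++
        S :: Iw ((st.b :: A).drop j ++ B ++ [c]))) W' := by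
  have hABD := hn.of_cons
  rw [List.append_assoc] at hABD
  have hA := hABD.of_append_left
  have hBD := hABD.of_append_right
  have hD := hBD.of_append_right.of_cons
  refine ⟨fun j => Ew C a ++ (Iw (A.take j) ++
    E :: (Iw (A.drop j) ++ (Iw B ++ I c :: S :: Iw D))), fun O W' => ?_⟩
  refine Iff.trans ?_ ((exists_split_iff (A := A)
    (p := fun A₁ A₂ => O = Ew C a ++ (Iw A₁ ++ E :: (Iw A₂ ++ (Iw B ++ I c :: S :: Iw D))) ∧
    Out st D (Sw C a ++ (Iw ((st.b :: A).take A₁.length) ++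
      S :: Iw ((st.b :: A).drop A₁.length ++ B ++ [c]))) W')).trans ?_)
  · rw [Line, half_col_top hA]
    simp only [half_Iw_E_top hBD]
    have key : ∀ A₁ A₂, A = A₁ ++ A₂ →
        ((∃ T, Half (Ew C a ++ (Iw A₁ ++ E :: (Iw A₂ ++ (Iw B ++ I c :: S :: Iw D))))
          (some st.b) T ∧ Fin' st T W') ↔
          Out st D (Sw C a ++ (Iw ((st.b :: A).take A₁.length) ++
            S :: Iw ((st.b :: A).drop A₁.length ++ B ++ [c]))) W') := by
      intro A₁ A₂ hA12
      have hn3 : (st.b :: (A₁ ++ (A₂ ++ B ++ [c]))).Nodup := by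
        refine hn.sublist ?_
        rw [hA12]
        simp
      have h := fin_push_S hn3 hD a W'
      rw [show Iw A₂ ++ (Iw B ++ I c :: S :: Iw D) = Iw (A₂ ++ B ++ [c]) ++ S :: Iw D by simp, h]
      have hle : A₁.length ≤ (st.b :: A).length := by
        rw [hA12]; simp; omega
      have : st.b :: (A₁ ++ (A₂ ++ B ++ [c])) = (st.b :: A) ++ (B ++ [c]) := by rw [hA12]; simp
      rw [this, List.take_append_of_le_length hle, List.drop_append_of_le_length hle,
        List.append_assoc]
    constructor
    · rintro ⟨⟨A₁, A₂, _, h1, rfl, rfl⟩, h⟩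
      exact ⟨A₁, A₂, h1, rfl, (key A₁ A₂ h1).1 h⟩
    · rintro ⟨A₁, A₂, h1, rfl, h⟩
      exact ⟨⟨A₁, A₂, _, h1, rfl, rfl⟩, (key A₁ A₂ h1).2 h⟩
  · refine exists_congr fun j => and_congr_right fun hj => ?_
    rw [List.length_take, min_eq_left hj]

/-- The first half is forced and puts an `S` above `c`. If the external path joins its arc, a gap
opens again at or below the old level; if not, a pair is formed and the `S` absorbs the push. -/
theorem line_gap_pop {st : Stp C} {B D Q : List C} {c : C} (hs : st.s = true)
    (hn : (B ++ c :: D).Nodup) (hQ : B ++ [c] = st.b :: Q) (a : ℕ) : ∃ O₀ : List (Sym C), ∀ O W',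
    Line st (Sw C a ++ (Iw B ++ E :: Iw (c :: D))) O W' ↔
      O = O₀ ∧ ((∃ j ≤ Q.length, W' = Sw C (a + 1) ++ (Iw (Q.take j) ++
        E :: Iw (Q.drop j ++ D ++ [st.l]))) ∨
        W' = Sw C a ++ Iw (st.b :: st.b :: (Q ++ D ++ [st.l]))) := by
  refine ⟨Ew C a ++ Iw (st.b :: Q) ++ S :: Iw D, fun O W' => ?_⟩
  have hn2 : (st.b :: Q ++ D).Nodup := by
    rw [← hQ]; simpa using hn
  have hbQ := hn2.of_append_left
  have hQ' := hbQ.of_cons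
  have hD := hn2.of_append_right
  rw [Line, half_Sw_top]
  simp only [half_Iw_E_top hn, exists_eq_right]
  have h1 : Ew C a ++ (Iw B ++ I c :: S :: Iw D) = Ew C a ++ Iw (st.b :: Q) ++ S :: Iw D := by
    rw [← hQ]; simp
  rw [h1]
  refine and_congr_right ?_
  rintro rfl
  simp only [half_Ew_pop, half_Iw_none_S hQ', half_Iw_some_S hbQ]
  have h2 := fun X => fin_none (st := st) hD X W'
  simp only [Out, hs, if_true] at h2
  rw [← exists_split_iff (A := Q) (p := fun A₁ A₂ => W' = Sw C (a + 1) ++ (Iw A₁ ++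
        E :: Iw (A₂ ++ D ++ [st.l])))]
  constructor
  · rintro ⟨_, ⟨_, rfl, A₁, A₂, T, rfl, rfl, h⟩ | ⟨_, rfl, T, rfl, h⟩, h'⟩
    · left
      refine ⟨A₁, A₂, rfl, ?_⟩
      rw [(h2 (Sw C (a + 1) ++ (Iw A₁ ++ E :: Iw A₂))).1 ⟨T, h, by simpa using h'⟩]
      simp
    · right
      rw [(h2 (Sw C a ++ I st.b :: Iw (st.b :: Q))).1 ⟨T, h, by simpa using h'⟩]
      simp
  · rintro (⟨A₁, A₂, rfl, rfl⟩ | rfl)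
    · obtain ⟨T, h, h'⟩ := (h2 (Sw C (a + 1) ++ (Iw A₁ ++ E :: Iw A₂))).2 (by simp)
      exact ⟨_, .inl ⟨_, rfl, A₁, A₂, T, rfl, rfl, h⟩, by simpa using h'⟩
    · obtain ⟨T, h, h'⟩ := (h2 (Sw C a ++ I st.b :: Iw (st.b :: Q))).2 (by simp)
      exact ⟨_, .inr ⟨_, rfl, T, rfl, h⟩, by simpa using h'⟩

/-- The two ends either stay side by side or join. Joining removes a push from the paths `K` above,
so these then behave as in `Out`, and the resulting `S` lands above `j` paths. -/
theorem line_pair_col {st : Stp C} {A K : List C} {x : C}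
    (hn : (st.b :: (A ++ x :: K)).Nodup) (a : ℕ) :
    ∃ (O₁ : List (Sym C)) (Oj : ℕ → List (Sym C)), ∀ O W',
    Line st (Sw C a ++ (Iw A ++ I x :: I x :: Iw K)) O W' ↔
      (O = O₁ ∧ st.s = false ∧ W' = Sw C a ++ (Iw (st.b :: A) ++ I x :: I x :: Iw K)) ∨
      ∃ j ≤ A.length + 1, O = Oj j ∧ Out st K (Sw C a ++ (Iw ((st.b :: A).take j) ++
        S :: Iw ((st.b :: A).drop j))) W' := by
  have hAK := hn.of_cons
  have hx := hAK.of_append_right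
  have hK := hx.of_cons
  -- The value `j = A.length + 1` stands for joining only in the second half; for smaller `j` the
  -- ends join in the first half, leaving a gap above `j` paths.
  refine ⟨Ew C a ++ (Iw A ++ I x :: I x :: Iw K), fun j => if j = A.length + 1 then
    Ew C a ++ (Iw A ++ I x :: I x :: Iw K) else
    Ew C a ++ (Iw (A.take j) ++ E :: (Iw (A.drop j) ++ S :: Iw K)), fun O W' => ?_⟩
  rw [Line, half_pair_top hAK, or_and_right]
  have hj : (∃ j ≤ A.length + 1, O = (if j = A.length + 1 then
    Ew C a ++ (Iw A ++ I x :: I x :: Iw K) else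
    Ew C a ++ (Iw (A.take j) ++ E :: (Iw (A.drop j) ++ S :: Iw K))) ∧
      Out st K (Sw C a ++ (Iw ((st.b :: A).take j) ++ S :: Iw ((st.b :: A).drop j))) W') ↔
      (O = Ew C a ++ (Iw A ++ I x :: I x :: Iw K) ∧
        Out st K (Sw C a ++ (Iw (st.b :: A) ++ [S])) W') ∨
      ∃ j ≤ A.length, O = Ew C a ++ (Iw (A.take j) ++ E :: (Iw (A.drop j) ++ S :: Iw K)) ∧
        Out st K (Sw C a ++ (Iw ((st.b :: A).take j) ++ S :: Iw ((st.b :: A).drop j))) W' := by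
    constructor
    · rintro ⟨j, hj, h1, h2⟩
      by_cases h : j = A.length + 1
      · subst h
        left
        rw [if_pos rfl] at h1
        rw [List.take_of_length_le (by simp), List.drop_of_length_le (by simp)] at h2
        simpa using ⟨h1, h2⟩
      · rw [if_neg h] at h1
        exact .inr ⟨j, by omega, h1, h2⟩
    · rintro (⟨h1, h2⟩ | ⟨j, hj, h1, h2⟩)
      · refine ⟨A.length + 1, le_rfl, by simpa using h1, ?_⟩
        rw [List.take_of_length_le (by simp), List.drop_of_length_le (by simp)]
        simpa using h2
      · exact ⟨j, by omega, by rw [if_neg (by omega)]; exact h1, h2⟩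
  rw [hj, ← or_assoc]
  refine or_congr ?_ ?_
  · rw [← and_or_left]
    refine and_congr_right ?_
    rintro rfl
    obtain ⟨A', e, h⟩ : ∃ A' e, st.b :: A = A' ++ [e] :=
      ⟨_, _, (List.dropLast_append_getLast (List.cons_ne_nil _ _)).symm⟩
    have hn1 : ((st.b :: A) ++ x :: K).Nodup := hn
    have hbA := hn1.of_append_left
    have hne : x ≠ e := by
      rintro rfl
      exact List.disjoint_of_nodup_append hn1 (a := x) (by rw [h]; simp) (by simp)
    simp only [half_Ew, half_Iw_some hbA h, half_I_some, hne, false_and, false_or, true_and]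
    have h2 := fin_none (st := st) hK (Sw C a ++ (Iw (st.b :: A) ++ [S])) W'
    have h3 := fin_some (st := st) hx (Sw C a ++ (Iw (st.b :: A) ++ [I x])) W'
    have h4 : Sw C a ++ (Iw (st.b :: A) ++ I x :: I x :: Iw K) =
      Sw C a ++ (Iw (st.b :: A) ++ [I x]) ++ Iw (x :: K) := by simp
    rw [h4, ← h2, ← h3, h]
    constructor
    · rintro ⟨_, ⟨_, rfl, _, rfl, _, rfl, ⟨T, rfl, h⟩ | ⟨T, rfl, h⟩⟩, h'⟩
      · exact .inr ⟨T, h, by simpa using h'⟩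
      · exact .inl ⟨T, h, by simpa using h'⟩
    · rintro (⟨T, h, h'⟩ | ⟨T, h, h'⟩)
      · exact ⟨_, ⟨_, rfl, _, rfl, _, rfl, .inr ⟨T, rfl, h⟩⟩, by simpa using h'⟩
      · exact ⟨_, ⟨_, rfl, _, rfl, _, rfl, .inl ⟨T, rfl, h⟩⟩, by simpa using h'⟩
  · refine Iff.trans ?_ ((exists_split_iff (A := A)
      (p := fun A₁ A₂ => O = Ew C a ++ (Iw A₁ ++ E :: (Iw A₂ ++ S :: Iw K)) ∧
        Out st K (Sw C a ++ (Iw ((st.b :: A).take A₁.length) ++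
          S :: Iw ((st.b :: A).drop A₁.length))) W')).trans ?_)
    · have key : ∀ A₁ A₂, A = A₁ ++ A₂ → ((∃ T, Half (Ew C a ++ (Iw A₁ ++ E ::
          (Iw A₂ ++ S :: Iw K))) (some st.b) T ∧ Fin' st T W') ↔
          Out st K (Sw C a ++ (Iw ((st.b :: A).take A₁.length) ++
            S :: Iw ((st.b :: A).drop A₁.length))) W') := by
        rintro A₁ A₂ rfl
        exact fin_push_S (hn.sublist (by simp)) hK a W'
      constructor
      · rintro ⟨⟨A₁, A₂, h1, rfl⟩, h⟩
        exact ⟨A₁, A₂, h1, rfl, (key A₁ A₂ h1).1 h⟩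
      · rintro ⟨A₁, A₂, h1, rfl, h⟩
        exact ⟨⟨A₁, A₂, h1, rfl⟩, (key A₁ A₂ h1).2 h⟩
    · refine exists_congr fun j => and_congr_right fun hj => ?_
      rw [List.length_take, min_eq_left hj]

end Lines

end TFPL

namespace TFPL

open TFPL.Sym

/-! ### Counting the runs: no defect, a displaced `I`, a displaced `S` -/

section Counting

/-- Change of colours. -/
def Sym.map {C C' : Type} (g : C → C') : Sym C → Sym C'
  | S => S
  | I c => I (g c)
  | E => E

variable {C : Type}

/-- Forget the colours. -/
def fg (w : List (Sym C)) : List (Sym Unit) := w.map (Sym.map fun _ => ())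

@[simp] theorem fg_nil : fg ([] : List (Sym C)) = [] := rfl
@[simp] theorem fg_append (v w : List (Sym C)) : fg (v ++ w) = fg v ++ fg w := List.map_append
@[simp] theorem fg_cons_S (w : List (Sym C)) : fg (S :: w) = S :: fg w := rfl
@[simp] theorem fg_cons_E (w : List (Sym C)) : fg (E :: w) = E :: fg w := rfl
@[simp] theorem fg_cons_I (c : C) (w : List (Sym C)) : fg (I c :: w) = I () :: fg w := rfl
@[simp] theorem fg_Sw (a : ℕ) : fg (Sw C a) = Sw Unit a := List.map_replicate
@[simp] theorem fg_Iw (K : List C) : fg (Iw K) = List.replicate K.length (I ()) := by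
  induction K with
  | nil => rfl
  | cons c K ih => simp only [List.map_cons, fg_cons_I, ih, List.length_cons, List.replicate_succ]

theorem replicate_append_cons_inj {α : Type} {x y z : α} (hy : x ≠ y) (hz : x ≠ z) {k k' : ℕ}
    {X Y : List α} (h : List.replicate k x ++ y :: X = List.replicate k' x ++ z :: Y) :
    k = k' ∧ y = z ∧ X = Y := by
  induction k generalizing k' with
  | zero => cases k' <;> simp_all [List.replicate_succ]
  | succ k ih =>
    cases k' with
    | zero => simp_all [List.replicate_succ]
    | succ k' =>
      simp only [List.replicate_succ, List.cons_append, List.cons.injEq, true_and] at h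
      simpa using ih h

/-- The states at the end of a configuration. -/
def Final (W : List (Sym C)) : Prop := ∃ a K, W = Sw C a ++ Iw K

/-- The sequences of states, without the colours, that can follow `W`. -/
def Runs : List (Stp C) → List (Sym C) → Set (List (List (Sym Unit) × List (Sym Unit)))
  | [], W => {u | u = [] ∧ Final W}
  | st :: ss, W =>
      {u | ∃ O W' u', Line st W O W' ∧ u' ∈ Runs ss W' ∧ u = (fg O, fg W') :: u'}

/-- Branches with different uncoloured words on the even antidiagonal give disjoint sets of runs, so
the counts add up, even if some branches share the odd antidiagonal. -/
theorem runs_cons {ι : Type} {st : Stp C} {ss : List (Stp C)} {W : List (Sym C)} (J : Finset ι)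
    (Oj Wj : ι → List (Sym C)) (h : ∀ O W', Line st W O W' ↔ ∃ j ∈ J, O = Oj j ∧ W' = Wj j)
    (hinj : ∀ i ∈ J, ∀ j ∈ J, fg (Wj i) = fg (Wj j) → i = j) (c : ι → ℕ)
    (hc : ∀ j ∈ J, (Runs ss (Wj j)).encard = c j) :
    (Runs (st :: ss) W).encard = (∑ j ∈ J, c j : ℕ) := by
  have h1 : Runs (st :: ss) W =
      ⋃ j ∈ J, (fun u' => (fg (Oj j), fg (Wj j)) :: u') '' Runs ss (Wj j) := by
    ext u
    simp only [Runs, Set.mem_ofPred_eq, h, Set.mem_iUnion, Set.mem_image, exists_prop]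
    constructor
    · rintro ⟨_, _, u', ⟨j, hj, rfl, rfl⟩, hu, rfl⟩
      exact ⟨j, hj, u', hu, rfl⟩
    · rintro ⟨j, hj, u', hu, rfl⟩
      exact ⟨_, _, u', ⟨j, hj, rfl, rfl⟩, hu, rfl⟩
  rw [h1]
  clear h h1
  classical
  induction J using Finset.induction_on with
  | empty => simp
  | insert j J hj ih =>
    rw [Finset.sum_insert hj, Finset.set_biUnion_insert, Set.encard_union_eq]
    · rw [Function.Injective.encard_image (fun a b hab => by simpa using hab),
        hc j (Finset.mem_insert_self _ _), ih]
      · push_cast; rfl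
      · exact fun i hi j hj => hinj i (Finset.mem_insert_of_mem hi) j (Finset.mem_insert_of_mem hj)
      · exact fun j hj => hc j (Finset.mem_insert_of_mem hj)
    · rw [Set.disjoint_left]
      rintro _ ⟨u, -, rfl⟩ h2
      simp only [Set.mem_iUnion, Set.mem_image, exists_prop] at h2
      obtain ⟨i, hi, u', -, h3⟩ := h2
      simp only [List.cons.injEq, Prod.mk.injEq] at h3
      exact hj (hinj i (Finset.mem_insert_of_mem hi) j (Finset.mem_insert_self _ _) h3.1.2 ▸ hi)

theorem runs_one {st : Stp C} {ss : List (Stp C)} {W W₁ O₁ : List (Sym C)}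
    (h : ∀ O W', Line st W O W' ↔ O = O₁ ∧ W' = W₁) :
    (Runs (st :: ss) W).encard = (Runs ss W₁).encard := by
  have : Runs (st :: ss) W = (fun u' => (fg O₁, fg W₁) :: u') '' Runs ss W₁ := by
    ext u
    simp only [Runs, Set.mem_ofPred_eq, h, Set.mem_image]
    constructor
    · rintro ⟨_, _, u', ⟨rfl, rfl⟩, hu, rfl⟩
      exact ⟨u', hu, rfl⟩
    · rintro ⟨u', hu, rfl⟩
      exact ⟨_, _, u', ⟨rfl, rfl⟩, hu, rfl⟩
  rw [this, Function.Injective.encard_image (fun a b hab => by simpa using hab)]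

theorem runs_two {st : Stp C} {ss : List (Stp C)} {W W₁ O₁ W₂ O₂ : List (Sym C)}
    (h : ∀ O W', Line st W O W' ↔ (O = O₁ ∧ W' = W₁) ∨ (O = O₂ ∧ W' = W₂))
    (hne : fg W₁ ≠ fg W₂) {c₁ c₂ : ℕ} (h1 : (Runs ss W₁).encard = c₁)
    (h2 : (Runs ss W₂).encard = c₂) : (Runs (st :: ss) W).encard = (c₁ + c₂ : ℕ) := by
  have := runs_cons (ι := Bool) (st := st) (W := W) (ss := ss) Finset.univ (fun b => cond b O₁ O₂)
    (fun b => cond b W₁ W₂) (fun O W' => by simp [h, or_comm])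
    (by
      rintro (_ | _) - (_ | _) - h <;> simp_all [hne.symm]) (fun b => cond b c₁ c₂)
    (by rintro (_ | _) - <;> simpa)
  simpa [add_comm] using this

/-- The colours of the paths that are to be continued, from the most recent arc to the oldest one,
then those from the left boundary. -/
def Stp.next (st : Stp C) (K : List C) : List C :=
  (if st.p then K.tail else st.b :: K) ++ if st.s then [st.l] else []

/-- The colours of the arcs that have been closed. -/
def Stp.dead (st : Stp C) (D : List C) : List C := if st.p then st.b :: D else D

/-- The colours of the steps are consistent. -/
def Ok : List (Stp C) → List C → List C → Prop
  | [], D, K => (D ++ K).Nodup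
  | st :: ss, D, K => (D ++ K).Nodup ∧ (st.p = true → K.head? = some st.b) ∧
      Ok ss (st.dead D) (st.next K)

theorem Ok.nodup {ss : List (Stp C)} {D K : List C} (h : Ok ss D K) : (D ++ K).Nodup := by
  cases ss with
  | nil => exact h
  | cons st ss => exact h.1

/-- The colours after some steps. -/
def stk : List (Stp C) → List C → List C
  | [], K => K
  | st :: ss, K => stk ss (st.next K)

/-- Steps with equal left and bottom letters are forced from a word without defect: each closing
step adds an `S`, and the pending colours evolve as a stack. -/
theorem runs_base_append {us ss : List (Stp C)} (hus : ∀ st ∈ us, st.s = st.p) {D K : List C}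
    (hok : Ok (us ++ ss) D K) (a : ℕ) : ∃ D', Ok ss D' (stk us K) ∧
      (Runs (us ++ ss) (Sw C a ++ Iw K)).encard =
        (Runs ss (Sw C (a + us.countP (·.p)) ++ Iw (stk us K))).encard := by
  induction us generalizing D K a with
  | nil => exact ⟨D, hok, rfl⟩
  | cons st us ih =>
    obtain ⟨hn, hh, hok⟩ := hok
    have hs := hus st (by simp)
    have hus' : ∀ st ∈ us, st.s = st.p := fun st h => hus st (by simp [h])
    cases hp : st.p
    · obtain ⟨D', h1, h2⟩ := ih hus' hok a
      have hn' := hok.nodup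
      rw [hp] at hs
      have hnext : st.next K = st.b :: K := by simp [Stp.next, hp, hs]
      rw [hnext] at h2 hn'
      refine ⟨D', h1, ?_⟩
      rw [List.cons_append, runs_one (line_base_push hs hn'.of_append_right a), h2]
      simp [stk, hnext, hp]
    · obtain ⟨D', h1, h2⟩ := ih hus' hok (a + 1)
      rw [hp] at hs
      obtain ⟨K, rfl⟩ : ∃ K', K = st.b :: K' := by
        have := hh hp
        cases K with
        | nil => simp at this
        | cons c K => exact ⟨K, by simpa using this⟩
      have hnext : st.next (st.b :: K) = K ++ [st.l] := by simp [Stp.next, hp, hs]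
      rw [hnext] at h2
      refine ⟨D', h1, ?_⟩
      rw [List.cons_append, runs_one (line_base_pop hs hn.of_append_right a), h2]
      simp [stk, hnext, hp, add_assoc, add_comm]

theorem runs_base {ss : List (Stp C)} (hss : ∀ st ∈ ss, st.s = st.p) {D K : List C}
    (hok : Ok ss D K) (a : ℕ) : (Runs ss (Sw C a ++ Iw K)).encard = 1 := by
  obtain ⟨D', -, h⟩ := runs_base_append (ss := []) hss (by simpa using hok) a
  rw [List.append_nil] at h
  rw [h]
  have : Runs [] (Sw C (a + ss.countP (·.p)) ++ Iw (stk ss K)) = {[]} := by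
    ext u
    simp only [Runs, Set.mem_ofPred_eq, Set.mem_singleton_iff, and_iff_left_iff_imp]
    rintro -
    exact ⟨_, _, rfl⟩
  rw [this, Set.encard_singleton]

/-- A final word has no `S` above an `I`, so a defect left at the end kills the run. -/
theorem not_final {a k : ℕ} (hk : k ≠ 0) (X : List (Sym Unit)) {W : List (Sym C)}
    (hW : fg W = Sw Unit a ++ (List.replicate k (I ()) ++ S :: X)) : Runs [] W = ∅ := by
  ext u
  simp only [Runs, Set.mem_ofPred_eq, Set.mem_empty_iff_false, iff_false, not_and]
  rintro - ⟨a', K, rfl⟩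
  obtain ⟨k, rfl⟩ := Nat.exists_eq_succ_of_ne_zero hk
  simp only [fg_append, fg_Sw, fg_Iw, List.replicate_succ, List.cons_append] at hW
  obtain hK | ⟨m, hm⟩ : K.length = 0 ∨ ∃ m, K.length = m + 1 := by
    cases K.length <;> simp
  · rw [hK] at hW
    have := congrArg (I () ∈ ·) hW
    simp at this
  · rw [hm, List.replicate_succ] at hW
    have := (replicate_append_cons_inj (by simp) (by simp) hW).2.2
    have := congrArg (S ∈ ·) this
    simp at this

/-- Each step lets the displaced `I` pass one `S` or none, and it must pass all `k` of them before
the end: choose the steps at which it does. -/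
theorem runs_row {ss : List (Stp C)} (hss : ∀ st ∈ ss, st.s = st.p) {D K : List C} {c : C}
    (hok : Ok ss D (c :: K)) (hK : K ≠ []) (a k : ℕ) :
    (Runs ss (Sw C a ++ I c :: (Sw C k ++ Iw K))).encard = (ss.length.choose k : ℕ) := by
  induction ss generalizing D K c a k with
  | nil =>
    cases k with
    | zero => simpa using runs_base hss hok a
    | succ k =>
      rw [not_final one_ne_zero (a := a) (Sw Unit k ++ fg (Iw K)) (by simp [List.replicate_succ])]
      simp
  | cons st ss ih =>
    cases k with
    | zero => simpa using runs_base hss hok a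
    | succ k =>
      obtain ⟨hn, hh, hok⟩ := hok
      have hs := hss st (by simp)
      have hss' : ∀ st ∈ ss, st.s = st.p := fun st h => hss st (by simp [h])
      -- Pascal's rule: the `I` stays below `k + 1` letters `S`, or passes one.
      rw [List.length_cons, Nat.choose_succ_succ', Nat.add_comm (ss.length.choose k)]
      cases hp : st.p
      · rw [hp] at hs
        have hnext : st.next (c :: K) = st.b :: c :: K := by simp [Stp.next, hp, hs]
        rw [hnext] at hok
        refine runs_two (line_row_push hs hok.nodup.of_append_right a k) ?_
          (ih hss' hok (by simp) a (k + 1)) (ih hss' hok (by simp) (a + 1) k)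
        intro h
        simp only [fg_append, fg_Sw, fg_cons_I] at h
        simpa using (replicate_append_cons_inj (by simp) (by simp) h).1
      · rw [hp] at hs
        obtain rfl : c = st.b := by simpa using hh hp
        obtain ⟨d, K, rfl⟩ := List.exists_cons_of_ne_nil hK
        have hnext : st.next (st.b :: d :: K) = d :: (K ++ [st.l]) := by
          simp [Stp.next, hp, hs]
        rw [hnext] at hok
        refine runs_two (line_row_pop hs hn.of_append_right a k) ?_
          (ih hss' hok (by simp) (a + 1) (k + 1)) (ih hss' hok (by simp) (a + 2) k)
        intro h
        simp only [fg_append, fg_Sw, fg_cons_I] at h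
        simpa using (replicate_append_cons_inj (by simp) (by simp) h).1

theorem sum_multichoose (m k : ℕ) :
    ∑ j ∈ Finset.range (k + 1), m.multichoose j = (m + 1).multichoose k := by
  induction k with
  | zero => simp
  | succ k ih => rw [Finset.sum_range_succ, ih, Nat.multichoose_succ_succ, add_comm]

/-- The displaced `S` may pass any number of the `A.length` paths below it in one step and must have
passed all of them at the end. So the runs distribute these passages among the steps, with
repetition. -/
theorem runs_col {ss : List (Stp C)} (hss : ∀ st ∈ ss, st.s = st.p) {D A K : List C}
    (hok : Ok ss D (A ++ K)) (hK : K ≠ []) (a : ℕ) :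
    (Runs ss (Sw C a ++ (Iw A ++ S :: Iw K))).encard = (ss.length.multichoose A.length : ℕ) := by
  induction ss generalizing D A K a with
  | nil =>
    by_cases hA : A = []
    · subst hA
      have := runs_base hss hok (a + 1)
      simpa [List.replicate_succ'] using this
    · have hA' : A.length ≠ 0 := by simpa using hA
      rw [not_final hA' (a := a) (fg (Iw K)) (by simp)]
      obtain ⟨k, hk⟩ := Nat.exists_eq_succ_of_ne_zero hA'
      simp [hk]
  | cons st ss ih =>
    obtain ⟨hn, hh, hok⟩ := hok
    have hs := hss st (by simp)
    have hss' : ∀ st ∈ ss, st.s = st.p := fun st h => hss st (by simp [h])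
    rw [List.length_cons, ← sum_multichoose]
    cases hp : st.p
    · rw [hp] at hs
      have hnext : st.next (A ++ K) = (st.b :: A) ++ K := by simp [Stp.next, hp, hs]
      rw [hnext] at hok
      obtain ⟨Oj, hO⟩ := line_col_push hs hok.nodup.of_append_right a
      refine runs_cons (Finset.range (A.length + 1)) Oj (fun j => Sw C a ++
        (Iw ((st.b :: A).take j) ++ S :: Iw ((st.b :: A).drop j ++ K)))
        (fun O W' => by simp [hO]) ?_ _ ?_
      · intro i hi j hj h
        simp only [fg_append, fg_Sw, fg_Iw, fg_cons_S] at h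
        have := (replicate_append_cons_inj (by simp) (by simp) (List.append_cancel_left h)).1
        simp only [Finset.mem_range] at hi hj
        simp only [List.length_take, List.length_cons] at this
        omega
      · intro j hj
        have h := ih hss' (D := st.dead D) (A := (st.b :: A).take j)
          (K := (st.b :: A).drop j ++ K) (by rwa [← List.append_assoc, List.take_append_drop])
          (by simp [hK]) a
        rw [h]
        simp only [Finset.mem_range] at hj
        rw [List.length_take, min_eq_left (by simp; omega)]
    · rw [hp] at hs
      obtain ⟨Q, hQ⟩ : ∃ Q, A ++ K = st.b :: Q := by
        have := hh hp
        cases h : A ++ K with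
        | nil => rw [h] at this; simp at this
        | cons c K => rw [h] at this; exact ⟨K, by simpa using this⟩
      have hnext : st.next (A ++ K) = Q ++ [st.l] := by simp [Stp.next, hp, hs, hQ]
      rw [hnext] at hok
      have hAQ : A.length ≤ Q.length := by
        have h1 := congrArg List.length hQ
        have h2 := List.length_pos_iff.2 hK
        simp at h1
        omega
      obtain ⟨Oj, hO⟩ := line_col_pop hs hn.of_append_right hK hQ a
      refine runs_cons (Finset.range (A.length + 1)) Oj (fun j => Sw C (a + 1) ++
        (Iw (Q.take j) ++ S :: Iw (Q.drop j ++ [st.l])))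
        (fun O W' => by simp [hO]) ?_ _ ?_
      · intro i hi j hj h
        simp only [fg_append, fg_Sw, fg_Iw, fg_cons_S] at h
        have := (replicate_append_cons_inj (by simp) (by simp) (List.append_cancel_left h)).1
        simp only [Finset.mem_range] at hi hj
        simp only [List.length_take] at this
        omega
      · intro j hj
        have h := ih hss' (D := st.dead D) (A := Q.take j)
          (K := Q.drop j ++ [st.l]) (by rwa [← List.append_assoc, List.take_append_drop])
          (by simp) (a + 1)
        rw [h]
        simp only [Finset.mem_range] at hj
        rw [List.length_take, min_eq_left (by omega)]

end Counting

end TFPL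

namespace TFPL

open TFPL.Sym

/-! ### Counting the runs through a bump in a row -/

section Deviations

variable {C : Type}

/-- The number of letters `S`. -/
def numS (w : List (Sym C)) : ℕ := w.countP fun x => match x with | S => true | _ => false

@[simp] theorem numS_append (v w : List (Sym C)) : numS (v ++ w) = numS v + numS w :=
  List.countP_append
@[simp] theorem numS_cons_S (w : List (Sym C)) : numS (S :: w) = numS w + 1 :=
  List.countP_cons_of_pos rfl
@[simp] theorem numS_cons_I (c : C) (w : List (Sym C)) : numS (I c :: w) = numS w :=
  List.countP_cons_of_neg (by simp)
@[simp] theorem numS_cons_E (w : List (Sym C)) : numS (E :: w) = numS w :=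
  List.countP_cons_of_neg (by simp)
@[simp] theorem numS_fg (w : List (Sym C)) : numS (fg w) = numS w := by
  induction w with
  | nil => rfl
  | cons x w ih => cases x <;> simp [ih]
@[simp] theorem numS_Sw (a : ℕ) : numS (Sw C a) = a := by
  induction a with
  | zero => rfl
  | succ a ih => rw [Sw, List.replicate_succ, numS_cons_S, ih]
@[simp] theorem numS_Iw (K : List C) : numS (Iw K) = 0 := by
  induction K with
  | nil => rfl
  | cons c K ih => exact (numS_cons_I c (Iw K)).trans ih

theorem sum_range_choose_eq (g r : ℕ) : ∑ i ∈ Finset.range g, i.choose r = g.choose (r + 1) := by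
  induction g with
  | zero => simp
  | succ g ih => rw [Finset.sum_range_succ, ih, Nat.choose_succ_succ', add_comm]

theorem sum_range_choose_sub (g r : ℕ) :
    ∑ i ∈ Finset.range g, (g - 1 - i).choose r = g.choose (r + 1) := by
  rw [Finset.sum_range_reflect (fun i => i.choose r), sum_range_choose_eq]

theorem sum_range_choose_add (x j r : ℕ) :
    ∑ i ∈ Finset.range j, (x + i).choose r + x.choose (r + 1) = (x + j).choose (r + 1) := by
  induction j with
  | zero => simp
  | succ j ih =>
    rw [Finset.sum_range_succ, ← add_assoc, Nat.choose_succ_succ', ← ih]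
    ring

/-- Variant of `runs_cons` with one exceptional branch, used for the branch that leads to a pair. -/
theorem runs_cons_option {ι : Type} {st : Stp C} {ss : List (Stp C)} {W O₀ W₀ : List (Sym C)}
    (J : Finset ι) (Oj Wj : ι → List (Sym C))
    (h : ∀ O W', Line st W O W' ↔ (O = O₀ ∧ W' = W₀) ∨ ∃ j ∈ J, O = Oj j ∧ W' = Wj j)
    (hinj : ∀ i ∈ J, ∀ j ∈ J, fg (Wj i) = fg (Wj j) → i = j)
    (hne : ∀ j ∈ J, fg W₀ ≠ fg (Wj j)) (c₀ : ℕ) (c : ι → ℕ)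
    (hc₀ : (Runs ss W₀).encard = c₀) (hc : ∀ j ∈ J, (Runs ss (Wj j)).encard = c j) :
    (Runs (st :: ss) W).encard = (c₀ + ∑ j ∈ J, c j : ℕ) := by
  have := runs_cons (st := st) (W := W) (ss := ss) (Finset.insertNone J)
    (fun o => o.elim O₀ Oj) (fun o => o.elim W₀ Wj)
    (fun O W' => by
      rw [h]
      constructor
      · rintro (h | ⟨j, hj, h⟩)
        · exact ⟨none, by simp, h⟩
        · exact ⟨some j, by simpa using hj, h⟩
      · rintro ⟨_ | j, hj, h⟩
        · exact Or.inl h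
        · exact Or.inr ⟨j, by simpa using hj, h⟩)
    (by
      rintro (_ | i) hi (_ | j) hj h
      · rfl
      · exact absurd h (hne j (by simpa using hj))
      · exact absurd h.symm (hne i (by simpa using hi))
      · exact congrArg some (hinj i (by simpa using hi) j (by simpa using hj) h))
    (fun o => o.elim c₀ c)
    (by
      rintro (_ | j) hj
      · exact hc₀
      · exact hc j (by simpa using hj))
  rw [this, Finset.sum_insertNone]
  rfl

theorem exists_split_drop {G : List C} {P : List C → List C → Prop} :
    (∃ D₁ D₂, G = D₁ ++ D₂ ∧ D₂ ≠ [] ∧ P D₁ D₂) ↔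
      ∃ i < G.length, P (G.take i) (G.drop i) := by
  constructor
  · rintro ⟨D₁, D₂, rfl, h, hP⟩
    refine ⟨D₁.length, ?_, by simpa using hP⟩
    have := List.length_pos_iff.2 h
    simpa using this
  · rintro ⟨i, hi, hP⟩
    refine ⟨_, _, (List.take_append_drop i G).symm, ?_, hP⟩
    simpa using hi

theorem fg_gap_inj {a : ℕ} {A A' B B' G G' : List C}
    (h : fg (Sw C a ++ (Iw A ++ S :: (Iw B ++ E :: Iw G))) =
      fg (Sw C a ++ (Iw A' ++ S :: (Iw B' ++ E :: Iw G')))) :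
    A.length = A'.length ∧ B.length = B'.length ∧ G.length = G'.length := by
  simp only [fg_append, fg_Sw, fg_Iw, fg_cons_S, fg_cons_E] at h
  have h1 := replicate_append_cons_inj (by simp) (by simp) (List.append_cancel_left h)
  have h2 := replicate_append_cons_inj (by simp) (by simp) h1.2.2
  exact ⟨h1.1, h2.1, by simpa using congrArg List.length h2.2.2⟩

theorem fg_col_inj {a : ℕ} {A A' K K' : List C}
    (h : fg (Sw C a ++ (Iw A ++ S :: Iw K)) = fg (Sw C a ++ (Iw A' ++ S :: Iw K'))) :
    A.length = A'.length := by
  simp only [fg_append, fg_Sw, fg_Iw, fg_cons_S] at h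
  exact (replicate_append_cons_inj (by simp) (by simp) (List.append_cancel_left h)).1

theorem Ok.head {st : Stp C} {ss : List (Stp C)} {D K : List C} (h : Ok (st :: ss) D K)
    (hp : st.p = true) : ∃ K', K = st.b :: K' := by
  have := h.2.1 hp
  cases K with
  | nil => simp at this
  | cons c K => exact ⟨K, by simpa using this⟩

theorem Ok.tail {st : Stp C} {ss : List (Stp C)} {D K : List C} (h : Ok (st :: ss) D K) :
    Ok ss (st.dead D) (st.next K) := h.2.2

/-- Each closing step joins the pair and makes the next arc a pair in its turn, with one more `S` in
between or the same number. The step `ct` leaves a displaced `I`, counted by `runs_row`; Pascal's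
rule does the rest. -/
theorem runs_pair_row {rs vs : List (Stp C)} {ct : Stp C}
    (hrs : ∀ st ∈ rs, st.s = true ∧ st.p = true) (hct : ct.s = true ∧ ct.p = false)
    (hvs : ∀ st ∈ vs, st.s = st.p) {D K : List C} {x : C} (hx : x ∈ D)
    (hok : Ok (rs ++ ct :: vs) D K) (a k : ℕ) :
    (Runs (rs ++ ct :: vs) (Sw C a ++ I x :: (Sw C k ++ I x :: Iw K))).encard =
      ((vs.length + rs.length + 1).choose (k + rs.length + 1) : ℕ) := by
  induction rs generalizing D K x a k with
  | nil =>
    rw [List.nil_append] at hok ⊢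
    have hnext : ct.next K = ct.b :: (K ++ [ct.l]) := by simp [Stp.next, hct]
    have hdead : ct.dead D = D := by simp [Stp.dead, hct]
    have hok' := hok.tail
    rw [hnext, hdead] at hok'
    have hxb : x ≠ ct.b := by
      rintro rfl
      exact List.disjoint_of_nodup_append hok'.nodup hx (by simp)
    have hxK : (x :: K).Nodup := List.nodup_cons.2
      ⟨fun h => List.disjoint_of_nodup_append hok.nodup hx h, hok.nodup.of_append_right⟩
    obtain ⟨O₁, O₂, hO⟩ := line_pair_row hct.1 hxb hxK a k
    rw [List.length_nil, add_zero, add_zero, Nat.choose_succ_succ',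
      Nat.add_comm (vs.length.choose k)]
    refine runs_two hO ?_ (runs_row hvs hok' (by simp) a (k + 1))
      (runs_row hvs hok' (by simp) (a + 1) k)
    intro h
    simp only [fg_append, fg_Sw, fg_cons_I] at h
    simpa using (replicate_append_cons_inj (by simp) (by simp) h).1
  | cons st rs ih =>
    have hst := hrs st (by simp)
    have hrs' : ∀ st ∈ rs, st.s = true ∧ st.p = true := fun st h => hrs st (by simp [h])
    rw [List.cons_append] at hok ⊢
    obtain ⟨K, rfl⟩ := hok.head hst.2
    have hnext : st.next (st.b :: K) = K ++ [st.l] := by simp [Stp.next, hst]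
    have hdead : st.dead D = st.b :: D := by simp [Stp.dead, hst]
    have hok' := hok.tail
    rw [hnext, hdead] at hok'
    have hxb : x ≠ st.b := by
      rintro rfl
      exact List.disjoint_of_nodup_append hok.nodup hx (by simp)
    have hxK : (x :: st.b :: K).Nodup := List.nodup_cons.2
      ⟨fun h => List.disjoint_of_nodup_append hok.nodup hx h, hok.nodup.of_append_right⟩
    obtain ⟨O₁, O₂, hO⟩ := line_pair_row hst.1 hxb hxK a k
    rw [List.length_cons, ← add_assoc, ← add_assoc, Nat.choose_succ_succ',
      Nat.add_comm ((vs.length + rs.length + 1).choose (k + rs.length + 1))]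
    have h1 := ih hrs' (x := st.b) (by simp) hok' a (k + 1)
    have h2 := ih hrs' (x := st.b) (by simp) hok' (a + 1) k
    rw [show k + 1 + rs.length + 1 = k + rs.length + 1 + 1 by ring] at h1
    refine runs_two hO ?_ h1 h2
    intro h
    simp only [fg_append, fg_Sw, fg_cons_I] at h
    simpa using (replicate_append_cons_inj (by simp) (by simp) h).1

/-- At a closing step the gap moves to a level at most equal to its own, or gives way to a pair; at
`ct` it is filled for good. The branches add up by the hockey-stick identity `sum_range_choose_add`,
the pair providing its initial term. -/
theorem runs_gap_row {rs vs : List (Stp C)} {ct : Stp C}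
    (hrs : ∀ st ∈ rs, st.s = true ∧ st.p = true) (hct : ct.s = true ∧ ct.p = false)
    (hvs : ∀ st ∈ vs, st.s = st.p) {D B G : List C} (hG : G ≠ [])
    (hok : Ok (rs ++ ct :: vs) D (B ++ G)) (a : ℕ) :
    (Runs (rs ++ ct :: vs) (Sw C (a + 1) ++ (Iw B ++ E :: Iw G))).encard =
      ((vs.length + rs.length + 1 + B.length).choose rs.length : ℕ) := by
  induction rs generalizing D B G a with
  | nil =>
    rw [List.nil_append] at hok ⊢
    obtain ⟨c, G, rfl⟩ := List.exists_cons_of_ne_nil hG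
    have hnext : ct.next (B ++ c :: G) = ct.b :: (B ++ c :: (G ++ [ct.l])) := by
      simp [Stp.next, hct]
    have hok' := hok.tail
    rw [hnext] at hok'
    have hn : (ct.b :: ([] ++ B ++ c :: G)).Nodup := by
      have h := hok'.nodup.of_append_right
      rw [show ct.b :: (B ++ c :: (G ++ [ct.l])) = (ct.b :: ([] ++ B ++ c :: G)) ++ [ct.l] by
        simp] at h
      exact h.of_append_left
    obtain ⟨Oj, hO⟩ := line_gap_push (st := ct) hn a
    have hO' : ∀ O W', Line ct (Sw C (a + 1) ++ (Iw B ++ E :: Iw (c :: G))) O W' ↔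
        O = Oj 0 ∧ W' = Sw C (a + 1) ++ Iw (ct.b :: (B ++ c :: (G ++ [ct.l]))) := by
      intro O W'
      have := hO O W'
      simp only [List.map_nil, List.nil_append] at this
      -- The topmost `S` of the initial block serves as the `S` of `line_gap_push`, with no path
      -- below it.
      rw [Sw, List.replicate_succ', List.append_assoc, List.singleton_append, this]
      simp [Out, hct]
    rw [runs_one hO', runs_base hvs hok']
    simp
  | cons st rs ih =>
    have hst := hrs st (by simp)
    have hrs' : ∀ st ∈ rs, st.s = true ∧ st.p = true := fun st h => hrs st (by simp [h])
    rw [List.cons_append] at hok ⊢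
    obtain ⟨c, G, rfl⟩ := List.exists_cons_of_ne_nil hG
    obtain ⟨K, hK⟩ := hok.head hst.2
    obtain ⟨Q, hQ⟩ : ∃ Q, B ++ [c] = st.b :: Q := by
      cases B with
      | nil => exact ⟨[], by simp at hK; simp [hK.1]⟩
      | cons d B => exact ⟨B ++ [c], by simp at hK; simp [hK.1]⟩
    have hBQ : B.length = Q.length := by simpa using congrArg List.length hQ
    have hK' : B ++ c :: G = st.b :: (Q ++ G) := by
      rw [← List.singleton_append, ← List.append_assoc, hQ, List.cons_append]
    have hnext : st.next (B ++ c :: G) = Q ++ G ++ [st.l] := by simp [Stp.next, hst, hK']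
    have hdead : st.dead D = st.b :: D := by simp [Stp.dead, hst]
    have hok' := hok.tail
    rw [hnext, hdead] at hok'
    obtain ⟨O₀, hO⟩ := line_gap_pop hst.1 hok.nodup.of_append_right hQ (a + 1)
    have h0 := runs_pair_row hrs' hct hvs (x := st.b) (by simp) hok' (a + 1) 0
    have := runs_cons_option (st := st) (ss := rs ++ ct :: vs)
      (W := Sw C (a + 1) ++ (Iw B ++ E :: Iw (c :: G))) (O₀ := O₀)
      (W₀ := Sw C (a + 1) ++ I st.b :: (Sw C 0 ++ I st.b :: Iw (Q ++ G ++ [st.l])))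
      (Finset.range (Q.length + 1)) (fun _ => O₀)
      (fun j => Sw C (a + 1 + 1) ++ (Iw (Q.take j) ++ E :: Iw (Q.drop j ++ G ++ [st.l])))
      (fun O W' => by
        rw [hO]
        simp only [Finset.mem_range, Nat.lt_succ_iff, List.map_cons, List.replicate_zero,
          List.nil_append]
        constructor
        · rintro ⟨rfl, ⟨j, hj, h⟩ | h⟩
          · exact Or.inr ⟨j, hj, rfl, h⟩
          · exact Or.inl ⟨rfl, h⟩
        · rintro (⟨rfl, h⟩ | ⟨j, hj, rfl, h⟩)
          · exact ⟨rfl, Or.inr h⟩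
          · exact ⟨rfl, Or.inl ⟨j, hj, h⟩⟩)
      (by
        intro i hi j hj h
        simp only [fg_append, fg_Sw, fg_Iw, fg_cons_E] at h
        have := (replicate_append_cons_inj (by simp) (by simp) (List.append_cancel_left h)).1
        simp only [Finset.mem_range] at hi hj
        simp only [List.length_take] at this
        omega)
      (by
        intro j hj h
        have := congrArg numS h
        simp only [numS_fg, numS_append, numS_Sw, numS_cons_I, numS_cons_E, numS_Iw] at this
        omega)
      _ (fun j => (vs.length + rs.length + 1 + j).choose rs.length) h0
      (by
        intro j hj
        have h := ih hrs' (D := st.b :: D) (B := Q.take j) (G := Q.drop j ++ G ++ [st.l])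
          (by simp) (by rwa [List.append_assoc, ← List.append_assoc (Q.take j),
            List.take_append_drop, ← List.append_assoc]) (a + 1)
        simp only [Finset.mem_range] at hj
        rw [h, List.length_take, min_eq_left (by omega)])
    rw [this, Nat.add_comm, Nat.zero_add, sum_range_choose_add, hBQ, List.length_cons]
    congr 2
    ring

end Deviations

end TFPL

namespace TFPL

open TFPL.Sym

/-! ### Counting the runs through a bump in a column, and the totals for both shapes -/

section Columns

variable {C : Type}

theorem sum_gap (g k m r : ℕ) :
    ∑ u ∈ Finset.range (k + 1) ×ˢ Finset.range g,
      (g - 1 - u.2).choose r * m.multichoose u.1 = g.choose (r + 1) * (m + 1).multichoose k := by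
  rw [Finset.sum_product_right]
  simp only [← Finset.mul_sum, sum_multichoose]
  rw [← Finset.sum_mul, sum_range_choose_sub]

/-- Two independent motions give a product. The gap moves strictly up at each step of `rs`, always
with paths above it, whence the binomial; the `S` passes the paths below it as in `runs_col`, during
all the steps. -/
theorem runs_gap_col {rs vs : List (Stp C)} {ct : Stp C}
    (hrs : ∀ st ∈ rs, st.s = false ∧ st.p = false) (hct : ct.s = true ∧ ct.p = false)
    (hvs : ∀ st ∈ vs, st.s = st.p) {D A B G : List C} (hG : G ≠ [])
    (hok : Ok (rs ++ ct :: vs) D (A ++ B ++ G)) (a : ℕ) :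
    (Runs (rs ++ ct :: vs) (Sw C a ++ (Iw A ++ S :: (Iw B ++ E :: Iw G)))).encard =
      ((G.length - 1).choose rs.length *
        (vs.length + rs.length + 1).multichoose A.length : ℕ) := by
  induction rs generalizing D A B G with
  | nil =>
    rw [List.nil_append] at hok ⊢
    obtain ⟨c, G, rfl⟩ := List.exists_cons_of_ne_nil hG
    have hnext : ct.next (A ++ B ++ c :: G) = ct.b :: A ++ (B ++ c :: G ++ [ct.l]) := by
      simp [Stp.next, hct]
    have hok' := hok.tail
    rw [hnext] at hok'
    have hn : (ct.b :: (A ++ B ++ c :: G)).Nodup := by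
      have h := hok'.nodup.of_append_right
      rw [show ct.b :: A ++ (B ++ c :: G ++ [ct.l]) = (ct.b :: (A ++ B ++ c :: G)) ++ [ct.l] by
        simp] at h
      exact h.of_append_left
    obtain ⟨Oj, hO⟩ := line_gap_push (st := ct) hn a
    rw [runs_cons (Finset.range (A.length + 1)) Oj (fun j => Sw C a ++
      (Iw ((ct.b :: A).take j) ++ S :: Iw ((ct.b :: A).drop j ++ (B ++ c :: G ++ [ct.l]))))
      (fun O W' => by rw [hO]; simp [Out, hct]) ?_ (fun j => vs.length.multichoose j)
      ?_, sum_multichoose]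
    · simp
    · intro i hi j hj h
      have := fg_col_inj h
      simp only [Finset.mem_range] at hi hj
      simp only [List.length_take, List.length_cons] at this
      omega
    · intro j hj
      rw [runs_col hvs (D := ct.dead D) (by rwa [← List.append_assoc, List.take_append_drop])
        (by simp)]
      simp only [Finset.mem_range] at hj
      rw [List.length_take, min_eq_left (by simp; omega)]
  | cons st rs ih =>
    have hst := hrs st (by simp)
    have hrs' : ∀ st ∈ rs, st.s = false ∧ st.p = false := fun st h => hrs st (by simp [h])
    rw [List.cons_append] at hok ⊢
    obtain ⟨c, G, rfl⟩ := List.exists_cons_of_ne_nil hG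
    have hnext : st.next (A ++ B ++ c :: G) = st.b :: A ++ (B ++ c :: G) := by
      simp [Stp.next, hst]
    have hok' := hok.tail
    rw [hnext] at hok'
    have hn : (st.b :: (A ++ B ++ c :: G)).Nodup := by
      simpa using hok'.nodup.of_append_right
    obtain ⟨Oj, hO⟩ := line_gap_push (st := st) hn a
    rw [runs_cons (Finset.range (A.length + 1) ×ˢ Finset.range G.length) (fun u => Oj u.1)
      (fun u => Sw C a ++ (Iw ((st.b :: A).take u.1) ++ S ::
        (Iw ((st.b :: A).drop u.1 ++ B ++ [c] ++ G.take u.2) ++ E :: Iw (G.drop u.2))))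
      ?_ ?_ (fun u => (G.length - 1 - u.2).choose rs.length *
        (vs.length + rs.length + 1).multichoose u.1) ?_, sum_gap]
    · simp [add_assoc]
    · intro O W'
      simp only [hO, Out, hst, Bool.false_eq_true, if_false, exists_split_drop]
      simp
      grind
    · rintro ⟨i, i'⟩ hi ⟨j, j'⟩ hj h
      have := fg_gap_inj h
      simp only [Finset.mem_product, Finset.mem_range] at hi hj
      simp only [List.length_take, List.length_cons, List.length_drop] at this
      ext <;> dsimp only <;> omega
    · rintro ⟨j, i⟩ hj
      simp only [Finset.mem_product, Finset.mem_range] at hj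
      have h := ih hrs' (D := st.dead D) (A := (st.b :: A).take j)
        (B := (st.b :: A).drop j ++ B ++ [c] ++ G.take i) (G := G.drop i)
        (by simp; omega) (by
          rw [← List.append_assoc, ← List.append_assoc, ← List.append_assoc,
            List.take_append_drop, List.append_assoc _ (G.take i), List.take_append_drop]
          simpa using hok')
      rw [h, List.length_take, min_eq_left (by simp; omega), List.length_drop]
      dsimp only
      rw [Nat.sub_right_comm]

/-- A pair has the colour of an arc that the matching has already closed, so it does not occur among
the pending colours. The list `D` of closed colours is carried along for this. -/
theorem nodup_cons_insert {D A K : List C} {b x : C} (hx : x ∈ D)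
    (h : (D ++ (b :: A ++ K)).Nodup) : (b :: (A ++ x :: K)).Nodup := by
  have h1 : (b :: A ++ x :: K).Perm (x :: (b :: A ++ K)) := List.perm_middle
  rw [← List.cons_append, h1.nodup_iff, List.nodup_cons]
  exact ⟨fun hx' => List.disjoint_of_nodup_append h hx hx', h.of_append_right⟩

/-- The number of ways to continue from a horizontal path that passes above `s + 1` paths and
below `g` paths. -/
def pairCount (m : ℕ) : ℕ → ℕ → ℕ → ℕ
  | s, _, 0 => (m + 1).multichoose (s + 1)
  | s, g, r + 1 => pairCount m (s + 1) g r + g.choose (r + 1) * (m + r + 2).multichoose (s + 1)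

/-- Unrolling the recursion over the step at which the two ends join; the last joining time
contributes the term `q = 0`. -/
theorem pairCount_eq (m s g r : ℕ) : pairCount m s g r =
    ∑ q ∈ Finset.range (r + 1), g.choose q * (m + s + r + 1).choose (s + 1 + r - q) := by
  induction r generalizing s with
  | zero => simp [pairCount, Nat.multichoose_eq, add_assoc, add_comm, add_left_comm]
  | succ r ih =>
    rw [pairCount, ih, Finset.sum_range_succ
      (fun q => g.choose q * (m + s + (r + 1) + 1).choose (s + 1 + (r + 1) - q)) (r + 1)]
    congr 1
    · refine Finset.sum_congr rfl fun q hq => ?_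
      rw [show m + (s + 1) + r + 1 = m + s + (r + 1) + 1 by ring,
        show s + 1 + 1 + r = s + 1 + (r + 1) by ring]
    · rw [Nat.multichoose_eq]
      congr 2 <;> omega

/-- Vandermonde's identity: the runs that begin with a gap supply exactly the missing term `q = r +
1`. -/
theorem choose_add_pairCount (m g r : ℕ) :
    g.choose (r + 1) + pairCount m 0 g r = (m + r + 1 + g).choose (r + 1) := by
  have h := Finset.Nat.sum_antidiagonal_eq_sum_range_succ
    (fun i j => g.choose i * (m + r + 1).choose j) (r + 1)
  rw [pairCount_eq, Nat.add_comm (m + r + 1), Nat.add_choose_eq, h, Finset.sum_range_succ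
    (fun i => g.choose i * (m + r + 1).choose (r + 1 - i)) (r + 1), Nat.sub_self,
    Nat.choose_zero_right, mul_one, Nat.add_comm]
  refine congrArg (· + _) (Finset.sum_congr rfl fun q hq => ?_)
  rw [add_zero, Nat.zero_add, Nat.add_comm 1 r]

/-- At each opening step the pair persists with one more path below it, or joins, creating an `S`
and a gap counted by `runs_gap_col`. At `ct` it has to join, and only the `S` remains. -/
theorem runs_pair_col {rs vs : List (Stp C)} {ct : Stp C}
    (hrs : ∀ st ∈ rs, st.s = false ∧ st.p = false) (hct : ct.s = true ∧ ct.p = false)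
    (hvs : ∀ st ∈ vs, st.s = st.p) {D A K : List C} {x : C} (hx : x ∈ D)
    (hok : Ok (rs ++ ct :: vs) D (A ++ K)) (a : ℕ) :
    (Runs (rs ++ ct :: vs) (Sw C a ++ (Iw A ++ I x :: I x :: Iw K))).encard =
      pairCount vs.length A.length K.length rs.length := by
  induction rs generalizing D A with
  | nil =>
    rw [List.nil_append] at hok ⊢
    have hnext : ct.next (A ++ K) = ct.b :: A ++ (K ++ [ct.l]) := by
      simp [Stp.next, hct]
    have hdead : ct.dead D = D := by simp [Stp.dead, hct]
    have hok' := hok.tail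
    rw [hnext, hdead] at hok'
    have hn : (ct.b :: (A ++ x :: K)).Nodup := nodup_cons_insert hx (D := D)
      (hok'.nodup.sublist (by simp))
    obtain ⟨O₁, Oj, hO⟩ := line_pair_col hn a
    rw [runs_cons (Finset.range (A.length + 1 + 1)) Oj (fun j => Sw C a ++
      (Iw ((ct.b :: A).take j) ++ S :: Iw ((ct.b :: A).drop j ++ (K ++ [ct.l]))))
      (fun O W' => by simp [hO, Out, hct]) ?_ (fun j => vs.length.multichoose j)
      ?_, sum_multichoose]
    · simp [pairCount]
    · intro i hi j hj h
      have := fg_col_inj h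
      simp only [Finset.mem_range] at hi hj
      simp only [List.length_take, List.length_cons] at this
      omega
    · intro j hj
      rw [runs_col hvs (D := D) (by rwa [← List.append_assoc, List.take_append_drop])
        (by simp)]
      simp only [Finset.mem_range] at hj
      rw [List.length_take, min_eq_left (by simp; omega)]
  | cons st rs ih =>
    have hst := hrs st (by simp)
    have hrs' : ∀ st ∈ rs, st.s = false ∧ st.p = false := fun st h => hrs st (by simp [h])
    rw [List.cons_append] at hok ⊢
    have hnext : st.next (A ++ K) = st.b :: A ++ K := by simp [Stp.next, hst]
    have hdead : st.dead D = D := by simp [Stp.dead, hst]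
    have hok' := hok.tail
    rw [hnext, hdead] at hok'
    have hn : (st.b :: (A ++ x :: K)).Nodup := nodup_cons_insert hx hok'.nodup
    obtain ⟨O₁, Oj, hO⟩ := line_pair_col hn a
    have h0 := ih hrs' hx hok'
    rw [runs_cons_option (O₀ := O₁)
      (W₀ := Sw C a ++ (Iw (st.b :: A) ++ I x :: I x :: Iw K))
      (Finset.range (A.length + 1 + 1) ×ˢ Finset.range K.length) (fun u => Oj u.1)
      (fun u => Sw C a ++ (Iw ((st.b :: A).take u.1) ++ S ::
        (Iw ((st.b :: A).drop u.1 ++ K.take u.2) ++ E :: Iw (K.drop u.2))))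
      ?_ ?_ ?_ _ (fun u => (K.length - 1 - u.2).choose rs.length *
        (vs.length + rs.length + 1).multichoose u.1) h0 ?_, sum_gap]
    · simp [pairCount, add_assoc]
    · intro O W'
      simp only [hO, Out, hst, Bool.false_eq_true, if_false, exists_split_drop]
      simp
      grind
    · rintro ⟨i, i'⟩ hi ⟨j, j'⟩ hj h
      have := fg_gap_inj h
      simp only [Finset.mem_product, Finset.mem_range] at hi hj
      simp only [List.length_take, List.length_cons, List.length_drop] at this
      ext <;> dsimp only <;> omega
    · intro j hj h
      have := congrArg numS h
      simp only [numS_fg, numS_append, numS_Sw, numS_cons_I, numS_cons_E, numS_cons_S,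
        numS_Iw] at this
      omega
    · rintro ⟨j, i⟩ hj
      simp only [Finset.mem_product, Finset.mem_range] at hj
      have h := runs_gap_col hrs' hct hvs (D := D) (A := (st.b :: A).take j)
        (B := (st.b :: A).drop j ++ K.take i) (G := K.drop i)
        (by simp; omega) (by
          rw [← List.append_assoc, List.take_append_drop, List.append_assoc,
            List.take_append_drop]
          exact hok') a
      rw [h, List.length_take, min_eq_left (by simp; omega), List.length_drop]
      dsimp only
      rw [Nat.sub_right_comm]

/-- The first disagreement produces a gap at one of `K.length` levels or a pair, and the counts add
up by the same hockey-stick identity as in `runs_gap_row`. -/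
theorem runs_open_row {rs vs : List (Stp C)} {ot ct : Stp C} (hot : ot.s = false ∧ ot.p = true)
    (hrs : ∀ st ∈ rs, st.s = true ∧ st.p = true) (hct : ct.s = true ∧ ct.p = false)
    (hvs : ∀ st ∈ vs, st.s = st.p) {D K : List C} {b : C}
    (hok : Ok (ot :: (rs ++ ct :: vs)) D (b :: K)) (a : ℕ) :
    (Runs (ot :: (rs ++ ct :: vs)) (Sw C a ++ Iw (b :: K))).encard =
      ((vs.length + rs.length + 1 + K.length).choose (rs.length + 1) : ℕ) := by
  obtain rfl : b = ot.b := by simpa using hok.2.1 hot.2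
  have hnext : ot.next (ot.b :: K) = K := by simp [Stp.next, hot]
  have hdead : ot.dead D = ot.b :: D := by simp [Stp.dead, hot]
  have hok' := hok.tail
  rw [hnext, hdead] at hok'
  have h0 := runs_pair_row hrs hct hvs (x := ot.b) (by simp) hok' a 0
  rw [runs_cons_option (O₀ := Ew C a ++ Iw (ot.b :: K))
    (W₀ := Sw C a ++ I ot.b :: (Sw C 0 ++ I ot.b :: Iw K))
    (Finset.range K.length) (fun _ => Ew C a ++ Iw (ot.b :: K))
    (fun i => Sw C (a + 1) ++ (Iw (K.take i) ++ E :: Iw (K.drop i)))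
    ?_ ?_ ?_ _ (fun i => (vs.length + rs.length + 1 + i).choose rs.length) h0 ?_]
  · rw [Nat.add_comm, Nat.zero_add, sum_range_choose_add]
  · intro O W'
    rw [line_base_open hot.1 hok.nodup.of_append_right, exists_split_drop]
    simp
    grind
  · intro i hi j hj h
    simp only [fg_append, fg_Sw, fg_Iw, fg_cons_E] at h
    have := (replicate_append_cons_inj (by simp) (by simp) (List.append_cancel_left h)).1
    simp only [Finset.mem_range] at hi hj
    simp only [List.length_take] at this
    omega
  · intro j hj h
    have := congrArg numS h
    simp only [numS_fg, numS_append, numS_Sw, numS_cons_I, numS_cons_E, numS_Iw] at this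
    omega
  · intro i hi
    simp only [Finset.mem_range] at hi
    rw [runs_gap_row hrs hct hvs (by simpa using hi) (by rwa [List.take_append_drop]),
      List.length_take, min_eq_left hi.le]

/-- Same branching as for a row. The gaps sum to `K.length.choose (rs.length + 1)`, and Vandermonde
combines this with the pair into the same total as for a row. -/
theorem runs_open_col {rs vs : List (Stp C)} {ot ct : Stp C} (hot : ot.s = false ∧ ot.p = true)
    (hrs : ∀ st ∈ rs, st.s = false ∧ st.p = false) (hct : ct.s = true ∧ ct.p = false)
    (hvs : ∀ st ∈ vs, st.s = st.p) {D K : List C} {b : C}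
    (hok : Ok (ot :: (rs ++ ct :: vs)) D (b :: K)) (a : ℕ) :
    (Runs (ot :: (rs ++ ct :: vs)) (Sw C a ++ Iw (b :: K))).encard =
      ((vs.length + rs.length + 1 + K.length).choose (rs.length + 1) : ℕ) := by
  obtain rfl : b = ot.b := by simpa using hok.2.1 hot.2
  have hnext : ot.next (ot.b :: K) = K := by simp [Stp.next, hot]
  have hdead : ot.dead D = ot.b :: D := by simp [Stp.dead, hot]
  have hok' := hok.tail
  rw [hnext, hdead] at hok'
  have h0 := runs_pair_col hrs hct hvs (A := []) (x := ot.b) (by simp) hok' a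
  rw [runs_cons_option (O₀ := Ew C a ++ Iw (ot.b :: K))
    (W₀ := Sw C a ++ (Iw [] ++ I ot.b :: I ot.b :: Iw K))
    (Finset.range K.length) (fun _ => Ew C a ++ Iw (ot.b :: K))
    (fun i => Sw C (a + 1) ++ (Iw (K.take i) ++ E :: Iw (K.drop i)))
    ?_ ?_ ?_ _ (fun i => (K.length - 1 - i).choose rs.length) h0 ?_]
  · rw [sum_range_choose_sub, List.length_nil, Nat.add_comm (pairCount _ _ _ _),
      choose_add_pairCount]
  · intro O W'
    rw [line_base_open hot.1 hok.nodup.of_append_right, exists_split_drop]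
    simp
    grind
  · intro i hi j hj h
    simp only [fg_append, fg_Sw, fg_Iw, fg_cons_E] at h
    have := (replicate_append_cons_inj (by simp) (by simp) (List.append_cancel_left h)).1
    simp only [Finset.mem_range] at hi hj
    simp only [List.length_take] at this
    omega
  · intro j hj h
    have := congrArg numS h
    simp only [numS_fg, numS_append, numS_Sw, numS_cons_I, numS_cons_E, numS_Iw] at this
    omega
  · intro i hi
    simp only [Finset.mem_range] at hi
    have h := runs_gap_col hrs hct hvs (D := ot.b :: D) (A := []) (B := K.take i)
      (G := K.drop i) (by simpa using hi) (by simpa using hok') a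
    -- The `S` just created counts as a displaced `S` with no path below it.
    have e : Sw C (a + 1) ++ (Iw (K.take i) ++ E :: Iw (K.drop i)) =
        Sw C a ++ (Iw [] ++ S :: (Iw (K.take i) ++ E :: Iw (K.drop i))) := by
      rw [Sw, List.replicate_succ']
      simp
    rw [e, h, List.length_drop, List.length_nil, Nat.multichoose_zero_right, mul_one,
      Nat.sub_right_comm]

end Columns

end TFPL

namespace TFPL

open TFPL.Sym

/-! ### Runs as assignments of colours to edges -/

section Edges

variable {C : Type}

/-- `InS h v t`: a vertex whose edges to the left and below have the colours `h` and `v` (if they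
are present) has the state `t`. -/
def InS : Option C → Option C → Sym C → Prop
  | none, v, t => t = carrySym v
  | some c, none, t => t = I c
  | some c, some d, t => c = d ∧ t = S

/-- `OutS x h v`: a vertex of state `x` can have edges of the colours `h` to the right and `v`
above. -/
def OutS : Sym C → Option C → Option C → Prop
  | S, h, v => h = none ∧ v = none
  | I c, h, v => (h = some c ∧ v = none) ∨ (h = none ∧ v = some c)
  | E, h, v => ∃ c, h = some c ∧ v = some c

theorem half_cons {x : Sym C} {w T : List (Sym C)} {k : Option C} : Half (x :: w) k T ↔
    ∃ h v t T', OutS x h v ∧ InS h k t ∧ T = t :: T' ∧ Half w v T' := by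
  cases x with
  | S =>
    cases k <;> simp [Half, OutS, InS]
  | I c =>
    cases k with
    | none =>
      simp only [Half, OutS]
      constructor
      · rintro (⟨T', rfl, h⟩ | ⟨T', rfl, h⟩)
        · exact ⟨_, _, _, T', Or.inl ⟨rfl, rfl⟩, rfl, rfl, h⟩
        · exact ⟨_, _, _, T', Or.inr ⟨rfl, rfl⟩, rfl, rfl, h⟩
      · rintro ⟨_, _, _, T', ⟨rfl, rfl⟩ | ⟨rfl, rfl⟩, h1, rfl, h⟩
        · exact Or.inl ⟨T', by rw [show _ = _ from h1], h⟩
        · exact Or.inr ⟨T', by rw [show _ = _ from h1]; rfl, h⟩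
    | some d =>
      simp only [Half, OutS]
      constructor
      · rintro (⟨rfl, T', rfl, h⟩ | ⟨T', rfl, h⟩)
        · exact ⟨_, _, _, T', Or.inl ⟨rfl, rfl⟩, ⟨rfl, rfl⟩, rfl, h⟩
        · exact ⟨_, _, _, T', Or.inr ⟨rfl, rfl⟩, rfl, rfl, h⟩
      · rintro ⟨_, _, _, T', ⟨rfl, rfl⟩ | ⟨rfl, rfl⟩, h1, rfl, h⟩
        · exact Or.inl ⟨h1.1, T', by rw [h1.2], h⟩
        · exact Or.inr ⟨T', by rw [show _ = _ from h1]; rfl, h⟩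
  | E =>
    cases k with
    | none =>
      simp only [Half, OutS]
      constructor
      · rintro ⟨c, T', rfl, h⟩
        exact ⟨_, _, _, T', ⟨c, rfl, rfl⟩, rfl, rfl, h⟩
      · rintro ⟨_, _, _, T', ⟨c, rfl, rfl⟩, h1, rfl, h⟩
        exact ⟨c, T', by rw [show _ = _ from h1], h⟩
    | some d =>
      simp only [Half, OutS]
      constructor
      · rintro ⟨T', rfl, h⟩
        exact ⟨_, _, _, T', ⟨d, rfl, rfl⟩, ⟨rfl, rfl⟩, rfl, h⟩
      · rintro ⟨_, _, _, T', ⟨c, rfl, rfl⟩, ⟨rfl, rfl⟩, rfl, h⟩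
        exact ⟨T', rfl, h⟩

/-- The word of the states `w 0, …, w (m - 1)`. -/
abbrev wd (m : ℕ) (w : ℕ → Sym C) : List (Sym C) := (List.range m).map w

theorem wd_succ (m : ℕ) (w : ℕ → Sym C) : wd (m + 1) w = w 0 :: wd m fun y => w (y + 1) := by
  simp [wd, List.range_succ_eq_map, Function.comp_def]

theorem wd_succ' (m : ℕ) (w : ℕ → Sym C) : wd (m + 1) w = wd m w ++ [w m] := by
  simp [wd, List.range_succ]

theorem eq_wd (w : List (Sym C)) : w = wd w.length fun y => w.getD y E := by
  apply List.ext_getElem <;> simp +contextual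

theorem wd_inj {m : ℕ} {w w' : ℕ → Sym C} : wd m w = wd m w' ↔ ∀ y < m, w y = w' y := by
  simp [wd, List.map_inj_left]

/-- `Half` is a rule for words; here it becomes the existence of coloured edges obeying the rule at
each vertex, which is what a configuration provides. -/
theorem half_range {m : ℕ} {w T : ℕ → Sym C} {k : Option C} :
    Half (wd m w) k (wd (m + 1) T) ↔ ∃ H V : ℕ → Option C, V 0 = k ∧ H m = none ∧
      (∀ y < m, OutS (w y) (H y) (V (y + 1))) ∧ ∀ y ≤ m, InS (H y) (V y) (T y) := by
  induction m generalizing w T k with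
  | zero =>
    simp only [wd, List.range_zero, List.map_nil, Half]
    constructor
    · intro h
      exact ⟨fun _ => none, fun _ => k, rfl, rfl, by simp, by simpa [InS] using h⟩
    · rintro ⟨H, V, rfl, hH, -, h⟩
      have := h 0 le_rfl
      rw [hH] at this
      simpa [InS] using this
  | succ m ih =>
    rw [wd_succ m, wd_succ (m + 1), half_cons]
    constructor
    · rintro ⟨h, v, t, T', hout, hin, heq, hh⟩
      obtain ⟨rfl, rfl⟩ := List.cons.inj heq
      obtain ⟨H, V, rfl, hm, h1, h2⟩ := ih.1 hh
      refine ⟨fun y => y.casesOn h H, fun y => y.casesOn k V, rfl, hm, ?_, ?_⟩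
      · rintro (_ | y) hy
        · exact hout
        · exact h1 y (by omega)
      · rintro (_ | y) hy
        · exact hin
        · exact h2 y (by omega)
    · rintro ⟨H, V, rfl, hm, h1, h2⟩
      exact ⟨H 0, V 1, T 0, _, h1 0 (by omega), h2 0 (by omega), rfl,
        ih.2 ⟨fun y => H (y + 1), fun y => V (y + 1), rfl, hm, fun y hy => h1 (y + 1) (by omega),
          fun y hy => h2 (y + 1) (by omega)⟩⟩

theorem Half.length {w T : List (Sym C)} {k : Option C} (h : Half w k T) :
    T.length = w.length + 1 := by
  induction w generalizing k T with
  | nil => simp [show T = _ from h]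
  | cons x w ih =>
    obtain ⟨_, _, _, T', -, -, rfl, hh⟩ := half_cons.1 h
    simp [ih hh]

theorem Line.length {st : Stp C} {W O W' : List (Sym C)} (h : Line st W O W') :
    O.length = W.length ∧ W'.length = W.length + 1 := by
  obtain ⟨h1, T, h2, h3⟩ := h
  have h1 := h1.length
  have h2 := h2.length
  simp only [List.length_append, List.length_singleton, Nat.add_right_cancel_iff] at h1
  refine ⟨h1, ?_⟩
  rw [← h1, ← h2]
  unfold Fin' at h3
  split_ifs at h3
  · obtain ⟨V, rfl, rfl⟩ := h3
    simp
  · rw [h3.1]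

/-- The extra `E` above an odd antidiagonal means that no edge goes up from the left boundary
vertex, and the top of the even one records whether a path starts there. -/
theorem line_range {st : Stp C} {m : ℕ} {w o w' : ℕ → Sym C} :
    Line st (wd m w) (wd m o) (wd (m + 1) w') ↔
      (∃ H V : ℕ → Option C, V 0 = none ∧ V m = none ∧
        (∀ y < m, OutS (w y) (H y) (V (y + 1))) ∧ ∀ y < m, InS (H y) (V y) (o y)) ∧
      ∃ H V : ℕ → Option C, V 0 = some st.b ∧
        (∀ y < m, OutS (o y) (H y) (V (y + 1))) ∧ (∀ y < m, InS (H y) (V y) (w' y)) ∧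
        if st.s then V m = none ∧ w' m = I st.l else ∃ c, V m = some c ∧ w' m = I c := by
  have e1 : wd m o ++ [E] = wd (m + 1) fun y => if y = m then E else o y := by
    rw [wd_succ', if_pos rfl, wd_inj.2]
    intro y hy
    rw [if_neg hy.ne]
  unfold Line
  refine and_congr ?_ ?_
  · rw [e1, half_range]
    constructor
    · rintro ⟨H, V, h0, hm, h1, h2⟩
      refine ⟨H, V, h0, ?_, h1, fun y hy => ?_⟩
      · have := h2 m le_rfl
        rw [hm, if_pos rfl] at this
        cases h : V m with
        | none => rfl
        | some c => rw [h] at this; simp [InS] at this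
      · have := h2 y hy.le
        rwa [if_neg hy.ne] at this
    · rintro ⟨H, V, h0, hm, h1, h2⟩
      refine ⟨fun y => if y = m then none else H y, V, h0, if_pos rfl, fun y hy => ?_,
        fun y hy => ?_⟩
      · dsimp only
        rw [if_neg hy.ne]; exact h1 y hy
      · dsimp only
        split_ifs with h
        · rw [h, hm]; rfl
        · exact h2 y (by omega)
  · constructor
    · rintro ⟨T, h1, h2⟩
      have hT := h1.length
      rw [List.length_map, List.length_range] at hT
      have hT' := eq_wd T
      rw [hT] at hT'
      generalize (fun y => T.getD y E) = t at hT'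
      subst hT'
      obtain ⟨H, V, h0, hm, h3, h4⟩ := half_range.1 h1
      have h5 := h4 m le_rfl
      rw [hm] at h5
      replace h5 : t m = carrySym (V m) := h5
      refine ⟨H, V, h0, h3, ?_⟩
      unfold Fin' at h2
      split_ifs at h2 with hs
      · obtain ⟨U, h6, h7⟩ := h2
        rw [wd_succ'] at h6 h7
        replace h6 := List.append_inj' h6 rfl
        replace h7 := List.append_inj' h7 rfl
        rw [if_pos hs]
        obtain ⟨rfl, h6⟩ := h6
        refine ⟨fun y hy => ?_, ?_, by simpa using h7.2⟩
        · rw [wd_inj.1 h7.1 y hy]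
          exact h4 y hy.le
        · cases h : V m with
          | none => rfl
          | some c => rw [h] at h5; simp [h5] at h6
      · obtain ⟨h6, U, c, h7⟩ := h2
        rw [wd_inj] at h6
        rw [if_neg hs]
        refine ⟨fun y hy => ?_, c, ?_, ?_⟩
        · rw [h6 y (by omega)]
          exact h4 y hy.le
        · rw [wd_succ'] at h7
          replace h7 := List.append_inj' h7 rfl
          have h8 : t m = I c := by simpa using h7.2
          cases h : V m with
          | none => rw [h, h8] at h5; simp at h5
          | some d => rw [h, h8] at h5; simpa using h5.symm
        · rw [wd_succ'] at h7
          replace h7 := List.append_inj' h7 rfl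
          rw [h6 m (by omega)]
          simpa using h7.2
    · rintro ⟨H, V, h0, h1, h2, h3⟩
      refine ⟨wd (m + 1) fun y => if y = m then carrySym (V m) else w' y, half_range.2
        ⟨fun y => if y = m then none else H y, V, h0, if_pos rfl, fun y hy => ?_,
          fun y hy => ?_⟩, ?_⟩
      · dsimp only
        rw [if_neg hy.ne]; exact h1 y hy
      · dsimp only
        split_ifs with h
        · rw [h]; rfl
        · exact h2 y (by omega)
      · have e : wd m (fun y => if y = m then carrySym (V m) else w' y) = wd m w' := by
          rw [wd_inj]
          intro y hy
          rw [if_neg hy.ne]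
        unfold Fin'
        rw [wd_succ', wd_succ', if_pos rfl, e]
        split_ifs at h3 ⊢
        · exact ⟨_, by rw [h3.1]; rfl, by rw [h3.2]⟩
        · obtain ⟨c, h3, h4⟩ := h3
          rw [h3, h4]
          exact ⟨rfl, _, c, rfl⟩

theorem mem_runs_range {st : ℕ → Stp C} {m : ℕ} {W : List (Sym C)}
    {u : List (List (Sym Unit) × List (Sym Unit))} :
    u ∈ Runs ((List.range m).map st) W ↔ ∃ Os Ws : ℕ → List (Sym C), Ws 0 = W ∧
      (∀ i < m, Line (st i) (Ws i) (Os i) (Ws (i + 1))) ∧ Final (Ws m) ∧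
      u = (List.range m).map fun i => (fg (Os i), fg (Ws (i + 1))) := by
  induction m generalizing st W u with
  | zero =>
    simp only [List.range_zero, List.map_nil, Runs, Set.mem_ofPred_eq]
    constructor
    · rintro ⟨rfl, h⟩
      exact ⟨fun _ => [], fun _ => W, rfl, by simp, h, rfl⟩
    · rintro ⟨Os, Ws, rfl, -, h, rfl⟩
      exact ⟨rfl, h⟩
  | succ m ih =>
    rw [List.range_succ_eq_map, List.map_cons, List.map_map]
    simp only [Runs, Set.mem_ofPred_eq, List.map_cons, List.map_map, Function.comp_def, ih]
    constructor
    · rintro ⟨O, W', u', h, ⟨Os, Ws, rfl, h1, h2, rfl⟩, rfl⟩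
      refine ⟨fun i => i.casesOn O Os, fun i => i.casesOn W Ws, rfl, ?_, h2, rfl⟩
      rintro (_ | i) hi
      · exact h
      · exact h1 i (by omega)
    · rintro ⟨Os, Ws, rfl, h1, h2, rfl⟩
      exact ⟨Os 0, Ws 1, _, h1 0 (by omega), ⟨fun i => Os (i + 1), fun i => Ws (i + 1), rfl,
        fun i hi => h1 (i + 1) (by omega), h2, rfl⟩, rfl⟩

/-- The states `L s y` and the colours `H s y`, `V s y` of the edges to the left of and below the
vertices number `y` of the antidiagonals number `s` fit together, for `m` steps. -/
structure Cfg (st : ℕ → Stp C) (m : ℕ) (H V : ℕ → ℕ → Option C) (L : ℕ → ℕ → Sym C) : Prop where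
  bottom : ∀ i < m, V (2 * i) 0 = some (st i).b
  bottom_odd : ∀ i, i + 1 < m → V (2 * i + 1) 0 = none
  out : ∀ s y, s + 2 < 2 * m → 2 * y ≤ s → OutS (L s y) (H (s + 1) y) (V (s + 1) (y + 1))
  inn : ∀ s y, s + 1 < 2 * m → 2 * y < s → InS (H s y) (V s y) (L s y)
  top_odd : ∀ i, i + 1 < m → V (2 * i + 1) (i + 1) = none
  top_true : ∀ i < m, (st i).s = true → V (2 * i) i = none ∧ L (2 * i) i = I (st i).l
  top_false : ∀ i < m, (st i).s = false → ∃ c, V (2 * i) i = some c ∧ L (2 * i) i = I c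

theorem Cfg.line {st : ℕ → Stp C} {m : ℕ} {H V : ℕ → ℕ → Option C} {L : ℕ → ℕ → Sym C}
    (h : Cfg st m H V L) {i : ℕ} (hi : i < m) :
    Line (st i) (wd i (L (2 * (i - 1)))) (wd i (L (2 * i - 1))) (wd (i + 1) (L (2 * i))) := by
  rw [line_range]
  refine ⟨?_, H (2 * i), V (2 * i), h.bottom i hi, fun y hy => ?_, fun y hy => ?_, ?_⟩
  -- The first step starts from the empty word, so the truncated subtractions in the indices do no
  -- harm.
  · obtain _ | i := i
    · exact ⟨fun _ => none, fun _ => none, rfl, rfl, by simp, by simp⟩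
    · exact ⟨H (2 * i + 1), V (2 * i + 1), h.bottom_odd i hi, h.top_odd i hi,
        fun y hy => h.out (2 * i) y (by omega) (by omega),
        fun y hy => h.inn (2 * i + 1) y (by omega) (by omega)⟩
  · obtain _ | i := i
    · simp at hy
    · exact h.out (2 * i + 1) y (by omega) (by omega)
  · exact h.inn (2 * i) y (by omega) (by omega)
  · split_ifs with hs
    · exact h.top_true i hi hs
    · exact h.top_false i hi (by simpa using hs)

/-- The edges chosen separately for the two halves of each step are interleaved, odd antidiagonals
receiving those of a first half and even ones those of a second half. -/
theorem mem_runs_iff {st : ℕ → Stp C} {m : ℕ} {u : List (List (Sym Unit) × List (Sym Unit))} :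
    u ∈ Runs ((List.range m).map st) [] ↔ ∃ H V L, Cfg st m H V L ∧
      Final (wd m (L (2 * (m - 1)))) ∧
      u = (List.range m).map fun i => (fg (wd i (L (2 * i - 1))), fg (wd (i + 1) (L (2 * i)))) := by
  rw [mem_runs_range]
  constructor
  · rintro ⟨Os, Ws, h0, h1, h2, rfl⟩
    have hW : ∀ i ≤ m, (Ws i).length = i := by
      intro i
      induction i with
      | zero => simp [h0]
      | succ i ih =>
        intro hi
        rw [(h1 i (by omega)).length.2, ih (by omega)]
    have hO : ∀ i < m, (Os i).length = i := fun i hi => by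
      rw [(h1 i hi).length.1, hW i hi.le]
    have hW' : ∀ i ≤ m, Ws i = wd i fun y => (Ws i).getD y E := fun i hi => by
      conv_lhs => rw [eq_wd (Ws i), hW i hi]
    have hO' : ∀ i < m, Os i = wd i fun y => (Os i).getD y E := fun i hi => by
      conv_lhs => rw [eq_wd (Os i), hO i hi]
    have h3 : ∀ i : ℕ, ∃ H₁ V₁ H₂ V₂ : ℕ → Option C, i < m →
        (V₁ 0 = none ∧ V₁ i = none ∧
        (∀ y < i, OutS ((Ws i).getD y E) (H₁ y) (V₁ (y + 1))) ∧
          ∀ y < i, InS (H₁ y) (V₁ y) ((Os i).getD y E)) ∧ V₂ 0 = some (st i).b ∧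
        (∀ y < i, OutS ((Os i).getD y E) (H₂ y) (V₂ (y + 1))) ∧
        (∀ y < i, InS (H₂ y) (V₂ y) ((Ws (i + 1)).getD y E)) ∧
        if (st i).s then V₂ i = none ∧ (Ws (i + 1)).getD i E = I (st i).l else
          ∃ c, V₂ i = some c ∧ (Ws (i + 1)).getD i E = I c := by
      intro i
      by_cases hi : i < m
      · have := h1 i hi
        rw [hW' i hi.le, hO' i hi, hW' (i + 1) (by omega), line_range] at this
        obtain ⟨⟨H₁, V₁, h⟩, H₂, V₂, h'⟩ := this
        exact ⟨H₁, V₁, H₂, V₂, fun _ => ⟨h, h'⟩⟩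
      · exact ⟨fun _ => none, fun _ => none, fun _ => none, fun _ => none, fun h => absurd h hi⟩
    choose H₁ V₁ H₂ V₂ h3 using h3
    refine ⟨fun s => if s % 2 = 0 then H₂ (s / 2) else H₁ (s / 2 + 1),
      fun s => if s % 2 = 0 then V₂ (s / 2) else V₁ (s / 2 + 1),
      fun s y => if s % 2 = 0 then (Ws (s / 2 + 1)).getD y E else (Os (s / 2 + 1)).getD y E,
      ⟨?_, ?_, ?_, ?_, ?_, ?_, ?_⟩, ?_, ?_⟩
    · intro i hi
      simpa using (h3 i hi).2.1
    · intro i hi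
      simpa [Nat.add_mod, show (2 * i + 1) / 2 = i by omega] using (h3 (i + 1) hi).1.1
    · intro s y hs hy
      obtain ⟨i, rfl | rfl⟩ : ∃ i, s = 2 * i ∨ s = 2 * i + 1 := ⟨s / 2, by omega⟩
      · simpa [Nat.add_mod, show (2 * i + 1) / 2 = i by omega] using
          (h3 (i + 1) (by omega)).1.2.2.1 y (by omega)
      · simpa [Nat.add_mod, show (2 * i + 1) / 2 = i by omega,
          show (2 * i + 1 + 1) / 2 = i + 1 by omega] using
          (h3 (i + 1) (by omega)).2.2.1 y (by omega)
    · intro s y hs hy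
      obtain ⟨i, rfl | rfl⟩ : ∃ i, s = 2 * i ∨ s = 2 * i + 1 := ⟨s / 2, by omega⟩
      · simpa using (h3 i (by omega)).2.2.2.1 y (by omega)
      · simpa [Nat.add_mod, show (2 * i + 1) / 2 = i by omega] using
          (h3 (i + 1) (by omega)).1.2.2.2 y (by omega)
    · intro i hi
      simpa [Nat.add_mod, show (2 * i + 1) / 2 = i by omega] using (h3 (i + 1) hi).1.2.1
    · intro i hi hs
      have := (h3 i hi).2.2.2.2
      rw [if_pos hs] at this
      simpa using this
    · intro i hi hs
      have := (h3 i hi).2.2.2.2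
      rw [hs] at this
      simpa using this
    · obtain _ | m := m
      · exact ⟨0, [], rfl⟩
      · rw [hW' (m + 1) le_rfl] at h2
        simpa using h2
    · refine List.map_congr_left fun i hi => ?_
      rw [List.mem_range] at hi
      rw [hO' i hi, hW' (i + 1) hi]
      obtain _ | i := i
      · simp [wd]
      · simp [show (2 * (i + 1) - 1) / 2 = i by omega,
          show (2 * (i + 1) - 1) % 2 = 1 by omega]
  · rintro ⟨H, V, L, h, h2, rfl⟩
    refine ⟨fun i => wd i (L (2 * i - 1)), fun i => wd i (L (2 * (i - 1))), rfl, ?_, h2, rfl⟩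
    intro i hi
    dsimp only
    rw [Nat.add_sub_cancel]
    exact h.line hi

end Edges

end TFPL

namespace TFPL

/-! ### Ends of paths in graphs of degree at most two -/

section Components

variable {V : Type} {f : SimpleGraph V}

/-- The number of neighbours. -/
noncomputable def dg (f : SimpleGraph V) (v : V) : ℕ := (f.neighborSet v).ncard

theorem degree_toSimpleGraph (c : f.ConnectedComponent) [Fintype c.supp]
    [DecidableRel c.toSimpleGraph.Adj] (v : c.supp) :
    SimpleGraph.degree c.toSimpleGraph v = dg f v := by
  rw [dg, ← SimpleGraph.card_neighborSet_eq_degree, ← Nat.card_eq_fintype_card,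
    Nat.card_coe_set_eq, ← Set.ncard_image_of_injective _ Subtype.val_injective]
  congr 1
  ext w
  simp only [Set.mem_image, SimpleGraph.mem_neighborSet, Subtype.exists, exists_and_right,
    exists_eq_right]
  constructor
  · rintro ⟨hw, h⟩
    exact (SimpleGraph.ConnectedComponent.toSimpleGraph_adj c v.2 hw).1 h
  · intro h
    have hw : w ∈ c := c.mem_supp_of_adj_mem_supp v.2 h
    exact ⟨hw, (SimpleGraph.ConnectedComponent.toSimpleGraph_adj c v.2 hw).2 h⟩

/-- A path has at most two ends. -/
theorem sum_deficit (c : f.ConnectedComponent) (hfin : c.supp.Finite)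
    (hdeg : ∀ v ∈ c.supp, dg f v ≤ 2) (T : Finset V) (hT : ∀ v ∈ T, v ∈ c.supp) :
    ∑ v ∈ T, (2 - dg f v) ≤ 2 := by
  classical
  have := hfin.fintype
  have h1 := c.connected_toSimpleGraph.card_vert_le_card_edgeSet_add_one
  have h2 := c.toSimpleGraph.sum_degrees_eq_twice_card_edges
  rw [Nat.card_eq_fintype_card, Nat.card_eq_fintype_card, ← SimpleGraph.edgeFinset_card] at h1
  have h3 : ∑ v : c.supp, (2 - dg f v) + ∑ v : c.supp, SimpleGraph.degree c.toSimpleGraph v =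
      2 * Fintype.card c.supp := by
    rw [← Finset.sum_add_distrib, Finset.sum_congr rfl (g := fun _ => 2)]
    · simp [mul_comm]
    · intro v _
      rw [degree_toSimpleGraph]
      have := hdeg v v.2
      omega
  have h4 : ∑ v ∈ T, (2 - dg f v) ≤ ∑ v : c.supp, (2 - dg f v) := by
    rw [← Finset.sum_coe_sort T]
    refine (Finset.sum_map Finset.univ ⟨fun v : T => (⟨v, hT v v.2⟩ : c.supp), ?_⟩
      (fun v : c.supp => 2 - dg f v)).symm.trans_le
      (Finset.sum_le_sum_of_subset (Finset.subset_univ _))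
    intro a b h
    exact Subtype.ext (congrArg (fun z : c.supp => (z : V)) h)
  have h5 : Fintype.card c.supp ≤ c.toSimpleGraph.edgeFinset.card + 1 := h1
  have h6 : ∑ v : c.supp, SimpleGraph.degree c.toSimpleGraph v =
    2 * c.toSimpleGraph.edgeFinset.card := h2
  omega

/-- The handshake lemma inside the component of `v`. -/
theorem exists_other_odd {v : V} (hfin : (f.connectedComponentMk v).supp.Finite)
    (hv : Odd (dg f v)) : ∃ w ≠ v, f.Reachable v w ∧ Odd (dg f w) := by
  classical
  have := hfin.fintype
  have h1 := (f.connectedComponentMk v).toSimpleGraph.exists_ne_odd_degree_of_exists_odd_degree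
    ⟨v, rfl⟩ (by rw [degree_toSimpleGraph]; exact hv)
  obtain ⟨⟨w, hw⟩, hne, h⟩ := h1
  rw [degree_toSimpleGraph] at h
  refine ⟨w, fun h => hne (Subtype.ext h), ?_, h⟩
  exact (SimpleGraph.ConnectedComponent.exact hw).symm

end Components

/-! ### Antidiagonal coordinates on the triangle -/

section Coordinates

/-- The vertex of height `y` on the antidiagonal number `s`. -/
def pt (s y : ℤ) : ℤ × ℤ := (s - y, y)

theorem pt_inj {s y s' y' : ℤ} : pt s y = pt s' y' ↔ s = s' ∧ y = y' := by
  simp only [pt, Prod.mk.injEq]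
  omega

theorem eq_pt (v : ℤ × ℤ) : v = pt (v.1 + v.2) v.2 := by
  simp [pt]

variable {n : ℕ} {f : SimpleGraph (ℤ × ℤ)}

theorem triangleGraph_adj_iff {n : ℕ} {p q : ℤ × ℤ} : (triangleGraph n).Adj p q ↔
    ((InTriangle n p ∧ InTriangle n q ∧ (q = p + (1, 0) ∨ q = p + (0, 1))) ∨
      ∃ i : Fin (2 * n), p = extV i ∧ q = extV i + (0, 1)) ∨
    ((InTriangle n q ∧ InTriangle n p ∧ (p = q + (1, 0) ∨ p = q + (0, 1))) ∨
      ∃ i : Fin (2 * n), q = extV i ∧ p = extV i + (0, 1)) := by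
  rw [triangleGraph, SimpleGraph.fromRel_adj, and_iff_right_iff_imp]
  rintro ((⟨-, -, rfl | rfl⟩ | ⟨i, rfl, rfl⟩) | (⟨-, -, rfl | rfl⟩ | ⟨i, rfl, rfl⟩)) <;>
    simp

theorem horizontal_iff {s y : ℤ} : (triangleGraph n).Adj (pt s y) (pt (s - 1) y) ↔
    0 ≤ y ∧ 2 * y < s ∧ s ≤ 4 * n - 2 := by
  rw [triangleGraph_adj_iff]
  simp only [InTriangle, pt, extV, Prod.mk_add_mk, Prod.mk.injEq]
  constructor
  · rintro ((h | ⟨i, h⟩) | (h | ⟨i, h⟩)) <;> omega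
  · rintro ⟨h1, h2, h3⟩
    refine Or.inr (Or.inl ?_)
    omega

theorem vertical_iff {s y : ℤ} : (triangleGraph n).Adj (pt s y) (pt (s - 1) (y - 1)) ↔
    0 ≤ y ∧ 2 * y ≤ s ∧ s ≤ 4 * n - 2 ∧ (y = 0 → Even s) := by
  rw [triangleGraph_adj_iff]
  simp only [InTriangle, pt, extV, Prod.mk_add_mk, Prod.mk.injEq, Int.even_iff]
  constructor
  · rintro ((h | ⟨i, h⟩) | (h | ⟨i, h⟩)) <;> omega
  · rintro ⟨h1, h2, h3, h4⟩
    refine Or.inr ?_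
    obtain h | h := h1.eq_or_lt
    · have := h4 h.symm
      exact Or.inr ⟨⟨(s / 2).toNat, by omega⟩, by dsimp only; omega⟩
    · refine Or.inl ?_
      omega

theorem adj_iff_of_le (hf : f ≤ triangleGraph n) {p q : ℤ × ℤ} : f.Adj p q ↔ f.Adj p q ∧
    (q = p + (1, 0) ∨ q = p + (0, 1) ∨ q = p - (1, 0) ∨ q = p - (0, 1)) := by
  rw [iff_self_and]
  intro h
  have h := triangleGraph_adj_iff.1 (hf h)
  obtain (⟨-, -, h | h⟩ | ⟨i, rfl, rfl⟩) | (⟨-, -, h | h⟩ | ⟨i, rfl, rfl⟩) := h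
  · exact Or.inl h
  · exact Or.inr (Or.inl h)
  · simp
  · exact Or.inr (Or.inr (Or.inl (by rw [h]; simp)))
  · exact Or.inr (Or.inr (Or.inr (by rw [h]; simp)))
  · simp

open Classical in
theorem dg_eq (hf : f ≤ triangleGraph n) (v : ℤ × ℤ) : dg f v =
    (if f.Adj v (v + (1, 0)) then 1 else 0) + (if f.Adj v (v + (0, 1)) then 1 else 0) +
    (if f.Adj v (v - (1, 0)) then 1 else 0) + (if f.Adj v (v - (0, 1)) then 1 else 0) := by
  have : f.neighborSet v = ↑(({v + (1, 0), v + (0, 1), v - (1, 0), v - (0, 1)} :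
      Finset (ℤ × ℤ)).filter (f.Adj v)) := by
    ext w
    rw [SimpleGraph.mem_neighborSet, adj_iff_of_le hf]
    simp [and_comm]
  have h1 : v + (1, 0) ∉ ({v + (0, 1), v - (1, 0), v - (0, 1)} : Finset (ℤ × ℤ)) := by
    simp [Prod.ext_iff]; omega
  have h2 : v + (0, 1) ∉ ({v - (1, 0), v - (0, 1)} : Finset (ℤ × ℤ)) := by
    simp [Prod.ext_iff]; omega
  have h3 : v - (1, 0) ∉ ({v - (0, 1)} : Finset (ℤ × ℤ)) := by
    simp [Prod.ext_iff]
  rw [dg, this, Set.ncard_coe_finset, Finset.card_filter, Finset.sum_insert h1,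
    Finset.sum_insert h2, Finset.sum_insert h3, Finset.sum_singleton]
  ring

theorem component_finite (hf : f ≤ triangleGraph n) (v : ℤ × ℤ) :
    (f.connectedComponentMk v).supp.Finite := by
  have h : ({p : ℤ × ℤ | ∃ q, (triangleGraph n).Adj p q}).Finite := by
    refine (Set.finite_Icc ((0 : ℤ), (-1 : ℤ)) (4 * n, 4 * n)).subset ?_
    rintro p ⟨q, h⟩
    rw [triangleGraph_adj_iff] at h
    simp only [InTriangle, extV, Prod.ext_iff, Prod.fst_add, Prod.snd_add] at h
    rw [Set.mem_Icc, Prod.le_def, Prod.le_def]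
    dsimp only
    obtain (h | ⟨i, h⟩) | (h | ⟨i, h⟩) := h <;> omega
  refine (h.insert v).subset fun w hw => ?_
  obtain ⟨p⟩ : f.Reachable w v := SimpleGraph.ConnectedComponent.exact hw
  cases p with
  | nil => exact Set.mem_insert _ _
  | cons h p => exact Set.mem_insert_of_mem _ ⟨_, hf h⟩

end Coordinates

end TFPL

namespace TFPL

/-! ### Configurations as sets of edges to the left of and below vertices -/

section Bits

variable {n : ℕ}

/-- The letter number `i` is a `1`. -/
def one (w : Word n) (i : ℕ) : Bool := if h : i < 2 * n then decide (w ⟨i, h⟩ = 1) else false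

theorem one_fin (w : Word n) (i : Fin (2 * n)) : one w i = true ↔ w i = 1 := by
  simp [one]

theorem one_fin_false (w : Word n) (i : Fin (2 * n)) : one w i = false ↔ w i = 0 := by
  simp only [one, i.isLt, dif_pos, decide_eq_false_iff_not]
  generalize w i = x
  revert x
  decide

/-- The conditions on a configuration that do not involve its paths. -/
structure Loc (s t : Word n) (f : SimpleGraph (ℤ × ℤ)) : Prop where
  subgraph : f ≤ triangleGraph n
  degree_two : ∀ v : ℤ × ℤ, 0 ≤ v.2 → v.2 < v.1 → v.1 + v.2 < 4 * (n : ℤ) - 2 →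
    (f.neighborSet v).ncard = 2
  external : ∀ i : Fin (2 * n), f.Adj (extV i) (extV i + (0, 1))
  left_horizontal : ∀ i : Fin (2 * n), i.val + 1 < 2 * n → f.Adj (leftV i) (leftV i + (1, 0))
  left_vertical : ∀ i : Fin (2 * n), f.Adj (leftV i) (leftV i - (0, 1)) ↔ s i = 0
  right_horizontal : ∀ i : Fin (2 * n), 0 < i.val → f.Adj (rightV i) (rightV i - (1, 0))
  right_vertical : ∀ i : Fin (2 * n), f.Adj (rightV i) (rightV i - (0, 1)) ↔ t i = 1

theorem IsTFPL.loc {s t p : Word n} {f : SimpleGraph (ℤ × ℤ)} (h : IsTFPL s t p f) : Loc s t f :=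
  ⟨h.1, h.2, h.3, h.4, h.5, h.6, h.7⟩

/-- The vertex number `y` of the antidiagonal number `a` has an edge to its left. -/
def hB (f : SimpleGraph (ℤ × ℤ)) (a y : ℕ) : Prop := f.Adj (pt a y) (pt ((a : ℤ) - 1) y)

/-- The vertex number `y` of the antidiagonal number `a` has an edge below it. -/
def vB (f : SimpleGraph (ℤ × ℤ)) (a y : ℕ) : Prop := f.Adj (pt a y) (pt ((a : ℤ) - 1) ((y : ℤ) - 1))

open Classical in
/-- The number of true propositions among four. -/
noncomputable def cnt (p q r s : Prop) : ℕ :=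
  (if p then 1 else 0) + (if q then 1 else 0) + (if r then 1 else 0) + (if s then 1 else 0)

/-- The edges `H` to the left of the vertices and `V` below them satisfy the conditions inside the
triangle and on its left and lower boundaries. -/
structure Bits (n : ℕ) (s : ℕ → Bool) (H V : ℕ → ℕ → Prop) : Prop where
  ext : ∀ i < 2 * n, V (2 * i) 0
  deg : ∀ a y, a + 2 < 4 * n → 2 * y < a →
    cnt (H (a + 1) y) (V (a + 1) (y + 1)) (H a y) (V a y) = 2
  lh : ∀ i, i + 1 < 2 * n → H (2 * i + 1) i
  lv : ∀ i < 2 * n, V (2 * i) i ↔ s i = false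
  domH : ∀ a y, H a y → 2 * y < a ∧ a + 2 ≤ 4 * n
  domV : ∀ a y, V a y → 2 * y ≤ a ∧ a + 2 ≤ 4 * n ∧ (y = 0 → Even a)

/-- The conditions on the right boundary, for the right boundary word `0^n 1^n`. -/
structure BitsRight (n : ℕ) (H V : ℕ → ℕ → Prop) : Prop where
  rh : ∀ y, y + 1 < 2 * n → H (4 * n - 2) y
  rv : ∀ y < 2 * n, V (4 * n - 2) y ↔ y < n

theorem adj_right {f : SimpleGraph (ℤ × ℤ)} {a y : ℕ} {v : ℤ × ℤ} (hv : v = pt a y) :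
    f.Adj v (v + (1, 0)) ↔ hB f (a + 1) y := by
  rw [hB, f.adj_comm, hv]
  have h1 : pt a y + (1, 0) = pt ((a + 1 : ℕ) : ℤ) y := by
    simp [pt]; ring
  have h2 : pt a y = pt (((a + 1 : ℕ) : ℤ) - 1) y := by
    simp [pt]
  rw [h1, ← h2]

theorem adj_up {f : SimpleGraph (ℤ × ℤ)} {a y : ℕ} {v : ℤ × ℤ} (hv : v = pt a y) :
    f.Adj v (v + (0, 1)) ↔ vB f (a + 1) (y + 1) := by
  rw [vB, f.adj_comm, hv]
  have h1 : pt a y + (0, 1) = pt ((a + 1 : ℕ) : ℤ) ((y + 1 : ℕ) : ℤ) := by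
    simp [pt]
  have h2 : pt a y = pt (((a + 1 : ℕ) : ℤ) - 1) (((y + 1 : ℕ) : ℤ) - 1) := by
    simp [pt]
  rw [h1, ← h2]

theorem adj_left {f : SimpleGraph (ℤ × ℤ)} {a y : ℕ} {v : ℤ × ℤ} (hv : v = pt a y) :
    f.Adj v (v - (1, 0)) ↔ hB f a y := by
  rw [hB, hv]
  have h1 : pt a y - (1, 0) = pt ((a : ℤ) - 1) y := by
    simp [pt]; ring
  rw [h1]

theorem adj_down {f : SimpleGraph (ℤ × ℤ)} {a y : ℕ} {v : ℤ × ℤ} (hv : v = pt a y) :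
    f.Adj v (v - (0, 1)) ↔ vB f a y := by
  rw [vB, hv]
  have h1 : pt a y - (0, 1) = pt ((a : ℤ) - 1) ((y : ℤ) - 1) := by
    simp [pt]
  rw [h1]

theorem dg_pt {f : SimpleGraph (ℤ × ℤ)} (hf : f ≤ triangleGraph n) (a y : ℕ) :
    dg f (pt a y) = cnt (hB f (a + 1) y) (vB f (a + 1) (y + 1)) (hB f a y) (vB f a y) := by
  classical
  rw [dg_eq hf, cnt]
  simp only [adj_right rfl, adj_up rfl, adj_left rfl, adj_down rfl]

theorem leftV_eq (i : Fin (2 * n)) : leftV i = pt ((2 * i.val : ℕ) : ℤ) i.val := by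
  simp [leftV, pt]; ring

theorem extV_add (i : Fin (2 * n)) : extV i + (0, 1) = pt ((2 * i.val : ℕ) : ℤ) (0 : ℕ) := by
  simp [extV, pt]

theorem extV_eq (i : Fin (2 * n)) :
    extV i = pt (((2 * i.val : ℕ) : ℤ) - 1) (((0 : ℕ) : ℤ) - 1) := by
  simp [extV, pt]

theorem rightV_eq (i : Fin (2 * n)) :
    rightV i = pt ((4 * n - 2 : ℕ) : ℤ) ((2 * n - 1 - i.val : ℕ) : ℤ) := by
  have := i.isLt
  rw [rightV, pt, Prod.mk.injEq]
  omega

theorem bits_of_loc {s : Word n} {f : SimpleGraph (ℤ × ℤ)} (h : Loc s (zeroWord n) f) :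
    Bits n (one s) (hB f) (vB f) ∧ BitsRight n (hB f) (vB f) := by
  refine ⟨⟨?_, ?_, ?_, ?_, ?_, ?_⟩, ⟨?_, ?_⟩⟩
  · intro i hi
    have := h.external ⟨i, hi⟩
    rw [f.adj_comm, extV_add, extV_eq] at this
    exact this
  · intro a y ha hy
    rw [← dg_pt h.subgraph]
    exact h.degree_two _ (by simp [pt]) (by simp [pt]; omega) (by simp [pt]; omega)
  · intro i hi
    exact (adj_right (leftV_eq _)).1 (h.left_horizontal ⟨i, by omega⟩ hi)
  · intro i hi
    exact (adj_down (leftV_eq ⟨i, hi⟩)).symm.trans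
      ((h.left_vertical _).trans (one_fin_false s ⟨i, hi⟩).symm)
  · intro a y hH
    have := horizontal_iff.1 (h.subgraph hH)
    omega
  · intro a y hV
    have := vertical_iff.1 (h.subgraph hV)
    refine ⟨by omega, by omega, fun hy => ?_⟩
    have := this.2.2.2 (by omega)
    exact_mod_cast this
  · intro y hy
    have hlt : 2 * n - 1 - y < 2 * n := by omega
    have := (adj_left (rightV_eq ⟨_, hlt⟩)).1 (h.right_horizontal ⟨_, hlt⟩ (by dsimp only; omega))
    dsimp only at this
    rwa [show 2 * n - 1 - (2 * n - 1 - y) = y by omega] at this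
  · intro y hy
    have hlt : 2 * n - 1 - y < 2 * n := by omega
    have h1 := adj_down (f := f) (rightV_eq ⟨_, hlt⟩)
    rw [h.right_vertical] at h1
    dsimp only at h1
    rw [show 2 * n - 1 - (2 * n - 1 - y) = y by omega] at h1
    rw [← h1, zeroWord]
    dsimp only
    split_ifs <;> simp <;> omega

theorem loc_of_bits {s : Word n} {f : SimpleGraph (ℤ × ℤ)} (hf : f ≤ triangleGraph n)
    (h : Bits n (one s) (hB f) (vB f)) (hr : BitsRight n (hB f) (vB f)) :
    Loc s (zeroWord n) f := by
  refine ⟨hf, ?_, ?_, ?_, ?_, ?_, ?_⟩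
  · intro v h1 h2 h3
    have e : v = pt ((v.1 + v.2).toNat : ℤ) (v.2.toNat : ℤ) := by
      rw [Int.toNat_of_nonneg h1, Int.toNat_of_nonneg (by omega)]
      exact eq_pt v
    have := h.deg (v.1 + v.2).toNat v.2.toNat (by omega) (by omega)
    rwa [← dg_pt hf, ← e] at this
  · intro i
    rw [f.adj_comm, extV_add, extV_eq]
    exact h.ext i i.isLt
  · intro i hi
    exact (adj_right (leftV_eq i)).2 (h.lh i hi)
  · intro i
    rw [adj_down (leftV_eq i), h.lv i i.isLt, one_fin_false]
  · intro i hi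
    exact (adj_left (rightV_eq i)).2 (hr.rh _ (by omega))
  · intro i
    rw [adj_down (rightV_eq i), hr.rv _ (by omega), zeroWord]
    split_ifs <;> simp <;> omega

/-- The graph with the given edges to the left of the vertices and below them. -/
def gr (H V : ℕ → ℕ → Prop) : SimpleGraph (ℤ × ℤ) :=
  SimpleGraph.fromRel fun p q => ∃ a y : ℕ, p = pt a y ∧
    ((H a y ∧ q = pt ((a : ℤ) - 1) y) ∨ (V a y ∧ q = pt ((a : ℤ) - 1) ((y : ℤ) - 1)))

theorem gr_adj {H V : ℕ → ℕ → Prop} {p q : ℤ × ℤ} (h : (gr H V).Adj p q) :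
    (∃ a y : ℕ, p = pt a y ∧
      ((H a y ∧ q = pt ((a : ℤ) - 1) y) ∨ (V a y ∧ q = pt ((a : ℤ) - 1) ((y : ℤ) - 1)))) ∨
    (∃ a y : ℕ, q = pt a y ∧
      ((H a y ∧ p = pt ((a : ℤ) - 1) y) ∨ (V a y ∧ p = pt ((a : ℤ) - 1) ((y : ℤ) - 1)))) :=
  ((SimpleGraph.fromRel_adj _ _ _).1 h).2

theorem hB_gr {H V : ℕ → ℕ → Prop} : hB (gr H V) = H := by
  funext a y
  rw [hB, gr, SimpleGraph.fromRel_adj, eq_iff_iff]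
  constructor
  · rintro ⟨-, ⟨a', y', h, ⟨h', h2⟩ | ⟨h', h2⟩⟩ | ⟨a', y', h, ⟨h', h2⟩ | ⟨h', h2⟩⟩⟩ <;>
      rw [pt_inj] at h h2
    · rwa [show a = a' by omega, show y = y' by omega]
    all_goals omega
  · intro h
    refine ⟨?_, Or.inl ⟨a, y, rfl, Or.inl ⟨h, rfl⟩⟩⟩
    rw [Ne, pt_inj]
    omega

theorem vB_gr {H V : ℕ → ℕ → Prop} : vB (gr H V) = V := by
  funext a y
  rw [vB, gr, SimpleGraph.fromRel_adj, eq_iff_iff]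
  constructor
  · rintro ⟨-, ⟨a', y', h, ⟨h', h2⟩ | ⟨h', h2⟩⟩ | ⟨a', y', h, ⟨h', h2⟩ | ⟨h', h2⟩⟩⟩ <;>
      rw [pt_inj] at h h2
    · omega
    · rwa [show a = a' by omega, show y = y' by omega]
    all_goals omega
  · intro h
    refine ⟨?_, Or.inl ⟨a, y, rfl, Or.inr ⟨h, rfl⟩⟩⟩
    rw [Ne, pt_inj]
    omega

theorem gr_le {s : ℕ → Bool} {H V : ℕ → ℕ → Prop} (h : Bits n s H V) :
    gr H V ≤ triangleGraph n := by
  have key : ∀ p q : ℤ × ℤ, (∃ a y : ℕ, p = pt a y ∧ ((H a y ∧ q = pt ((a : ℤ) - 1) y) ∨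
      (V a y ∧ q = pt ((a : ℤ) - 1) ((y : ℤ) - 1)))) → (triangleGraph n).Adj p q := by
    rintro _ _ ⟨a, y, rfl, ⟨h', rfl⟩ | ⟨h', rfl⟩⟩
    · have := h.domH a y h'
      rw [horizontal_iff]
      omega
    · have := h.domV a y h'
      rw [vertical_iff]
      refine ⟨by omega, by omega, by omega, fun hy => ?_⟩
      have := this.2.2 (by omega)
      exact_mod_cast this
  intro p q hpq
  obtain h' | h' := gr_adj hpq
  · exact key p q h'
  · exact (key q p h').symm

/-- Each edge of the triangle, external ones included, is the left or the lower edge of exactly one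
of its ends, the one on the later antidiagonal. -/
theorem eq_of_bits {f g : SimpleGraph (ℤ × ℤ)} (hf : f ≤ triangleGraph n)
    (hg : g ≤ triangleGraph n) (hH : ∀ a y, hB f a y ↔ hB g a y)
    (hV : ∀ a y, vB f a y ↔ vB g a y) : f = g := by
  have key : ∀ p q : ℤ × ℤ, (triangleGraph n).Adj p q → ∃ a y : ℕ,
      (p = pt a y ∧ (q = pt ((a : ℤ) - 1) y ∨ q = pt ((a : ℤ) - 1) ((y : ℤ) - 1))) ∨
      (q = pt a y ∧ (p = pt ((a : ℤ) - 1) y ∨ p = pt ((a : ℤ) - 1) ((y : ℤ) - 1))) := by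
    intro p q h
    rw [triangleGraph_adj_iff] at h
    simp only [InTriangle, extV, Prod.ext_iff, Prod.fst_add, Prod.snd_add] at h
    obtain (h | ⟨i, h⟩) | (h | ⟨i, h⟩) := h
    · refine ⟨(q.1 + q.2).toNat, q.2.toNat, Or.inr ?_⟩
      simp only [pt, Prod.ext_iff]
      omega
    · refine ⟨(q.1 + q.2).toNat, q.2.toNat, Or.inr ?_⟩
      simp only [pt, Prod.ext_iff]
      omega
    · refine ⟨(p.1 + p.2).toNat, p.2.toNat, Or.inl ?_⟩
      simp only [pt, Prod.ext_iff]
      omega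
    · refine ⟨(p.1 + p.2).toNat, p.2.toNat, Or.inl ?_⟩
      simp only [pt, Prod.ext_iff]
      omega
  have key2 : ∀ p q : ℤ × ℤ, (triangleGraph n).Adj p q → (f.Adj p q ↔ g.Adj p q) := by
    intro p q h
    obtain ⟨a, y, ⟨rfl, rfl | rfl⟩ | ⟨rfl, rfl | rfl⟩⟩ := key p q h
    · exact hH a y
    · exact hV a y
    · rw [f.adj_comm, g.adj_comm]; exact hH a y
    · rw [f.adj_comm, g.adj_comm]; exact hV a y
  ext p q
  exact ⟨fun h => (key2 p q (hf h)).1 h, fun h => (key2 p q (hg h)).2 h⟩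

end Bits

end TFPL

namespace TFPL

open TFPL.Sym

/-! ### From a coloured configuration to its words of states -/

section Words

variable {C : Type}

open Classical in
/-- A colour, if a condition holds. -/
noncomputable def optc (P : Prop) (c : C) : Option C := if P then some c else none

@[simp] theorem optc_true {P : Prop} (h : P) (c : C) : optc P c = some c := if_pos h
@[simp] theorem optc_false {P : Prop} (h : ¬ P) (c : C) : optc P c = none := if_neg h

/-- The state of a vertex with edges of the given colours to its left and below. -/
def inSym : Option C → Option C → Sym C
  | none, v => carrySym v
  | some c, none => I c
  | some _, some _ => S

/-- The states of the vertices. The vertices of the left boundary where a path starts are treated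
as if they had one more edge. -/
noncomputable def lab (s : ℕ → Bool) (H V : ℕ → ℕ → Prop) (col : ℕ → ℕ → C) (a y : ℕ) : Sym C :=
  open Classical in
  if a = 2 * y ∧ s y = true then I (col a y) else inSym (optc (H a y) (col a y)) (optc (V a y) (col a y))

variable {n : ℕ} {s : ℕ → Bool} {H V : ℕ → ℕ → Prop}

theorem lab_map {C' : Type} (g : C → C') (col : ℕ → ℕ → C) (a y : ℕ) :
    Sym.map g (lab s H V col a y) = lab s H V (fun a y => g (col a y)) a y := by
  unfold lab
  split_ifs with h
  · rfl
  · by_cases h1 : H a y <;> by_cases h2 : V a y <;> simp [h1, h2, inSym, Sym.map]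

/-- The words of the states on the antidiagonals. -/
noncomputable def wordsOf (n : ℕ) (s : ℕ → Bool) (H V : ℕ → ℕ → Prop) :
    List (List (Sym Unit) × List (Sym Unit)) :=
  (List.range (2 * n)).map fun i =>
    (wd i (lab s H V (fun _ _ => ()) (2 * i - 1)), wd (i + 1) (lab s H V (fun _ _ => ()) (2 * i)))

theorem fg_wd (m : ℕ) (w : ℕ → Sym C) : fg (wd m w) = wd m fun y => Sym.map (fun _ => ()) (w y) := by
  simp [fg, wd, Function.comp_def]

theorem wd_add (m k : ℕ) (w : ℕ → Sym C) : wd (m + k) w = wd m w ++ wd k fun y => w (m + y) := by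
  simp [wd, List.range_add, Function.comp_def]

theorem lab_top_true (col : ℕ → ℕ → C) {y : ℕ} (h : s y = true) :
    lab s H V col (2 * y) y = I (col (2 * y) y) := if_pos ⟨rfl, h⟩

theorem lab_of_ne (col : ℕ → ℕ → C) {a y : ℕ} (h : a ≠ 2 * y) :
    lab s H V col a y = inSym (optc (H a y) (col a y)) (optc (V a y) (col a y)) :=
  if_neg fun h' => h h'.1

/-- Degree two at each vertex is exactly the local rule, once the colour of every edge is read off
its upper or right end and the colours are constant along edges. -/
theorem cfg_of_bits (hb : Bits n s H V) {st : ℕ → Stp C} (hs : ∀ i, (st i).s = s i)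
    {col : ℕ → ℕ → C} (hH : ∀ a y, H (a + 1) y → col (a + 1) y = col a y)
    (hV : ∀ a y, V (a + 1) (y + 1) → col (a + 1) (y + 1) = col a y)
    (hb0 : ∀ i < 2 * n, col (2 * i) 0 = (st i).b)
    (hl : ∀ i < 2 * n, s i = true → col (2 * i) i = (st i).l) :
    Cfg st (2 * n) (fun a y => optc (H a y) (col a y)) (fun a y => optc (V a y) (col a y))
      (lab s H V col) := by
  have htop : ∀ i, ¬ H (2 * i) i := fun i h => by have := hb.domH _ _ h; omega
  have htop' : ∀ i, ¬ V (2 * i + 1) (i + 1) := fun i h => by have := hb.domV _ _ h; omega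
  have hlf : ∀ i < 2 * n, s i = false → lab s H V col (2 * i) i = I (col (2 * i) i) := by
    intro i hi h
    rw [lab, if_neg (by simp [h]), optc_false (htop i), optc_true ((hb.lv i hi).2 h)]
    rfl
  refine ⟨?_, ?_, ?_, ?_, ?_, ?_, ?_⟩
  · intro i hi
    rw [optc_true (hb.ext i hi), hb0 i hi]
  · intro i hi
    refine optc_false (fun h => ?_) _
    have := (hb.domV _ _ h).2.2 rfl
    simp [parity_simps] at this
  · intro a y ha hy
    obtain h | h := hy.eq_or_lt
    · subst h
      have h1 : lab s H V col (2 * y) y = I (col (2 * y) y) := by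
        cases h : s y
        · exact hlf y (by omega) h
        · exact lab_top_true col h
      have h2 := hb.lh y (by omega)
      rw [h1, optc_true h2, optc_false (htop' y), hH _ _ h2]
      exact Or.inl ⟨rfl, rfl⟩
    · have hd := hb.deg a y (by omega) h
      rw [lab_of_ne col (by omega)]
      have e1 := hH a y
      have e2 := hV a y
      by_cases h1 : H a y <;> by_cases h2 : V a y <;> by_cases h3 : H (a + 1) y <;>
        by_cases h4 : V (a + 1) (y + 1) <;>
        simp [h1, h2, h3, h4, cnt] at hd e1 e2 <;> simp [h1, h2, h3, h4, inSym, OutS, e1, e2]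
  · intro a y ha hy
    rw [lab_of_ne col (by omega)]
    by_cases h1 : H a y <;> by_cases h2 : V a y <;> simp [h1, h2, InS, inSym]
  · intro i hi
    exact optc_false (htop' i) _
  · intro i hi h
    rw [hs] at h
    refine ⟨optc_false (fun h' => ?_) _, by rw [lab_top_true col h, hl i hi h]⟩
    rw [hb.lv i hi, h] at h'
    simp at h'
  · intro i hi h
    rw [hs] at h
    exact ⟨_, optc_true ((hb.lv i hi).2 h) _, hlf i hi h⟩

theorem final_of_bits (hb : Bits n s H V) (hr : BitsRight n H V) (col : ℕ → ℕ → C) :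
    Final (wd (2 * n) (lab s H V col (2 * (2 * n - 1)))) := by
  refine ⟨n, (List.range n).map fun y => col (4 * n - 2) (n + y), ?_⟩
  rw [two_mul n, wd_add]
  congr 1
  · rw [List.eq_replicate_iff]
    refine ⟨by simp, ?_⟩
    simp only [List.mem_map, List.mem_range, forall_exists_index, and_imp]
    rintro _ y hy rfl
    rw [lab_of_ne col (by omega), show 2 * (n + n - 1) = 4 * n - 2 by omega,
      optc_true (hr.rh y (by omega)), optc_true ((hr.rv y (by omega)).2 hy)]
    rfl
  · rw [Iw, List.map_map, List.map_inj_left]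
    intro y hy
    rw [List.mem_range] at hy
    have e : 2 * (n + n - 1) = 4 * n - 2 := by omega
    rw [e, Function.comp_apply]
    have h1 : ¬ V (4 * n - 2) (n + y) := by
      rw [hr.rv _ (by omega)]; omega
    by_cases h : 4 * n - 2 = 2 * (n + y)
    · refine if_pos ⟨h, ?_⟩
      have := hb.lv (n + y) (by omega)
      rw [← h] at this
      simpa [h1] using this
    · rw [lab_of_ne col h, optc_true (hr.rh _ (by omega)), optc_false h1]
      rfl

theorem wordsOf_mem_runs (hb : Bits n s H V) (hr : BitsRight n H V) {st : ℕ → Stp C}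
    (hs : ∀ i, (st i).s = s i) {col : ℕ → ℕ → C}
    (hH : ∀ a y, H (a + 1) y → col (a + 1) y = col a y)
    (hV : ∀ a y, V (a + 1) (y + 1) → col (a + 1) (y + 1) = col a y)
    (hb0 : ∀ i < 2 * n, col (2 * i) 0 = (st i).b)
    (hl : ∀ i < 2 * n, s i = true → col (2 * i) i = (st i).l) :
    wordsOf n s H V ∈ Runs ((List.range (2 * n)).map st) [] := by
  rw [mem_runs_iff]
  refine ⟨_, _, _, cfg_of_bits hb hs hH hV hb0 hl, final_of_bits hb hr col, ?_⟩
  refine List.map_congr_left fun i _ => ?_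
  simp only [fg_wd, lab_map]

theorem optc_unit_iff {P Q P' Q' : Prop} (h : inSym (optc P ()) (optc Q ()) =
    inSym (optc P' ()) (optc Q' ())) : (P ∧ Q ↔ P' ∧ Q') ∧ (P ∨ Q ↔ P' ∨ Q') := by
  by_cases h1 : P <;> by_cases h2 : Q <;> by_cases h3 : P' <;> by_cases h4 : Q' <;>
    simp_all [inSym]

theorem iff_of_and_or {p q p' q' : Prop} (hq : q ↔ q') (h1 : p ∧ q ↔ p' ∧ q')
    (h2 : p ∨ q ↔ p' ∨ q') : p ↔ p' := by
  tauto

theorem cnt_two_iff {p q r t p' q' r' t' : Prop} (h : cnt p q r t = 2) (h' : cnt p' q' r' t' = 2)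
    (hp : p ↔ p') (h1 : r ∧ t ↔ r' ∧ t') (h2 : r ∨ t ↔ r' ∨ t') : q ↔ q' := by
  classical
  obtain rfl := propext hp
  have e : cnt p q r t = cnt p q r' t' := by
    unfold cnt
    by_cases a : r <;> by_cases b : t <;> by_cases c : r' <;> by_cases d : t' <;> simp_all
  rw [e] at h
  by_cases a : q <;> by_cases b : q' <;> simp [cnt, a, b] at h h' ⊢ <;> omega

/-- A state tells only how many incoming edges there are. Going up an antidiagonal, the lowest
vertical edge is known; with the state it gives the left edge, and the degree of the vertex to the
left then gives the next vertical edge. -/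
theorem bits_eq_of_wordsOf {H' V' : ℕ → ℕ → Prop} (hb : Bits n s H V) (hb' : Bits n s H' V')
    (h : wordsOf n s H V = wordsOf n s H' V') :
    (∀ a y, H a y ↔ H' a y) ∧ ∀ a y, V a y ↔ V' a y := by
  have hlab : ∀ a y, a + 2 ≤ 4 * n → 2 * y ≤ a →
      lab s H V (fun _ _ => ()) a y = lab s H' V' (fun _ _ => ()) a y := by
    intro a y ha hy
    rw [wordsOf, wordsOf, List.map_inj_left] at h
    obtain ⟨i, rfl | rfl⟩ : ∃ i, a = 2 * i ∨ a = 2 * i + 1 := ⟨a / 2, by omega⟩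
    · have := (Prod.mk.inj (h i (by simp; omega))).2
      exact wd_inj.1 this y (by omega)
    · have := (Prod.mk.inj (h (i + 1) (by simp; omega))).1
      exact wd_inj.1 this y (by omega)
  have hin : ∀ a y, a + 2 ≤ 4 * n → 2 * y < a →
      (H a y ∧ V a y ↔ H' a y ∧ V' a y) ∧ (H a y ∨ V a y ↔ H' a y ∨ V' a y) := by
    intro a y ha hy
    have := hlab a y ha hy.le
    rw [lab_of_ne _ (by omega), lab_of_ne _ (by omega)] at this
    exact optc_unit_iff this
  have key : ∀ a y, a + 2 ≤ 4 * n → 2 * y ≤ a → (V a y ↔ V' a y) := by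
    intro a y ha
    induction y with
    | zero =>
      intro _
      obtain ⟨i, rfl | rfl⟩ : ∃ i, a = 2 * i ∨ a = 2 * i + 1 := ⟨a / 2, by omega⟩
      · exact iff_of_true (hb.ext i (by omega)) (hb'.ext i (by omega))
      · refine iff_of_false (fun h => ?_) (fun h => ?_)
        · have := (hb.domV _ _ h).2.2 rfl
          simp [parity_simps] at this
        · have := (hb'.domV _ _ h).2.2 rfl
          simp [parity_simps] at this
    | succ y ih =>
      intro hy
      have h1 := ih (by omega)
      have h2 := hin a y ha (by omega)
      obtain ⟨a, rfl⟩ : ∃ b, a = b + 1 := ⟨a - 1, by omega⟩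
      have h3 := hin a y (by omega) (by omega)
      have h4 := hb.deg a y (by omega) (by omega)
      have h5 := hb'.deg a y (by omega) (by omega)
      have h6 := iff_of_and_or h1 h2.1 h2.2
      exact cnt_two_iff h4 h5 h6 h3.1 h3.2
  refine ⟨fun a y => ?_, fun a y => ?_⟩
  · by_cases hd : a + 2 ≤ 4 * n ∧ 2 * y < a
    · have h1 := key a y hd.1 (by omega)
      have h2 := hin a y hd.1 hd.2
      exact iff_of_and_or h1 h2.1 h2.2
    · refine iff_of_false (fun h => hd ?_) (fun h => hd ?_)
      · have := hb.domH _ _ h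
        omega
      · have := hb'.domH _ _ h
        omega
  · by_cases hd : a + 2 ≤ 4 * n ∧ 2 * y ≤ a
    · exact key a y hd.1 hd.2
    · refine iff_of_false (fun h => hd ?_) (fun h => hd ?_)
      · have := hb.domV _ _ h
        omega
      · have := hb'.domV _ _ h
        omega

end Words

end TFPL

namespace TFPL

open TFPL.Sym

/-! ### From coloured edges back to a configuration -/

section CfgBits

variable {C : Type} {n : ℕ} {st : ℕ → Stp C} {H V : ℕ → ℕ → Option C}
  {L : ℕ → ℕ → Sym C}

theorem Cfg.top (h : Cfg st (2 * n) H V L) {i : ℕ} (hi : i < 2 * n) : ∃ c, L (2 * i) i = I c := by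
  cases hs : (st i).s
  · obtain ⟨c, -, hc⟩ := h.top_false i hi hs
    exact ⟨c, hc⟩
  · exact ⟨_, (h.top_true i hi hs).2⟩

variable [Inhabited C]

/-- The edges to the left of the vertices. -/
def Hb (n : ℕ) (H : ℕ → ℕ → Option C) (a y : ℕ) : Prop :=
  a + 2 ≤ 4 * n ∧ 2 * y < a ∧ ∃ c, H a y = some c

/-- The edges below the vertices. -/
def Vb (n : ℕ) (V : ℕ → ℕ → Option C) (a y : ℕ) : Prop :=
  a + 2 ≤ 4 * n ∧ 2 * y ≤ a ∧ ∃ c, V a y = some c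

/-- The colours of the vertices. -/
def colOf (H : ℕ → ℕ → Option C) (L : ℕ → ℕ → Sym C) (a y : ℕ) : C :=
  match L a y with
  | I c => c
  | S => (H a y).getD default
  | E => (H (a + 1) y).getD default

theorem colOf_I {a y : ℕ} {c : C} (h : L a y = I c) : colOf H L a y = c := by
  simp [colOf, h]

theorem colOf_inn {a y : ℕ} {c : C} (h : InS (H a y) (V a y) (L a y))
    (hc : H a y = some c ∨ V a y = some c) : colOf H L a y = c := by
  unfold colOf
  cases h1 : H a y <;> cases h2 : V a y <;> simp_all [InS]

theorem colOf_out {a y : ℕ} {c : C} (h : OutS (L a y) (H (a + 1) y) (V (a + 1) (y + 1)))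
    (hc : H (a + 1) y = some c ∨ V (a + 1) (y + 1) = some c) : colOf H L a y = c := by
  unfold colOf
  cases h1 : L a y <;> rw [h1] at h
  · simp [OutS] at h
    simp [h] at hc
  · obtain ⟨h2, h3⟩ | ⟨h2, h3⟩ := h <;> simpa [h2, h3] using hc
  · obtain ⟨d, h2, h3⟩ := h
    simpa [h2, h3] using hc

variable (h : Cfg st (2 * n) H V L)
include h

theorem Cfg.colOf_below {a y : ℕ} {c : C} (ha : a + 1 < 2 * (2 * n)) (hy : 2 * y ≤ a)
    (hc : V a y = some c) : colOf H L a y = c := by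
  obtain hy | hy := hy.lt_or_eq
  · exact colOf_inn (h.inn a y ha hy) (Or.inr hc)
  · subst hy
    cases hs : (st y).s
    · obtain ⟨d, h1, h2⟩ := h.top_false y (by omega) hs
      rw [h1] at hc
      rw [colOf_I h2]
      exact Option.some.inj hc
    · rw [(h.top_true y (by omega) hs).1] at hc
      simp at hc

/-- Incoming and outgoing edges of each state add up to two. Outside the triangle `H` and `V` are
arbitrary, which is why `Hb` and `Vb` carry the range conditions. -/
theorem Cfg.bits : Bits n (fun i => (st i).s) (Hb n H) (Vb n V) := by
  refine ⟨?_, ?_, ?_, ?_, ?_, ?_⟩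
  · intro i hi
    exact ⟨by omega, by omega, _, h.bottom i hi⟩
  · intro a y ha hy
    have h1 := h.inn a y (by omega) hy
    have h2 := h.out a y (by omega) hy.le
    have e1 : Hb n H a y ↔ ∃ c, H a y = some c := by simp [Hb, hy]; omega
    have e2 : Vb n V a y ↔ ∃ c, V a y = some c := by simp [Vb, hy.le]; omega
    have e3 : Hb n H (a + 1) y ↔ ∃ c, H (a + 1) y = some c := by
      rw [Hb, ← and_assoc, and_iff_right (by omega)]
    have e4 : Vb n V (a + 1) (y + 1) ↔ ∃ c, V (a + 1) (y + 1) = some c := by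
      rw [Vb, ← and_assoc, and_iff_right (by omega)]
    rw [cnt, e1, e2, e3, e4]
    cases q1 : H a y <;> cases q2 : V a y <;> rw [q1, q2] at h1
    · rw [show L a y = E from h1] at h2
      obtain ⟨c, h3, h4⟩ := h2
      simp [h3, h4]
    · rw [show L a y = I _ from h1] at h2
      obtain ⟨h3, h4⟩ | ⟨h3, h4⟩ := h2 <;> simp [h3, h4]
    · rw [show L a y = I _ from h1] at h2
      obtain ⟨h3, h4⟩ | ⟨h3, h4⟩ := h2 <;> simp [h3, h4]
    · rw [h1.2] at h2
      obtain ⟨h3, h4⟩ := h2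
      simp [h3, h4]
  · intro i hi
    refine ⟨by omega, by omega, ?_⟩
    obtain ⟨c, hc⟩ := h.top (i := i) (by omega)
    have := h.out (2 * i) i (by omega) le_rfl
    rw [hc, h.top_odd i hi] at this
    obtain ⟨h1, -⟩ | ⟨-, h1⟩ := this
    · exact ⟨c, h1⟩
    · simp at h1
  · intro i hi
    rw [Vb, ← and_assoc, and_iff_right (by omega)]
    cases hs : (st i).s
    · obtain ⟨c, hc, -⟩ := h.top_false i hi hs
      simp [hc]
    · simp [(h.top_true i hi hs).1]
  · rintro a y ⟨h1, h2, -⟩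
    exact ⟨h2, h1⟩
  · rintro a y ⟨h1, h2, c, hc⟩
    refine ⟨h2, h1, ?_⟩
    rintro rfl
    by_contra ha
    obtain ⟨i, rfl⟩ := Nat.not_even_iff_odd.1 ha
    rw [h.bottom_odd i (by omega)] at hc
    simp at hc

theorem Cfg.colOf_left (a y : ℕ) (hH : Hb n H (a + 1) y) :
    colOf H L (a + 1) y = colOf H L a y := by
  obtain ⟨h1, h2, c, hc⟩ := hH
  rw [colOf_inn (h.inn (a + 1) y (by omega) h2) (Or.inl hc),
    colOf_out (h.out a y (by omega) (by omega)) (Or.inl hc)]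

theorem Cfg.colOf_down (a y : ℕ) (hV : Vb n V (a + 1) (y + 1)) :
    colOf H L (a + 1) (y + 1) = colOf H L a y := by
  obtain ⟨h1, h2, c, hc⟩ := hV
  rw [h.colOf_below (by omega) h2 hc, colOf_out (h.out a y (by omega) (by omega)) (Or.inr hc)]

theorem Cfg.colOf_bottom (i : ℕ) (hi : i < 2 * n) : colOf H L (2 * i) 0 = (st i).b :=
  h.colOf_below (by omega) (by omega) (h.bottom i hi)

theorem Cfg.colOf_top (i : ℕ) (hi : i < 2 * n) (hs : (st i).s = true) :
    colOf H L (2 * i) i = (st i).l :=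
  colOf_I (h.top_true i hi hs).2

theorem Cfg.eq_lab (a y : ℕ) (ha : a + 2 ≤ 4 * n) (hy : 2 * y ≤ a) :
    L a y = lab (fun i => (st i).s) (Hb n H) (Vb n V) (colOf H L) a y := by
  obtain hy | rfl := hy.lt_or_eq
  · rw [lab_of_ne _ (by omega)]
    have h1 := h.inn a y (by omega) hy
    have e1 : Hb n H a y ↔ ∃ c, H a y = some c := by
      rw [Hb, ← and_assoc, and_iff_right (by omega)]
    have e2 : Vb n V a y ↔ ∃ c, V a y = some c := by
      rw [Vb, ← and_assoc, and_iff_right (by omega)]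
    have h2 := fun c hc => colOf_inn (c := c) h1 (Or.inl hc)
    have h3 := fun c hc => colOf_inn (c := c) h1 (Or.inr hc)
    rw [e1, e2]
    revert h1 h2 h3
    cases q1 : H a y <;> cases q2 : V a y <;> intro h1 h2 h3
    · simpa [inSym] using (show L a y = E from h1)
    · rw [h3 _ rfl]
      simpa [inSym] using (show L a y = I _ from h1)
    · rw [h2 _ rfl]
      simpa [inSym] using (show L a y = I _ from h1)
    · simpa [inSym] using h1.2
  · cases hs : (st y).s
    · obtain ⟨c, h1, h2⟩ := h.top_false y (by omega) hs
      have e1 : ¬ Hb n H (2 * y) y := fun h => by have := h.2.1; omega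
      have e2 : Vb n V (2 * y) y := ⟨by omega, le_rfl, c, h1⟩
      rw [lab, if_neg (by simp [hs]), optc_false e1, optc_true e2, colOf_I h2, h2]
      rfl
    · rw [lab_top_true _ hs, h.colOf_top y (by omega) hs]
      exact (h.top_true y (by omega) hs).2

theorem Cfg.words_eq : ((List.range (2 * n)).map fun i =>
    (fg (wd i (L (2 * i - 1))), fg (wd (i + 1) (L (2 * i))))) =
      wordsOf n (fun i => (st i).s) (Hb n H) (Vb n V) := by
  refine List.map_congr_left fun i hi => ?_
  rw [List.mem_range] at hi
  rw [fg_wd, fg_wd, Prod.mk.injEq, wd_inj, wd_inj]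
  refine ⟨fun y hy => ?_, fun y hy => ?_⟩
  · rw [h.eq_lab _ _ (by omega) (by omega), lab_map]
  · rw [h.eq_lab _ _ (by omega) (by omega), lab_map]

end CfgBits

/-! ### Counting edges: the shape of the last word -/

section Weights

variable {C : Type}

/-- The number of edges to the left of or below a vertex of the given state. -/
def Sym.wt : Sym C → ℕ
  | S => 2
  | I _ => 1
  | E => 0

/-- The number of edges to the left of or below the vertices of the given states. -/
def wts (w : List (Sym C)) : ℕ := (w.map Sym.wt).sum

/-- Each vertex of `w` sends out two edges minus those it received, and all of them, with the one
entering from below, arrive in `T`. -/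
theorem Half.wts_eq {w T : List (Sym C)} {k : Option C} (h : Half w k T) :
    wts T + wts w = 2 * w.length + k.toList.length := by
  induction w generalizing k T with
  | nil =>
    rw [show T = [carrySym k] from h]
    cases k <;> rfl
  | cons x w ih =>
    obtain ⟨hh, v, t, T', h1, h2, rfl, h3⟩ := half_cons.1 h
    have h4 := ih h3
    have e1 : x.wt + hh.toList.length + v.toList.length = 2 := by
      cases x with
      | S => obtain ⟨rfl, rfl⟩ := h1; rfl
      | I c => obtain ⟨rfl, rfl⟩ | ⟨rfl, rfl⟩ := h1 <;> rfl
      | E => obtain ⟨c, rfl, rfl⟩ := h1; rfl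
    have e2 : t.wt = hh.toList.length + k.toList.length := by
      cases hh <;> cases k
      · rw [show t = _ from h2]; rfl
      · rw [show t = _ from h2]; rfl
      · rw [show t = _ from h2]; rfl
      · rw [h2.2]; rfl
    simp only [wts, List.map_cons, List.sum_cons, List.length_cons] at h4 ⊢
    omega

theorem Line.wts_eq {st : Stp C} {W O W' : List (Sym C)} (h : Line st W O W') :
    wts W' = wts W + 1 + st.s.toNat := by
  have hl := h.length
  obtain ⟨h1, T, h2, h3⟩ := h
  have h1 := h1.wts_eq
  have h2 := h2.wts_eq
  have e : wts (O ++ [E]) = wts O := by simp [wts, Sym.wt]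
  have e' : wts W' = wts T + st.s.toNat := by
    unfold Fin' at h3
    split_ifs at h3 with hs
    · obtain ⟨V, rfl, rfl⟩ := h3
      simp [wts, Sym.wt, hs]
    · simp [h3.1, hs]
  simp only [Option.toList_none, Option.toList_some, List.length_nil, List.length_cons] at h1 h2
  omega

theorem Cfg.wts_eq {m : ℕ} {st : ℕ → Stp C} {H V : ℕ → ℕ → Option C} {L : ℕ → ℕ → Sym C}
    (h : Cfg st m H V L) (i : ℕ) (hi : i ≤ m) : wts (wd i (L (2 * (i - 1)))) =
      i + (List.range i).countP fun j => (st j).s := by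
  induction i with
  | zero => rfl
  | succ i ih =>
    have := (h.line (i := i) (by omega)).wts_eq
    rw [ih (by omega)] at this
    rw [Nat.add_sub_cancel, this, List.range_succ, List.countP_append, List.countP_singleton]
    cases (st i).s <;> simp <;> omega

/-- The last word has length `2n` and weight `3n`: one edge for each external edge and one for each
of the `n` left paths. This determines the number of its letters `S`. -/
theorem Cfg.last {n : ℕ} {st : ℕ → Stp C} {H V : ℕ → ℕ → Option C} {L : ℕ → ℕ → Sym C}
    (h : Cfg st (2 * n) H V L) (hf : Final (wd (2 * n) (L (2 * (2 * n - 1)))))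
    (hn : ((List.range (2 * n)).countP fun j => (st j).s) = n) :
    (∀ y < n, L (4 * n - 2) y = S) ∧ ∀ y, n ≤ y → y < 2 * n → ∃ c, L (4 * n - 2) y = I c := by
  obtain ⟨a, K, hK⟩ := hf
  have h1 := h.wts_eq (2 * n) le_rfl
  rw [hn, hK] at h1
  have h2 := congrArg List.length hK
  have e1 : wts (Sw C a ++ Iw K) = 2 * a + K.length := by
    simp [wts, Sym.wt, Function.comp_def, mul_comm]
  simp only [List.length_map, List.length_range, List.length_append, List.length_replicate] at h2
  obtain rfl : a = n := by omega
  have e2 : 2 * (2 * a - 1) = 4 * a - 2 := by omega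
  rw [e2] at hK
  have key : ∀ y (hy : y < 2 * a), L (4 * a - 2) y = (Sw C a ++ Iw K)[y]'(by simp; omega) := by
    intro y hy
    simp [← hK]
  refine ⟨fun y hy => ?_, fun y hy hy' => ?_⟩
  · rw [key y (by omega), List.getElem_append_left (by simpa using hy)]
    simp
  · rw [key y hy', List.getElem_append_right (by simpa using hy)]
    simp

end Weights

end TFPL

namespace TFPL

open TFPL.Sym

/-! ### Colours force the connections -/

section Paths

variable {n : ℕ} {s : ℕ → Bool} {H V : ℕ → ℕ → Prop} {b l : ℕ → ℕ} {col : ℕ → ℕ → ℕ}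

/-- The colours `col` of the vertices are constant along the paths. -/
structure Coloured (n : ℕ) (s : ℕ → Bool) (H V : ℕ → ℕ → Prop) (b l : ℕ → ℕ)
    (col : ℕ → ℕ → ℕ) : Prop where
  left : ∀ a y, H (a + 1) y → col (a + 1) y = col a y
  down : ∀ a y, V (a + 1) (y + 1) → col (a + 1) (y + 1) = col a y
  bottom : ∀ i < 2 * n, col (2 * i) 0 = b i
  top : ∀ i < 2 * n, s i = true → col (2 * i) i = l i

/-- The colours of the vertices and of the outer ends of the external edges. -/
def vcol (col : ℕ → ℕ → ℕ) (v : ℤ × ℤ) : ℕ :=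
  if v.2 < 0 then col v.1.toNat 0 else col (v.1 + v.2).toNat v.2.toNat

theorem vcol_pt (col : ℕ → ℕ → ℕ) (a y : ℕ) : vcol col (pt a y) = col a y := by
  rw [vcol, if_neg (by simp [pt])]
  simp [pt]

/-- The outer end of the external edge number `i`. -/
def ep (i : ℕ) : ℤ × ℤ := pt (((2 * i : ℕ) : ℤ) - 1) (((0 : ℕ) : ℤ) - 1)

theorem vcol_ep (col : ℕ → ℕ → ℕ) (i : ℕ) : vcol col (ep i) = col (2 * i) 0 := by
  rw [vcol, if_pos (by simp [pt, ep])]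
  congr 1
  simp [pt, ep]
  omega

theorem Coloured.adj (hb : Bits n s H V) (hc : Coloured n s H V b l col) {p q : ℤ × ℤ}
    (h : (gr H V).Adj p q) : vcol col p = vcol col q := by
  have key : ∀ p q : ℤ × ℤ, (∃ a y : ℕ, p = pt a y ∧ ((H a y ∧ q = pt ((a : ℤ) - 1) y) ∨
      (V a y ∧ q = pt ((a : ℤ) - 1) ((y : ℤ) - 1)))) → vcol col p = vcol col q := by
    rintro _ _ ⟨a, y, rfl, ⟨h', rfl⟩ | ⟨h', rfl⟩⟩
    · have := hb.domH _ _ h'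
      obtain ⟨a, rfl⟩ : ∃ a', a = a' + 1 := ⟨a - 1, by omega⟩
      rw [show ((a + 1 : ℕ) : ℤ) - 1 = a by simp, vcol_pt, vcol_pt]
      exact hc.left a y h'
    · have := hb.domV _ _ h'
      obtain _ | y := y
      · obtain ⟨i, rfl⟩ := (this.2.2 rfl).two_dvd
        rw [vcol_pt, ← vcol_ep col]
        rfl
      · obtain ⟨a, rfl⟩ : ∃ a', a = a' + 1 := ⟨a - 1, by omega⟩
        rw [show ((a + 1 : ℕ) : ℤ) - 1 = a by simp, show ((y + 1 : ℕ) : ℤ) - 1 = y by simp,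
          vcol_pt, vcol_pt]
        exact hc.down a y h'
  obtain h' | h' := gr_adj h
  · exact key p q h'
  · exact (key q p h').symm

theorem Coloured.reachable (hb : Bits n s H V) (hc : Coloured n s H V b l col) {p q : ℤ × ℤ}
    (h : (gr H V).Reachable p q) : vcol col p = vcol col q := by
  obtain ⟨w⟩ := h
  induction w with
  | nil => rfl
  | cons h _ ih => exact (hc.adj hb h).trans ih

theorem dg_gr (hb : Bits n s H V) (a y : ℕ) :
    dg (gr H V) (pt a y) = cnt (H (a + 1) y) (V (a + 1) (y + 1)) (H a y) (V a y) := by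
  rw [dg_pt (gr_le hb), hB_gr, vB_gr]

theorem Bits.dg_left (hb : Bits n s H V) {i : ℕ} (hi : i + 1 < 2 * n) :
    dg (gr H V) (pt ((2 * i : ℕ) : ℤ) i) = if s i = true then 1 else 2 := by
  have h1 := hb.lh i hi
  have h2 : ¬ V (2 * i + 1) (i + 1) := fun h => by have := hb.domV _ _ h; omega
  have h3 : ¬ H (2 * i) i := fun h => by have := hb.domH _ _ h; omega
  have h4 := hb.lv i (by omega)
  rw [dg_gr hb]
  cases hs : s i <;> simp [cnt, h1, h2, h3, h4, hs]

theorem dg_ep {f : SimpleGraph (ℤ × ℤ)} (hf : f ≤ triangleGraph n) {i : ℕ}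
    (hi : vB f (2 * i) 0) : dg f (ep i) = 1 := by
  have e1 : ep i + (1, 0) = pt ((2 * i : ℕ) : ℤ) (((0 : ℕ) : ℤ) - 1) := by
    simp [ep, pt]
  have e2 : ep i + (0, 1) = pt ((2 * i : ℕ) : ℤ) (0 : ℕ) := by
    simp [ep, pt]
  have e3 : ep i - (1, 0) = pt ((((2 * i : ℕ) : ℤ) - 1) - 1) (((0 : ℕ) : ℤ) - 1) := by
    simp [ep, pt]
  have e4 : ep i - (0, 1) = pt ((((2 * i : ℕ) : ℤ) - 1) - 1) ((((0 : ℕ) : ℤ) - 1) - 1) := by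
    simp [ep, pt]; ring
  have h1 : ¬ f.Adj (ep i) (ep i + (1, 0)) := by
    intro h
    rw [e1, f.adj_comm] at h
    have := horizontal_iff.1 (hf h)
    omega
  have h3 : ¬ f.Adj (ep i) (ep i - (1, 0)) := by
    intro h
    rw [e3] at h
    have := horizontal_iff.1 (hf h)
    omega
  have h4 : ¬ f.Adj (ep i) (ep i - (0, 1)) := by
    intro h
    rw [e4] at h
    have := vertical_iff.1 (hf h)
    omega
  have h2 : f.Adj (ep i) (ep i + (0, 1)) := by
    rw [e2, f.adj_comm]
    exact hi
  rw [dg_eq hf]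
  simp [h1, h2, h3, h4]

/-- Every vertex of the graph is the outer end of an external edge or belongs to the triangle. -/
theorem exists_pt_of_adj {p q : ℤ × ℤ} (h : (triangleGraph n).Adj p q) :
    (∃ i < 2 * n, p = ep i) ∨ ∃ a y : ℕ, p = pt a y ∧ 2 * y ≤ a ∧ a + 2 ≤ 4 * n := by
  rw [triangleGraph_adj_iff] at h
  simp only [InTriangle, extV, Prod.ext_iff, Prod.fst_add, Prod.snd_add] at h
  obtain (h | ⟨i, h⟩) | (h | ⟨i, h⟩) := h
  · refine Or.inr ⟨(p.1 + p.2).toNat, p.2.toNat, ?_⟩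
    simp only [pt, Prod.ext_iff]
    omega
  · refine Or.inl ⟨i, i.isLt, ?_⟩
    simp only [ep, pt, Prod.ext_iff]
    push_cast
    omega
  · refine Or.inr ⟨(p.1 + p.2).toNat, p.2.toNat, ?_⟩
    simp only [pt, Prod.ext_iff]
    omega
  · refine Or.inr ⟨(p.1 + p.2).toNat, p.2.toNat, ?_⟩
    simp only [pt, Prod.ext_iff]
    omega

/-- Inner vertices, left vertices where no path starts, and the lower half of the right boundary
have degree two; nothing else remains. -/
theorem odd_cases (hb : Bits n s H V) (hlast : ∀ y < n, H (4 * n - 2) y ∧ V (4 * n - 2) y)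
    {v : ℤ × ℤ} (hv : Odd (dg (gr H V) v)) : (∃ i < 2 * n, v = ep i) ∨
      (∃ i, i + 1 < 2 * n ∧ s i = true ∧ v = pt ((2 * i : ℕ) : ℤ) i) ∨
      ∃ y : ℕ, n ≤ y ∧ y < 2 * n ∧ v = pt ((4 * n - 2 : ℕ) : ℤ) y := by
  obtain ⟨w, hw⟩ : ∃ w, (gr H V).Adj v w := by
    by_contra! h
    have : (gr H V).neighborSet v = ∅ := by
      ext w
      simp [h w]
    rw [dg, this, Set.ncard_empty] at hv
    simp at hv
  obtain h | ⟨a, y, rfl, hy, ha⟩ := exists_pt_of_adj (gr_le hb hw)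
  · exact Or.inl h
  · right
    obtain ha | ha := ha.lt_or_eq
    · obtain hy | rfl := hy.lt_or_eq
      · rw [dg_gr hb, hb.deg a y ha hy] at hv
        exact absurd hv (by decide)
      · refine Or.inl ⟨y, by omega, ?_, rfl⟩
        rw [hb.dg_left (by omega)] at hv
        by_contra hs
        rw [if_neg hs] at hv
        exact absurd hv (by decide)
    · refine Or.inr ⟨y, ?_, by omega, by rw [show a = 4 * n - 2 by omega]⟩
      by_contra hy'
      have h1 := hlast y (by omega)
      rw [show 4 * n - 2 = a by omega] at h1
      have h2 : ¬ H (a + 1) y := fun h => by have := hb.domH _ _ h; omega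
      have h3 : ¬ V (a + 1) (y + 1) := fun h => by have := hb.domV _ _ h; omega
      rw [dg_gr hb] at hv
      simp [cnt, h1.1, h1.2, h2, h3] at hv
      exact absurd hv (by decide)

/-- The path from a left vertex has another odd end. Its colour rules out external edges and other
left vertices, so the end is on the right boundary. -/
theorem exists_crossing (hb : Bits n s H V) (hc : Coloured n s H V b l col)
    (hlast : ∀ y < n, H (4 * n - 2) y ∧ V (4 * n - 2) y)
    (hbl : ∀ i < 2 * n, ∀ j < 2 * n, b i ≠ l j)
    (hl : ∀ i < 2 * n, ∀ j < 2 * n, l i = l j → i = j) {i : ℕ} (hi : i < 2 * n)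
    (hs : s i = true) : ∃ y, n ≤ y ∧ y < 2 * n ∧ col (4 * n - 2) y = l i ∧
      (gr H V).Reachable (pt ((2 * i : ℕ) : ℤ) i) (pt ((4 * n - 2 : ℕ) : ℤ) y) := by
  by_cases h : i + 1 < 2 * n
  · obtain ⟨w, hne, hr, hw⟩ := exists_other_odd (component_finite (gr_le hb) _)
      (v := pt ((2 * i : ℕ) : ℤ) i) (by rw [hb.dg_left h, if_pos hs]; decide)
    have h1 := hc.reachable hb hr
    rw [vcol_pt, hc.top i hi hs] at h1
    obtain ⟨j, hj, rfl⟩ | ⟨j, hj, hsj, rfl⟩ | ⟨y, hy, hy', rfl⟩ := odd_cases hb hlast hw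
    · rw [vcol_ep, hc.bottom j hj] at h1
      exact absurd h1.symm (hbl j hj i hi)
    · rw [vcol_pt, hc.top j (by omega) hsj] at h1
      obtain rfl := hl i hi j (by omega) h1
      exact absurd rfl hne
    · rw [vcol_pt] at h1
      exact ⟨y, hy, hy', h1.symm, hr⟩
  · refine ⟨i, by omega, hi, ?_, ?_⟩
    · rw [← hc.top i hi hs]
      congr 1
      omega
    · rw [show 4 * n - 2 = 2 * i by omega]

/-- The `n` left paths reach distinct vertices among the `n` upper right ones, hence all of them. -/
theorem last_colours (hb : Bits n s H V) (hc : Coloured n s H V b l col)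
    (hlast : ∀ y < n, H (4 * n - 2) y ∧ V (4 * n - 2) y)
    (hbl : ∀ i < 2 * n, ∀ j < 2 * n, b i ≠ l j)
    (hl : ∀ i < 2 * n, ∀ j < 2 * n, l i = l j → i = j)
    (hn : ((Finset.range (2 * n)).filter fun i => s i = true).card = n) :
    (∀ y, n ≤ y → y < 2 * n → ∃ i < 2 * n, col (4 * n - 2) y = l i) ∧
      ∀ y y', n ≤ y → y < 2 * n → n ≤ y' → y' < 2 * n →
        col (4 * n - 2) y = col (4 * n - 2) y' → y = y' := by
  have h1 : ∀ i, ∃ y, i < 2 * n → s i = true → n ≤ y ∧ y < 2 * n ∧ col (4 * n - 2) y = l i := by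
    intro i
    by_cases h : i < 2 * n ∧ s i = true
    · obtain ⟨y, h1, h2, h3, -⟩ := exists_crossing hb hc hlast hbl hl h.1 h.2
      exact ⟨y, fun _ _ => ⟨h1, h2, h3⟩⟩
    · exact ⟨0, fun h1 h2 => absurd ⟨h1, h2⟩ h⟩
  choose g hg using h1
  have h2 : ((Finset.range (2 * n)).filter fun i => s i = true).image g = Finset.Ico n (2 * n) := by
    refine Finset.eq_of_subset_of_card_le ?_ ?_
    · intro y hy
      simp only [Finset.mem_image, Finset.mem_filter, Finset.mem_range] at hy
      obtain ⟨i, ⟨hi, hs⟩, rfl⟩ := hy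
      have := hg i hi hs
      exact Finset.mem_Ico.2 ⟨this.1, this.2.1⟩
    · rw [Finset.card_image_of_injOn, hn, Nat.card_Ico]
      · omega
      · intro i hi j hj hij
        simp only [Finset.coe_filter, Finset.mem_range, Set.mem_ofPred_eq] at hi hj
        refine hl i hi.1 j hj.1 ?_
        rw [← (hg i hi.1 hi.2).2.2, ← (hg j hj.1 hj.2).2.2]
        exact congrArg _ hij
  have h3 : ∀ y, n ≤ y → y < 2 * n → ∃ i < 2 * n, s i = true ∧ g i = y := by
    intro y hy hy'
    have : y ∈ Finset.Ico n (2 * n) := Finset.mem_Ico.2 ⟨hy, hy'⟩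
    rw [← h2] at this
    simp only [Finset.mem_image, Finset.mem_filter, Finset.mem_range] at this
    obtain ⟨i, ⟨hi, hs⟩, h⟩ := this
    exact ⟨i, hi, hs, h⟩
  refine ⟨fun y hy hy' => ?_, fun y y' hy1 hy2 hy1' hy2' h => ?_⟩
  · obtain ⟨i, hi, hs, rfl⟩ := h3 y hy hy'
    exact ⟨i, hi, (hg i hi hs).2.2⟩
  · obtain ⟨i, hi, hs, rfl⟩ := h3 y hy1 hy2
    obtain ⟨j, hj, hs', rfl⟩ := h3 y' hy1' hy2'
    rw [(hg i hi hs).2.2, (hg j hj hs').2.2] at h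
    rw [hl i hi j hj h]

/-- The last word does not say whether an upper right vertex is entered from the left or from below.
Suppose the lowest one entered from below is not the lowest of the upper half. Then it shares its
predecessor with the vertex beneath it, though their colours differ. If it is, the staircase of `S`
below it leads down to the last external edge, whose colour is not that of a left path. -/
theorem bitsRight (hb : Bits n s H V) (hc : Coloured n s H V b l col)
    (hlast : ∀ y < n, H (4 * n - 2) y ∧ V (4 * n - 2) y)
    (hlast' : ∀ y, n ≤ y → y + 1 < 2 * n → (H (4 * n - 2) y ↔ ¬ V (4 * n - 2) y))
    (hbl : ∀ i < 2 * n, ∀ j < 2 * n, b i ≠ l j)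
    (hl : ∀ i < 2 * n, ∀ j < 2 * n, l i = l j → i = j)
    (hn : ((Finset.range (2 * n)).filter fun i => s i = true).card = n) : BitsRight n H V := by
  obtain ⟨h1, h2⟩ := last_colours hb hc hlast hbl hl hn
  have key : ∀ y, n ≤ y → y < 2 * n → ¬ V (4 * n - 2) y := by
    intro y
    induction y using Nat.strong_induction_on with
    | _ y ih =>
      intro hy hy' hV
      obtain ⟨a, ha⟩ : ∃ a, 4 * n - 2 = a + 1 := ⟨4 * n - 3, by omega⟩
      obtain ⟨y, rfl⟩ : ∃ z, y = z + 1 := ⟨y - 1, by omega⟩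
      rw [ha] at hV
      have h3 := hc.down a y hV
      by_cases hyn : n ≤ y
      · have h4 := (hlast' y hyn (by omega)).2 (ih y (by omega) hyn (by omega))
        rw [ha] at h4
        have h5 := hc.left a y h4
        rw [← h3, ← ha] at h5
        have := h2 _ _ hyn (by omega) hy hy' h5
        omega
      · have h4 : ∀ k ≤ y, col (a + 1) (y - k) = col (a + 1) (y + 1) := by
          intro k
          induction k with
          | zero =>
            intro _
            have h5 := (hlast y (by omega)).1
            rw [ha] at h5
            rw [h3, Nat.sub_zero, hc.left a y h5]
          | succ k ih =>
            intro hk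
            have h5 := (hlast (y - (k + 1)) (by omega)).1
            have h6 := (hlast (y - k) (by omega)).2
            rw [ha] at h5 h6
            rw [hc.left _ _ h5, ← ih (by omega)]
            obtain ⟨z, hz⟩ : ∃ z, y - k = z + 1 := ⟨y - k - 1, by omega⟩
            rw [hz] at h6 ⊢
            rw [hc.down _ _ h6, show y - (k + 1) = z by omega]
        have h5 := h4 y le_rfl
        obtain ⟨i, hi, h6⟩ := h1 (y + 1) hy hy'
        rw [ha, ← h5, Nat.sub_self, ← ha, show 4 * n - 2 = 2 * (2 * n - 1) by omega,
          hc.bottom _ (by omega)] at h6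
        exact hbl _ (by omega) i hi h6
  refine ⟨fun y hy => ?_, fun y hy => ⟨fun h => ?_, fun h => (hlast y h).2⟩⟩
  · by_cases hyn : y < n
    · exact (hlast y hyn).1
    · exact (hlast' y (by omega) hy).2 (key y (by omega) (by omega))
  · by_contra hyn
    exact key y (by omega) hy h

/-- By parity an external edge is connected to another odd vertex; its colour forces this to be an
external edge with the same label, and only one other carries that label. -/
theorem reachable_iff (hb : Bits n s H V) (hc : Coloured n s H V b l col)
    (hlast : ∀ y < n, H (4 * n - 2) y ∧ V (4 * n - 2) y)
    (hbl : ∀ i < 2 * n, ∀ j < 2 * n, b i ≠ l j)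
    (hl : ∀ i < 2 * n, ∀ j < 2 * n, l i = l j → i = j)
    (hn : ((Finset.range (2 * n)).filter fun i => s i = true).card = n)
    (hbb : ∀ i < 2 * n, ∀ j < 2 * n, ∀ k < 2 * n, b i = b j → i ≠ j → b i = b k → i ≠ k → j = k)
    {i j : ℕ} (hi : i < 2 * n) (hj : j < 2 * n) (hij : i ≠ j) :
    (gr H V).Reachable (ep i) (ep j) ↔ b i = b j := by
  constructor
  · intro h
    have := hc.reachable hb h
    rwa [vcol_ep, vcol_ep, hc.bottom i hi, hc.bottom j hj] at this
  · intro h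
    obtain ⟨w, hne, hr, hw⟩ := exists_other_odd (component_finite (gr_le hb) _)
      (v := ep i) (by rw [dg_ep (gr_le hb) (by rw [vB_gr]; exact hb.ext i hi)]; decide)
    have h1 := hc.reachable hb hr
    rw [vcol_ep, hc.bottom i hi] at h1
    obtain ⟨k, hk, rfl⟩ | ⟨k, hk, hsk, rfl⟩ | ⟨y, hy, hy', rfl⟩ := odd_cases hb hlast hw
    · rw [vcol_ep, hc.bottom k hk] at h1
      rw [hbb i hi j hj k hk h hij h1 (by rintro rfl; exact hne rfl)]
      exact hr
    · rw [vcol_pt, hc.top k (by omega) hsk] at h1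
      exact absurd h1 (hbl i hi k (by omega))
    · rw [vcol_pt] at h1
      obtain ⟨k, hk, h2⟩ := (last_colours hb hc hlast hbl hl hn).1 y hy hy'
      exact absurd (h1.trans h2) (hbl i hi k hk)

end Paths

end TFPL

namespace TFPL

/-! ### The noncrossing matching computed by a stack -/

section Stack

variable (p : ℕ → Bool)

/-- The number of letters `1` with index in `[i, k)`. -/
def co (i k : ℕ) : ℕ := ((Finset.Ico i k).filter fun j => p j = true).card

/-- The number of letters `0` with index in `[i, k)`. -/
def cz (i k : ℕ) : ℕ := ((Finset.Ico i k).filter fun j => p j = false).card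

theorem co_self (i : ℕ) : co p i i = 0 := by simp [co]
theorem cz_self (i : ℕ) : cz p i i = 0 := by simp [cz]

theorem co_succ {i k : ℕ} (h : i ≤ k) : co p i (k + 1) = co p i k + (p k).toNat := by
  rw [co, co, ← Finset.insert_Ico_right_eq_Ico_add_one h, Finset.filter_insert]
  cases hp : p k <;> simp

theorem cz_succ {i k : ℕ} (h : i ≤ k) : cz p i (k + 1) = cz p i k + (!p k).toNat := by
  rw [cz, cz, ← Finset.insert_Ico_right_eq_Ico_add_one h, Finset.filter_insert]
  cases hp : p k <;> simp

theorem co_add_cz (i k : ℕ) : co p i k + cz p i k = k - i := by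
  have := Finset.card_filter_add_card_filter_not (s := Finset.Ico i k) (fun j => p j = true)
  simpa [co, cz] using this

/-- The positions of the unmatched `0`s among the first letters, the last one first. -/
def stackP : ℕ → List ℕ
  | 0 => []
  | i + 1 => if p i then (stackP i).tail else i :: stackP i

/-- The position of the `0` of the pair to which the letter number `i` belongs. -/
def lbl (i : ℕ) : ℕ := if p i then (stackP p i).headD 0 else i

variable {p}

theorem stackP_true {i : ℕ} (h : p i = true) : stackP p (i + 1) = (stackP p i).tail := by
  simp [stackP, h]

theorem stackP_false {i : ℕ} (h : p i = false) : stackP p (i + 1) = i :: stackP p i := by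
  simp [stackP, h]

theorem lt_of_mem_stackP {i x : ℕ} (h : x ∈ stackP p i) : x < i := by
  induction i with
  | zero => simp [stackP] at h
  | succ i ih =>
    cases hp : p i
    · rw [stackP_false hp, List.mem_cons] at h
      obtain rfl | h := h
      · omega
      · have := ih h
        omega
    · rw [stackP_true hp] at h
      have := ih (List.mem_of_mem_tail h)
      omega

theorem stackP_pairwise (i : ℕ) : (stackP p i).Pairwise (· > ·) := by
  induction i with
  | zero => simp [stackP]
  | succ i ih =>
    cases hp : p i
    · rw [stackP_false hp, List.pairwise_cons]
      exact ⟨fun x hx => lt_of_mem_stackP hx, ih⟩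
    · rw [stackP_true hp]
      exact ih.tail

theorem mem_stackP_of_le {m k x : ℕ} (hmk : m ≤ k) (h : x ∈ stackP p k) :
    x ∈ stackP p m ∨ m ≤ x := by
  induction k, hmk using Nat.le_induction with
  | base => exact Or.inl h
  | succ k hmk ih =>
    cases hp : p k
    · rw [stackP_false hp, List.mem_cons] at h
      obtain rfl | h := h
      · exact Or.inr hmk
      · exact ih h
    · rw [stackP_true hp] at h
      exact ih (List.mem_of_mem_tail h)

theorem stackP_length {N : ℕ} (hd : ∀ k ≤ N, co p 0 k ≤ cz p 0 k) {k : ℕ} (hk : k ≤ N) :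
    (stackP p k).length + co p 0 k = cz p 0 k := by
  induction k with
  | zero => simp [stackP, co_self, cz_self]
  | succ k ih =>
    have h1 := ih (by omega)
    have h2 := hd (k + 1) hk
    rw [co_succ p k.zero_le, cz_succ p k.zero_le] at h2 ⊢
    cases hp : p k
    · simp only [stackP_false hp, List.length_cons]
      simp
      omega
    · rw [hp] at h2
      simp only [stackP_true hp, List.length_tail]
      simp at h2 ⊢
      omega

/-- The prefix condition keeps the stack nonempty at each closing letter, so the default value in
`lbl` is never used there. -/
theorem stackP_ne_nil {N : ℕ} (hd : ∀ k ≤ N, co p 0 k ≤ cz p 0 k) {k : ℕ} (hk : k < N)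
    (hp : p k = true) : ∃ P, stackP p k = lbl p k :: P := by
  have h1 := stackP_length hd hk.le
  have h2 := hd (k + 1) hk
  rw [co_succ p k.zero_le, cz_succ p k.zero_le, hp] at h2
  cases h : stackP p k with
  | nil => rw [h] at h1; simp at h1 h2; omega
  | cons x P => exact ⟨P, by simp [lbl, hp, h]⟩

/-- While the letters from `i` on keep a strict excess of `0`s, the stack never sinks to the entry
`i`, and the excess counts what lies above it. -/
theorem stackP_eq {i k : ℕ} (hi : p i = false) (hik : i < k)
    (h : ∀ m, i < m → m ≤ k → co p i m < cz p i m) :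
    ∃ Q, stackP p k = Q ++ i :: stackP p i ∧ Q.length + 1 + co p i k = cz p i k := by
  induction k, hik using Nat.le_induction with
  | base =>
    exact ⟨[], stackP_false hi, by simp [co_succ p le_rfl, cz_succ p le_rfl, hi, co_self, cz_self]⟩
  | succ k hik ih =>
    obtain ⟨Q, h1, h2⟩ := ih fun m hm hm' => h m hm (by omega)
    have h3 := h (k + 1) (by omega) le_rfl
    have hik' : i ≤ k := by omega
    rw [co_succ p hik', cz_succ p hik'] at h3 ⊢
    cases hp : p k
    · refine ⟨k :: Q, by rw [stackP_false hp, h1]; rfl, ?_⟩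
      simp
      omega
    · rw [hp] at h3
      simp at h3
      cases Q with
      | nil => simp at h2; omega
      | cons x Q =>
        refine ⟨Q, by rw [stackP_true hp, h1]; rfl, ?_⟩
        simp at h2 ⊢
        omega

theorem lbl_le (i : ℕ) : lbl p i ≤ i := by
  unfold lbl
  split_ifs
  · cases h : stackP p i with
    | nil => simp
    | cons x P => exact (lt_of_mem_stackP (x := x) (i := i) (p := p) (by simp [h])).le
  · exact le_rfl

theorem letters_of_lbl_eq {N : ℕ} (hd : ∀ k ≤ N, co p 0 k ≤ cz p 0 k) {i j : ℕ} (hij : i < j)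
    (hj : j < N) (h : lbl p i = lbl p j) : p i = false ∧ p j = true := by
  have hpj : p j = true := by
    by_contra hp
    have h1 : lbl p j = j := by simp [lbl, hp]
    have h2 := lbl_le (p := p) i
    omega
  refine ⟨?_, hpj⟩
  by_contra hp
  replace hp : p i = true := by simpa using hp
  obtain ⟨P, hP⟩ := stackP_ne_nil hd (hij.trans hj) hp
  obtain ⟨Q, hQ⟩ := stackP_ne_nil hd hj hpj
  have h1 : lbl p i ∈ stackP p j := by rw [hQ, h]; simp
  have h2 : lbl p i < i := lt_of_mem_stackP (by rw [hP]; simp)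
  obtain h3 | h3 := mem_stackP_of_le (m := i + 1) hij h1
  · rw [stackP_true hp, hP] at h3
    have h4 := stackP_pairwise (p := p) i
    rw [hP, List.pairwise_cons] at h4
    exact (h4.1 _ h3).false
  · omega

/-- The letters `i` and `j` are matched. -/
def Mt (p : ℕ → Bool) (i j : ℕ) : Prop :=
  (∀ k, i ≤ k → k < j → co p i (k + 1) < cz p i (k + 1)) ∧ co p i (j + 1) = cz p i (j + 1)

/-- By `stackP_eq`, the excess returns to zero at `j` exactly when `j` pops the entry `i`. -/
theorem mt_iff {N : ℕ} (hd : ∀ k ≤ N, co p 0 k ≤ cz p 0 k) {i j : ℕ} (hij : i < j) (hj : j < N) :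
    Mt p i j ↔ lbl p i = lbl p j := by
  constructor
  · rintro ⟨h1, h2⟩
    have hpi : p i = false := by
      have := h1 i le_rfl hij
      rw [co_succ p le_rfl, cz_succ p le_rfl, co_self, cz_self] at this
      cases hp : p i
      · rfl
      · rw [hp] at this; simp at this
    obtain ⟨Q, h3, h4⟩ := stackP_eq hpi hij fun m hm hm' => by
      have := h1 (m - 1) (by omega) (by omega)
      rwa [Nat.sub_add_cancel (by omega)] at this
    rw [co_succ p hij.le, cz_succ p hij.le] at h2
    cases hp : p j
    · rw [hp] at h2
      simp at h2
      omega
    · rw [hp] at h2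
      simp at h2
      obtain rfl : Q = [] := List.length_eq_zero_iff.1 (by omega)
      simp [lbl, hp, hpi, h3]
  · intro h
    obtain ⟨hpi, hpj⟩ := letters_of_lbl_eq hd hij hj h
    obtain ⟨P, hP⟩ := stackP_ne_nil hd hj hpj
    have hi : lbl p i = i := by simp [lbl, hpi]
    rw [← h, hi] at hP
    have h1 : ∀ m, i < m → m ≤ j → co p i m < cz p i m := by
      intro m
      induction m using Nat.strong_induction_on with
      | _ m ih =>
        intro hm hmj
        obtain ⟨m, rfl⟩ : ∃ k, m = k + 1 := ⟨m - 1, by omega⟩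
        obtain him | him := (Nat.lt_succ_iff.1 hm).eq_or_lt
        · subst him
          simp [co_succ p le_rfl, cz_succ p le_rfl, hpi, co_self, cz_self]
        · obtain ⟨Q, h2, h3⟩ := stackP_eq hpi him fun m' h h' => ih m' (by omega) h (by omega)
          rw [co_succ p him.le, cz_succ p him.le]
          cases hp : p m
          · simp
            omega
          · by_contra hlt
            simp at hlt
            obtain rfl : Q = [] := List.length_eq_zero_iff.1 (by omega)
            have h4 := stackP_true hp
            rw [h2] at h4
            obtain h5 | h5 := mem_stackP_of_le (p := p) (x := i) hmj (by rw [hP]; simp)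
            · rw [h4] at h5
              exact (lt_of_mem_stackP h5).false
            · omega
    obtain ⟨Q, h2, h3⟩ := stackP_eq hpi hij h1
    have hQ : Q = [] := by
      cases Q with
      | nil => rfl
      | cons x Q =>
        have h4 := stackP_pairwise (p := p) j
        rw [hP] at h2 h4
        obtain ⟨rfl, rfl⟩ := List.cons.inj h2
        rw [List.pairwise_cons] at h4
        exact absurd (h4.1 i (by simp)) (lt_irrefl i)
    refine ⟨fun k hk hk' => h1 (k + 1) (by omega) (by omega), ?_⟩
    rw [co_succ p hij.le, cz_succ p hij.le, hpj]
    simp [hQ] at h3 ⊢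
    omega

theorem lbl_unique {N : ℕ} (hd : ∀ k ≤ N, co p 0 k ≤ cz p 0 k) :
    ∀ i < N, ∀ j < N, ∀ k < N, lbl p i = lbl p j → i ≠ j → lbl p i = lbl p k → i ≠ k → j = k := by
  intro i hi j hj k hk h1 hij h2 hik
  by_contra hjk
  have key : ∀ x y z, x < y → y < z → z < N → lbl p x = lbl p y → lbl p y = lbl p z → False := by
    intro x y z hxy hyz hz h1 h2
    have h3 := (letters_of_lbl_eq hd hxy (hyz.trans hz) h1).2
    have h4 := (letters_of_lbl_eq hd hyz hz h2).1
    rw [h3] at h4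
    simp at h4
  have h3 := h1.symm.trans h2
  obtain h | h | h | h | h | h : i < j ∧ j < k ∨ i < k ∧ k < j ∨ j < i ∧ i < k ∨ j < k ∧ k < i ∨
      k < i ∧ i < j ∨ k < j ∧ j < i := by omega
  · exact key i j k h.1 h.2 hk h1 h3
  · exact key i k j h.1 h.2 hj h2 h3.symm
  · exact key j i k h.1 h.2 hk h1.symm h2
  · exact key j k i h.1 h.2 hi h3 h2.symm
  · exact key k i j h.1 h.2 hj h2.symm h1
  · exact key k j i h.1 h.2 hi h3.symm h1.symm

/-- The steps given by the words `s` and `p`. -/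
def steps (N : ℕ) (s p : ℕ → Bool) (i : ℕ) : Stp ℕ := ⟨s i, p i, lbl p i, N + i⟩

/-- The pending colours are the stack followed by the left colours. Closed and pending arcs have
labels below `i`, so the label `i` is fresh, and the shift by `N` keeps the left colours apart. -/
theorem ok_steps {N : ℕ} (s : ℕ → Bool) (hd : ∀ k ≤ N, co p 0 k ≤ cz p 0 k) (m : ℕ) {i : ℕ}
    (hi : i + m = N) {D Ls : List ℕ} (h1 : (D ++ stackP p i).Nodup) (h2 : ∀ x ∈ D, x < i)
    (h3 : Ls.Nodup) (h4 : ∀ x ∈ Ls, N ≤ x ∧ x < N + i) :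
    Ok ((List.range m).map fun j => steps N s p (i + j)) D (stackP p i ++ Ls) := by
  induction m generalizing i D Ls with
  | zero =>
    show (D ++ (stackP p i ++ Ls)).Nodup
    rw [← List.append_assoc, List.nodup_append']
    refine ⟨h1, h3, fun x hx hx' => ?_⟩
    have := h4 x hx'
    rw [List.mem_append] at hx
    obtain hx | hx := hx
    · have := h2 x hx; omega
    · have := lt_of_mem_stackP hx; omega
  | succ m ih =>
    rw [List.range_succ_eq_map, List.map_cons, List.map_map]
    have hrw : ((fun j => steps N s p (i + j)) ∘ Nat.succ) =
        fun j => steps N s p (i + 1 + j) := by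
      funext j
      simp [Nat.add_comm j 1, add_assoc]
    rw [hrw]
    have hLs : ∀ x ∈ Ls ++ (if s i then [N + i] else []), N ≤ x ∧ x < N + (i + 1) := by
      intro x hx
      rw [List.mem_append] at hx
      obtain hx | hx := hx
      · have := h4 x hx; omega
      · split_ifs at hx
        · simp at hx; omega
        · simp at hx
    have hLn : (Ls ++ (if s i then [N + i] else [])).Nodup := by
      rw [List.nodup_append']
      refine ⟨h3, by split_ifs <;> simp, fun x hx hx' => ?_⟩
      have := h4 x hx
      split_ifs at hx'
      · simp at hx'; omega
      · simp at hx'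
    refine ⟨?_, ?_, ?_⟩
    · rw [← List.append_assoc, List.nodup_append']
      refine ⟨h1, h3, fun x hx hx' => ?_⟩
      have := h4 x hx'
      rw [List.mem_append] at hx
      obtain hx | hx := hx
      · have := h2 x hx; omega
      · have := lt_of_mem_stackP hx; omega
    · intro hp
      obtain ⟨P, hP⟩ := stackP_ne_nil hd (k := i) (by omega) hp
      rw [hP]
      rfl
    · cases hp : p i
      · have e1 : (steps N s p (i + 0)).next (stackP p i ++ Ls) =
            stackP p (i + 1) ++ (Ls ++ (if s i then [N + i] else [])) := by
          simp [Stp.next, steps, hp, stackP_false hp, lbl]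
        have e2 : (steps N s p (i + 0)).dead D = D := by simp [Stp.dead, steps, hp]
        rw [e1, e2]
        refine ih (by omega) ?_ (fun x hx => (h2 x hx).trans (by omega)) hLn hLs
        rw [stackP_false hp, List.nodup_middle, List.nodup_cons]
        refine ⟨fun hx => ?_, h1⟩
        rw [List.mem_append] at hx
        obtain hx | hx := hx
        · exact (h2 i hx).false
        · exact (lt_of_mem_stackP hx).false
      · obtain ⟨P, hP⟩ := stackP_ne_nil hd (k := i) (by omega) hp
        have hP' : stackP p (i + 1) = P := by rw [stackP_true hp, hP]; rfl
        have e1 : (steps N s p (i + 0)).next (stackP p i ++ Ls) =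
            stackP p (i + 1) ++ (Ls ++ (if s i then [N + i] else [])) := by
          simp [Stp.next, steps, hp, hP, hP']
        have e2 : (steps N s p (i + 0)).dead D = lbl p i :: D := by simp [Stp.dead, steps, hp]
        rw [e1, e2]
        refine ih (by omega) ?_ ?_ hLn hLs
        · rw [hP', List.cons_append, ← List.nodup_middle, ← hP]
          exact h1
        · intro x hx
          rw [List.mem_cons] at hx
          obtain rfl | hx := hx
          · have := lt_of_mem_stackP (p := p) (i := i) (x := lbl p i) (by rw [hP]; simp)
            omega
          · have := h2 x hx
            omega

theorem ok_steps_nil {N : ℕ} (s : ℕ → Bool) (hd : ∀ k ≤ N, co p 0 k ≤ cz p 0 k) :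
    Ok ((List.range N).map (steps N s p)) [] [] := by
  have := ok_steps s hd N (i := 0) (by simp) (D := []) (Ls := []) (by simp [stackP]) (by simp)
    (by simp) (by simp)
  simpa [stackP] using this

end Stack

end TFPL

namespace TFPL

open TFPL.Sym

/-! ### Dyck words and Boolean sequences -/

section Dyck

variable {n : ℕ}

theorem card_filter_one (w : Word n) {i k : ℕ} (hk : k ≤ 2 * n) :
    (Finset.univ.filter fun j : Fin (2 * n) => i ≤ j.val ∧ j.val < k ∧ w j = 1).card =
      co (one w) i k := by
  rw [co, ← Finset.card_map Fin.valEmbedding]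
  congr 1
  ext x
  simp only [Finset.mem_map, Finset.mem_filter, Finset.mem_univ, true_and, Fin.valEmbedding_apply,
    Finset.mem_Ico]
  constructor
  · rintro ⟨j, ⟨h1, h2, h3⟩, rfl⟩
    exact ⟨⟨h1, h2⟩, (one_fin w j).2 h3⟩
  · rintro ⟨⟨h1, h2⟩, h3⟩
    exact ⟨⟨x, by omega⟩, ⟨h1, h2, (one_fin w ⟨x, by omega⟩).1 h3⟩, rfl⟩

theorem card_filter_zero (w : Word n) {i k : ℕ} (hk : k ≤ 2 * n) :
    (Finset.univ.filter fun j : Fin (2 * n) => i ≤ j.val ∧ j.val < k ∧ w j = 0).card =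
      cz (one w) i k := by
  rw [cz, ← Finset.card_map Fin.valEmbedding]
  congr 1
  ext x
  simp only [Finset.mem_map, Finset.mem_filter, Finset.mem_univ, true_and, Fin.valEmbedding_apply,
    Finset.mem_Ico]
  constructor
  · rintro ⟨j, ⟨h1, h2, h3⟩, rfl⟩
    exact ⟨⟨h1, h2⟩, (one_fin_false w j).2 h3⟩
  · rintro ⟨⟨h1, h2⟩, h3⟩
    exact ⟨⟨x, by omega⟩, ⟨h1, h2, (one_fin_false w ⟨x, by omega⟩).1 h3⟩, rfl⟩

theorem countBefore_one (w : Word n) {k : ℕ} (hk : k ≤ 2 * n) :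
    countBefore w 1 k = co (one w) 0 k := by
  rw [← card_filter_one w hk, countBefore]
  simp

theorem countBefore_zero (w : Word n) {k : ℕ} (hk : k ≤ 2 * n) :
    countBefore w 0 k = cz (one w) 0 k := by
  rw [← card_filter_zero w hk, countBefore]
  simp

theorem D.prefix_le (w : D n) : ∀ k ≤ 2 * n, co (one w.1) 0 k ≤ cz (one w.1) 0 k := by
  intro k hk
  rw [← countBefore_one _ hk, ← countBefore_zero _ hk]
  exact w.2.2 k hk

theorem D.count (w : D n) : co (one w.1) 0 (2 * n) = n := by
  have h1 := w.2.1
  rw [countBefore_one _ le_rfl, countBefore_zero _ le_rfl] at h1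
  have := co_add_cz (one w.1) 0 (2 * n)
  omega

theorem matched_iff (w : D n) {i j : Fin (2 * n)} (hij : i < j) :
    Matched w.1 i j ↔ lbl (one w.1) i = lbl (one w.1) j := by
  rw [← mt_iff w.prefix_le hij j.isLt, Matched, and_iff_right hij, Mt]
  have e1 : ∀ k : Fin (2 * n), (Finset.univ.filter fun l => i ≤ l ∧ l ≤ k ∧ w.1 l = 1).card =
      co (one w.1) i (k + 1) := by
    intro k
    rw [← card_filter_one w.1 (by omega)]
    simp only [Fin.le_def, Nat.lt_succ_iff]
  have e2 : ∀ k : Fin (2 * n), (Finset.univ.filter fun l => i ≤ l ∧ l ≤ k ∧ w.1 l = 0).card =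
      cz (one w.1) i (k + 1) := by
    intro k
    rw [← card_filter_zero w.1 (by omega)]
    simp only [Fin.le_def, Nat.lt_succ_iff]
  simp only [e1, e2]
  refine and_congr_left fun _ => ⟨fun h k hk hk' => ?_, fun h k hk hk' => ?_⟩
  · exact h ⟨k, by omega⟩ hk hk'
  · exact h k hk hk'

end Dyck

/-! ### Configurations correspond to runs -/

section Bijection

variable {n : ℕ}

theorem extV_eq_ep (i : Fin (2 * n)) : extV i = ep i := extV_eq i

theorem gr_bits {s : ℕ → Bool} {f : SimpleGraph (ℤ × ℤ)} (hf : f ≤ triangleGraph n)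
    (hb : Bits n s (hB f) (vB f)) : gr (hB f) (vB f) = f :=
  eq_of_bits (gr_le hb) hf (by simp [hB_gr]) (by simp [vB_gr])

theorem dg_last {s : ℕ → Bool} {H V : ℕ → ℕ → Prop} (hb : Bits n s H V) (y : ℕ) (hn : 0 < n) :
    dg (gr H V) (pt ((4 * n - 2 : ℕ) : ℤ) y) =
      cnt False False (H (4 * n - 2) y) (V (4 * n - 2) y) := by
  have h2 : ¬ H (4 * n - 2 + 1) y := fun h => by have := hb.domH _ _ h; omega
  have h3 : ¬ V (4 * n - 2 + 1) (y + 1) := fun h => by have := hb.domV _ _ h; omega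
  rw [dg_gr hb, eq_false h2, eq_false h3]

theorem cnt_false_le {r t : Prop} : cnt False False r t ≤ 2 := by
  classical
  by_cases r <;> by_cases t <;> simp [cnt, *]

theorem dg_le_two {s : ℕ → Bool} {H V : ℕ → ℕ → Prop} (hb : Bits n s H V) (v : ℤ × ℤ) :
    dg (gr H V) v ≤ 2 := by
  by_cases h : ∃ w, (gr H V).Adj v w
  · obtain ⟨w, hw⟩ := h
    obtain ⟨i, hi, rfl⟩ | ⟨a, y, rfl, hy, ha⟩ := exists_pt_of_adj (gr_le hb hw)
    · rw [dg_ep (gr_le hb) (by rw [vB_gr]; exact hb.ext i hi)]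
      omega
    · obtain ha | ha := ha.lt_or_eq
      · obtain hy | rfl := hy.lt_or_eq
        · rw [dg_gr hb, hb.deg a y ha hy]
        · rw [hb.dg_left (by omega)]
          split_ifs <;> omega
      · obtain rfl : a = 4 * n - 2 := by omega
        rw [dg_last hb y (by omega)]
        exact cnt_false_le
  · have : (gr H V).neighborSet v = ∅ := by
      ext w
      simpa using fun h' => h ⟨w, h'⟩
    rw [dg, this, Set.ncard_empty]
    omega

/-- A path does not have three ends. -/
theorem not_three_ends {V : Type} {f : SimpleGraph V} {u v w : V}
    (hfin : (f.connectedComponentMk u).supp.Finite) (hdeg : ∀ v, dg f v ≤ 2)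
    (huv : f.Reachable u v) (huw : f.Reachable u w) (hne : u ≠ v) (hne' : u ≠ w) (hne'' : v ≠ w)
    (hu : dg f u ≤ 1) (hv : dg f v ≤ 1) (hw : dg f w ≤ 1) : False := by
  classical
  have := sum_deficit (f.connectedComponentMk u) hfin (fun v _ => hdeg v) {u, v, w} (by
    intro x hx
    simp only [Finset.mem_insert, Finset.mem_singleton] at hx
    obtain rfl | rfl | rfl := hx
    · rfl
    · exact SimpleGraph.ConnectedComponent.sound huv.symm
    · exact SimpleGraph.ConnectedComponent.sound huw.symm)
  rw [Finset.sum_insert (by simp [hne, hne']), Finset.sum_insert (by simp [hne'']),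
    Finset.sum_singleton] at this
  omega

/-- A path reduced to one vertex does not have another end. -/
theorem not_end_of_isolated {V : Type} {f : SimpleGraph V} {u v : V}
    (hfin : (f.connectedComponentMk u).supp.Finite) (hdeg : ∀ v, dg f v ≤ 2)
    (huv : f.Reachable u v) (hne : u ≠ v) (h : dg f u + dg f v ≤ 1) : False := by
  classical
  have := sum_deficit (f.connectedComponentMk u) hfin (fun v _ => hdeg v) {u, v} (by
    intro x hx
    simp only [Finset.mem_insert, Finset.mem_singleton] at hx
    obtain rfl | rfl := hx
    · rfl
    · exact SimpleGraph.ConnectedComponent.sound huv.symm)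
  rw [Finset.sum_insert (by simp [hne]), Finset.sum_singleton] at this
  omega

/-- The component of a vertex of the left boundary where a path starts has no other end on the
left boundary or at the bottom. -/
theorem no_other_end {s : ℕ → Bool} {H V : ℕ → ℕ → Prop} (hb : Bits n s H V)
    (hr : BitsRight n H V) {i y : ℕ} (hi : i < 2 * n) (hs : s i = true) (hy : n ≤ y)
    (hy' : y < 2 * n)
    (hR : (gr H V).Reachable (pt ((2 * i : ℕ) : ℤ) i) (pt ((4 * n - 2 : ℕ) : ℤ) y)) {x : ℤ × ℤ}
    (hx : (gr H V).Reachable (pt ((2 * i : ℕ) : ℤ) i) x) (hne : x ≠ pt ((2 * i : ℕ) : ℤ) i)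
    (hend : (∃ k < 2 * n, x = ep k) ∨ ∃ k < 2 * n, s k = true ∧ x = pt ((2 * k : ℕ) : ℤ) k) :
    False := by
  have hfin := component_finite (gr_le hb) (pt ((2 * i : ℕ) : ℤ) i)
  have hdeg := dg_le_two hb
  have hV : ∀ z, n ≤ z → z < 2 * n → ¬ V (4 * n - 2) z := fun z h1 h2 h => by
    have := (hr.rv z h2).1 h
    omega
  have hlast : ∀ z, n ≤ z → z < 2 * n → dg (gr H V) (pt ((4 * n - 2 : ℕ) : ℤ) z) ≤ 1 := by
    intro z h1 h2
    rw [dg_last hb z (by omega), eq_false (hV z h1 h2)]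
    by_cases h : H (4 * n - 2) z <;> simp [cnt, h]
  -- The topmost vertex belongs to both boundaries and has degree zero. It uses up both ends of its
  -- component, so it needs the separate argument `not_end_of_isolated`.
  have hlast' : dg (gr H V) (pt ((2 * (2 * n - 1) : ℕ) : ℤ) (2 * n - 1 : ℕ)) = 0 := by
    have h1 := hV (2 * n - 1) (by omega) (by omega)
    have h2 : ¬ H (4 * n - 2) (2 * n - 1) := fun h => by have := hb.domH _ _ h; omega
    rw [show 2 * (2 * n - 1) = 4 * n - 2 by omega, dg_last hb _ (by omega), eq_false h1,
      eq_false h2]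
    simp [cnt]
  have hleft : ∀ k < 2 * n, s k = true → dg (gr H V) (pt ((2 * k : ℕ) : ℤ) k) ≤ 1 := by
    intro k hk hsk
    by_cases h : k + 1 < 2 * n
    · rw [hb.dg_left h, if_pos hsk]
    · obtain rfl : k = 2 * n - 1 := by omega
      rw [hlast']
      omega
  have hdx : dg (gr H V) x ≤ 1 := by
    obtain ⟨k, hk, rfl⟩ | ⟨k, hk, hsk, rfl⟩ := hend
    · rw [dg_ep (gr_le hb) (by rw [vB_gr]; exact hb.ext k hk)]
    · exact hleft k hk hsk
  by_cases h : i + 1 < 2 * n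
  · by_cases hxR : x = pt ((4 * n - 2 : ℕ) : ℤ) y
    · obtain ⟨k, hk, rfl⟩ | ⟨k, hk, hsk, rfl⟩ := hend
      · rw [ep, pt_inj] at hxR
        omega
      · have : k = 2 * n - 1 := by
          rw [pt_inj] at hxR
          omega
        subst this
        refine not_end_of_isolated hfin hdeg hx hne.symm ?_
        rw [hlast']
        exact hleft i hi hs
    · refine not_three_ends hfin hdeg hx hR hne.symm ?_ hxR (hleft i hi hs) hdx (hlast y hy hy')
      rw [Ne, pt_inj]
      omega
  · obtain rfl : i = 2 * n - 1 := by omega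
    refine not_end_of_isolated hfin hdeg hx hne.symm ?_
    rw [hlast']
    omega

open Classical in
/-- The colours of the components. -/
noncomputable def clabel (n : ℕ) (s : ℕ → Bool) (b l : ℕ → ℕ) (f : SimpleGraph (ℤ × ℤ))
    (c : f.ConnectedComponent) : ℕ :=
  if h : ∃ i < 2 * n, f.connectedComponentMk (ep i) = c then b h.choose
  else if h : ∃ i < 2 * n, s i = true ∧ f.connectedComponentMk (pt ((2 * i : ℕ) : ℤ) i) = c then
    l h.choose
  else 0

/-- Colour each component by an external edge or a left starting vertex in it. This is consistent
because connected external edges share a label, and because a component crossing from left to right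
has no third end. -/
theorem coloured_of_bits {s : ℕ → Bool} {H V : ℕ → ℕ → Prop} (hb : Bits n s H V)
    (hr : BitsRight n H V) {b l : ℕ → ℕ}
    (hbot : ∀ i < 2 * n, ∀ j < 2 * n, (gr H V).Reachable (ep i) (ep j) → b i = b j)
    (hcross : ∀ i < 2 * n, s i = true → ∃ y, n ≤ y ∧ y < 2 * n ∧
      (gr H V).Reachable (pt ((2 * i : ℕ) : ℤ) i) (pt ((4 * n - 2 : ℕ) : ℤ) y)) :
    Coloured n s H V b l
      fun a y => clabel n s b l (gr H V) ((gr H V).connectedComponentMk (pt a y)) := by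
  have hep : ∀ i < 2 * n, clabel n s b l (gr H V) ((gr H V).connectedComponentMk (ep i)) = b i := by
    intro i hi
    have h : ∃ j < 2 * n, (gr H V).connectedComponentMk (ep j) =
      (gr H V).connectedComponentMk (ep i) := ⟨i, hi, rfl⟩
    rw [clabel, dif_pos h]
    exact hbot _ h.choose_spec.1 i hi (SimpleGraph.ConnectedComponent.exact h.choose_spec.2)
  refine ⟨fun a y h => ?_, fun a y h => ?_, fun i hi => ?_, fun i hi hs => ?_⟩
  · refine congrArg _ (SimpleGraph.ConnectedComponent.sound (SimpleGraph.Adj.reachable ?_))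
    have h' : hB (gr H V) (a + 1) y := by rwa [hB_gr]
    rw [hB, show ((a + 1 : ℕ) : ℤ) - 1 = a by simp] at h'
    exact h'
  · refine congrArg _ (SimpleGraph.ConnectedComponent.sound (SimpleGraph.Adj.reachable ?_))
    have h' : vB (gr H V) (a + 1) (y + 1) := by rwa [vB_gr]
    rw [vB, show ((a + 1 : ℕ) : ℤ) - 1 = a by simp,
      show ((y + 1 : ℕ) : ℤ) - 1 = y by simp] at h'
    exact h'
  · rw [← hep i hi]
    refine congrArg _ (SimpleGraph.ConnectedComponent.sound (SimpleGraph.Adj.reachable ?_))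
    have h' : vB (gr H V) (2 * i) 0 := by rw [vB_gr]; exact hb.ext i hi
    exact h'
  · obtain ⟨y, hy, hy', hR⟩ := hcross i hi hs
    rw [clabel, dif_neg, dif_pos ⟨i, hi, hs, rfl⟩]
    · have h : ∃ j < 2 * n, s j = true ∧ (gr H V).connectedComponentMk (pt ((2 * j : ℕ) : ℤ) j) =
        (gr H V).connectedComponentMk (pt ((2 * i : ℕ) : ℤ) i) := ⟨i, hi, hs, rfl⟩
      by_contra hne
      refine no_other_end hb hr hi hs hy hy' hR
        (SimpleGraph.ConnectedComponent.exact h.choose_spec.2.2).symm (fun he => hne ?_)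
        (Or.inr ⟨_, h.choose_spec.1, h.choose_spec.2.1, rfl⟩)
      rw [pt_inj] at he
      exact congrArg l (by exact_mod_cast he.2)
    · rintro ⟨k, hk, h⟩
      refine no_other_end hb hr hi hs hy hy' hR (SimpleGraph.ConnectedComponent.exact h).symm ?_
        (Or.inl ⟨k, hk, rfl⟩)
      rw [ep, Ne, pt_inj]
      omega

theorem words_mem_runs {s p : D n} {f : SimpleGraph (ℤ × ℤ)} (h : IsTFPL s.1 (zero n).1 p.1 f) :
    wordsOf n (one s.1) (hB f) (vB f) ∈
      Runs ((List.range (2 * n)).map (steps (2 * n) (one s.1) (one p.1))) [] := by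
  obtain ⟨hb, hr⟩ := bits_of_loc h.loc
  have hgr := gr_bits h.subgraph hb
  have hc := coloured_of_bits (b := lbl (one p.1)) (l := fun i => 2 * n + i) hb hr
    (by
      intro i hi j hj hij
      rw [hgr] at hij
      obtain hlt | rfl | hlt := lt_trichotomy i j
      · exact (matched_iff p (i := ⟨i, hi⟩) (j := ⟨j, hj⟩) hlt).1
          ((h.bottom ⟨i, hi⟩ ⟨j, hj⟩ hlt).1 (by rwa [extV_eq_ep, extV_eq_ep]))
      · rfl
      · exact ((matched_iff p (i := ⟨j, hj⟩) (j := ⟨i, hi⟩) hlt).1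
          ((h.bottom ⟨j, hj⟩ ⟨i, hi⟩ hlt).1 (by rw [extV_eq_ep, extV_eq_ep]; exact hij.symm))).symm)
    (by
      intro i hi hs
      obtain ⟨j, hj, hR⟩ := h.crossing ⟨i, hi⟩ ((one_fin s.1 ⟨i, hi⟩).1 hs)
      rw [leftV_eq, rightV_eq] at hR
      have hj' : j.val < n := by
        by_contra hlt
        simp [zero, zeroWord, hlt] at hj
      refine ⟨2 * n - 1 - j, by omega, by omega, ?_⟩
      rw [hgr]
      exact hR)
  exact wordsOf_mem_runs (st := steps (2 * n) (one s.1) (one p.1)) hb hr (fun _ => rfl)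
    (col := fun a y => clabel n (one s.1) (lbl (one p.1)) (fun i => 2 * n + i) _
      (SimpleGraph.connectedComponentMk _ (pt a y))) hc.left hc.down hc.bottom hc.top

/-- A run does not mention connectivity: the matching at the bottom comes from `reachable_iff` and
the crossings from `exists_crossing`. -/
theorem exists_of_mem_runs {s p : D n} {u : List (List (Sym Unit) × List (Sym Unit))}
    (hu : u ∈ Runs ((List.range (2 * n)).map (steps (2 * n) (one s.1) (one p.1))) []) :
    ∃ f, IsTFPL s.1 (zero n).1 p.1 f ∧ wordsOf n (one s.1) (hB f) (vB f) = u := by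
  obtain ⟨H, V, L, h, hf, rfl⟩ := mem_runs_iff.1 hu
  have hb : Bits n (one s.1) (Hb n H) (Vb n V) := h.bits
  have hcount : ((Finset.range (2 * n)).filter fun i => one s.1 i = true).card = n := by
    have := D.count s
    rwa [co, ← Finset.range_eq_Ico] at this
  have hcount' : ((List.range (2 * n)).countP fun j => (steps (2 * n) (one s.1) (one p.1) j).s) =
      n := by
    refine Eq.trans ?_ hcount
    have e : ((Finset.range (2 * n)).filter fun i => one s.1 i = true).card =
      ((List.range (2 * n)).filter fun i => decide (one s.1 i = true)).length := rfl
    rw [List.countP_eq_length_filter, e]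
    simp [steps]
  obtain ⟨hl1, hl2⟩ := h.last hf hcount'
  have hc : Coloured n (one s.1) (Hb n H) (Vb n V) (lbl (one p.1)) (fun i => 2 * n + i)
      (colOf H L) := ⟨h.colOf_left, h.colOf_down, h.colOf_bottom, h.colOf_top⟩
  have hlast : ∀ y < n, Hb n H (4 * n - 2) y ∧ Vb n V (4 * n - 2) y := by
    intro y hy
    have h1 := h.eq_lab (4 * n - 2) y (by omega) (by omega)
    rw [hl1 y hy, lab_of_ne _ (by omega)] at h1
    by_cases h2 : Hb n H (4 * n - 2) y <;> by_cases h3 : Vb n V (4 * n - 2) y <;>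
      simp [h2, h3, inSym] at h1 ⊢
  have hlast' : ∀ y, n ≤ y → y + 1 < 2 * n →
      (Hb n H (4 * n - 2) y ↔ ¬ Vb n V (4 * n - 2) y) := by
    intro y hy hy'
    have h1 := h.eq_lab (4 * n - 2) y (by omega) (by omega)
    obtain ⟨c, hc⟩ := hl2 y hy (by omega)
    rw [hc, lab_of_ne _ (by omega)] at h1
    by_cases h2 : Hb n H (4 * n - 2) y <;> by_cases h3 : Vb n V (4 * n - 2) y <;>
      simp [h2, h3, inSym] at h1 ⊢
  have hbl : ∀ i < 2 * n, ∀ j < 2 * n, lbl (one p.1) i ≠ 2 * n + j := by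
    intro i hi j hj
    have := lbl_le (p := one p.1) i
    omega
  have hll : ∀ i < 2 * n, ∀ j < 2 * n, 2 * n + i = 2 * n + j → i = j := by
    intros
    omega
  have hr := bitsRight hb hc hlast hlast' hbl hll hcount
  have hle := gr_le hb
  have hloc : Loc s.1 (zeroWord n) (gr (Hb n H) (Vb n V)) :=
    loc_of_bits hle (by rwa [hB_gr, vB_gr]) (by rwa [hB_gr, vB_gr])
  refine ⟨gr (Hb n H) (Vb n V), ⟨hloc.1, hloc.2, hloc.3, hloc.4, hloc.5, hloc.6, hloc.7, ?_, ?_⟩,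
    ?_⟩
  · intro i j hij
    rw [extV_eq_ep, extV_eq_ep, reachable_iff hb hc hlast hbl hll hcount
      (lbl_unique p.prefix_le) i.isLt j.isLt (fun he => hij.ne (Fin.ext he)), matched_iff p hij]
  · intro i hi
    obtain ⟨y, hy, hy', -, hR⟩ := exists_crossing hb hc hlast hbl hll i.isLt
      ((one_fin s.1 i).2 hi)
    have hlt : 2 * n - 1 - y < 2 * n := by omega
    refine ⟨⟨_, hlt⟩, ?_, ?_⟩
    · simp only [zero, zeroWord]
      rw [if_pos (by omega)]
    · rw [leftV_eq, rightV_eq]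
      dsimp only
      rwa [show 2 * n - 1 - (2 * n - 1 - y) = y by omega]
  · rw [hB_gr, vB_gr]
    exact h.words_eq.symm

/-- The passage to uncoloured words is injective since they determine the edges; it reaches every
run by `exists_of_mem_runs`. -/
theorem tNum_eq_encard (s p : D n) : (tNum s (zero n) p : ℕ∞) =
    (Runs ((List.range (2 * n)).map (steps (2 * n) (one s.1) (one p.1))) []).encard := by
  have h1 : Runs ((List.range (2 * n)).map (steps (2 * n) (one s.1) (one p.1))) [] =
      (fun f => wordsOf n (one s.1) (hB f) (vB f)) '' {f | IsTFPL s.1 (zero n).1 p.1 f} := by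
    ext u
    constructor
    · intro hu
      obtain ⟨f, hf, rfl⟩ := exists_of_mem_runs hu
      exact ⟨f, hf, rfl⟩
    · rintro ⟨f, hf, rfl⟩
      exact words_mem_runs hf
  have h2 : Set.InjOn (fun f => wordsOf n (one s.1) (hB f) (vB f))
      {f | IsTFPL s.1 (zero n).1 p.1 f} := by
    intro f hf g hg hfg
    have hbf := (bits_of_loc hf.loc).1
    have hbg := (bits_of_loc hg.loc).1
    obtain ⟨h3, h4⟩ := bits_eq_of_wordsOf hbf hbg hfg
    exact eq_of_bits hf.subgraph hg.subgraph h3 h4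
  have h3 : {f | IsTFPL s.1 (zero n).1 p.1 f}.Finite :=
    Set.finite_coe_iff.1 (inferInstanceAs (Finite {f // IsTFPL s.1 (zero n).1 p.1 f}))
  rw [h1, h2.encard_image, ← h3.cast_ncard_eq]
  rfl

end Bijection

end TFPL

namespace TFPL

open TFPL.Sym

/-! ### The entries of `t` on the diagonal and for bumps -/

section Values

variable {C : Type}

theorem stk_length {us : List (Stp C)} (hus : ∀ st ∈ us, st.s = st.p) {ss : List (Stp C)}
    {D K : List C} (hok : Ok (us ++ ss) D K) :
    (stk us K).length = K.length + us.countP fun st => !st.p := by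
  induction us generalizing D K with
  | nil => rfl
  | cons st us ih =>
    have hs := hus st (by simp)
    have h1 := ih (fun st h => hus st (by simp [h])) (Ok.tail hok)
    rw [stk, h1]
    cases hp : st.p
    · rw [hp] at hs
      simp [Stp.next, hp, hs]
      omega
    · obtain ⟨K, rfl⟩ := Ok.head hok hp
      rw [hp] at hs
      simp [Stp.next, hp, hs]

theorem map_range_split {α : Type} (f : ℕ → α) (q r m : ℕ) :
    (List.range (q + (1 + (r + (1 + m))))).map f = (List.range q).map f ++
      f q :: ((List.range r).map (fun j => f (q + 1 + j)) ++
        f (q + 1 + r) :: (List.range m).map fun j => f (q + 1 + r + 1 + j)) := by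
  simp only [List.range_add, List.map_append, List.map_map, List.range_one, List.map_cons,
    Function.comp_def, add_assoc, add_zero,
    List.cons_append, List.nil_append]

/-- The words `s` and `p` differ by a bump: the letters `0 e⋯e 1` of `s`, with indices from `q` to
`q + a`, are replaced in `p` by `1 e⋯e 0`. -/
structure Bump (N : ℕ) (s p : ℕ → Bool) (q a : ℕ) (e : Bool) : Prop where
  pos : 0 < a
  lt : q + a < N
  first : s q = false ∧ p q = true
  mid : ∀ i, q < i → i < q + a → s i = e ∧ p i = e
  last : s (q + a) = true ∧ p (q + a) = false
  off : ∀ i, i < q ∨ q + a < i → s i = p i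

variable {n : ℕ}

theorem tNum_self (s : D n) : tNum s (zero n) s = 1 := by
  have h := tNum_eq_encard s s
  have hok := ok_steps_nil (one s.1) s.prefix_le
  rw [show ([] : List (Sym ℕ)) = Sw ℕ 0 ++ Iw [] from rfl, runs_base ?_ hok 0] at h
  · exact_mod_cast h
  · intro st hst
    obtain ⟨i, -, rfl⟩ := List.mem_map.1 hst
    rfl

/-- The steps before the bump are forced and leave as many pending colours as there are `0`s before
`q`. One of them is closed at `q`, the others form the list `K` of `runs_open_row` and
`runs_open_col`. -/
theorem tNum_bump {s p : D n} {q a : ℕ} {e : Bool} (h : Bump (2 * n) (one s.1) (one p.1) q a e) :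
    tNum s (zero n) p = (2 * n - 2 - co (one s.1) 0 q).choose a := by
  have h0 := tNum_eq_encard s p
  -- A bump of `r + 1` cells has an opening letter, `r` middle letters and a closing letter; `m`
  -- letters follow it.
  obtain ⟨r, rfl⟩ : ∃ r, a = r + 1 := ⟨a - 1, by have := h.pos; omega⟩
  obtain ⟨m, hm⟩ : ∃ m, 2 * n = q + (1 + (r + (1 + m))) :=
    ⟨2 * n - (q + r + 2), by have := h.lt; omega⟩
  have hok := ok_steps_nil (one s.1) p.prefix_le
  generalize hst : steps (2 * n) (one s.1) (one p.1) = st at *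
  rw [hm, map_range_split] at h0 hok
  generalize hus : (List.range q).map st = us at *
  generalize hrs : (List.range r).map (fun j => st (q + 1 + j)) = rs at *
  generalize hvs : (List.range m).map (fun j => st (q + 1 + r + 1 + j)) = vs at *
  have hus' : ∀ x ∈ us, x.s = x.p := by
    intro x hx
    rw [← hus] at hx
    obtain ⟨i, hi, rfl⟩ := List.mem_map.1 hx
    rw [List.mem_range] at hi
    rw [← hst]
    exact h.off i (Or.inl hi)
  have hvs' : ∀ x ∈ vs, x.s = x.p := by
    intro x hx
    rw [← hvs] at hx
    obtain ⟨i, hi, rfl⟩ := List.mem_map.1 hx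
    rw [← hst]
    exact h.off _ (Or.inr (by omega))
  have hrs' : ∀ x ∈ rs, x.s = e ∧ x.p = e := by
    intro x hx
    rw [← hrs] at hx
    obtain ⟨i, hi, rfl⟩ := List.mem_map.1 hx
    rw [List.mem_range] at hi
    rw [← hst]
    exact h.mid _ (by omega) (by omega)
  have hot : (st q).s = false ∧ (st q).p = true := by rw [← hst]; exact h.first
  have hct : (st (q + 1 + r)).s = true ∧ (st (q + 1 + r)).p = false := by
    rw [← hst]
    have := h.last
    rwa [show q + (r + 1) = q + 1 + r by ring] at this
  have hlen := stk_length hus' hok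
  obtain ⟨D', hok', h1⟩ := runs_base_append hus' hok 0
  rw [show ([] : List (Sym ℕ)) = Sw ℕ 0 ++ Iw [] from rfl, h1] at h0
  obtain ⟨K, hK⟩ := hok'.head hot.2
  rw [hK] at h0 hok' hlen
  have hr : rs.length = r := by simp [← hrs]
  have hv : vs.length = m := by simp [← hvs]
  have h2 : (Runs (st q :: (rs ++ st (q + 1 + r) :: vs))
      (Sw ℕ (0 + us.countP (·.p)) ++ Iw ((st q).b :: K))).encard =
      ((vs.length + rs.length + 1 + K.length).choose (rs.length + 1) : ℕ) := by
    cases e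
    · exact runs_open_col hot hrs' hct hvs' hok' _
    · exact runs_open_row hot hrs' hct hvs' hok' _
  rw [h2, hr, hv] at h0
  have hz : us.countP (fun x => !x.p) = cz (one s.1) 0 q := by
    rw [← hus, List.countP_map, List.countP_eq_length_filter, cz, ← Finset.range_eq_Ico]
    have e1 : ((Finset.range q).filter fun j => one s.1 j = false).card =
      ((List.range q).filter fun j => decide (one s.1 j = false)).length := rfl
    rw [e1]
    congr 1
    refine List.filter_congr fun i hi => ?_
    rw [List.mem_range] at hi
    have e2 : (st i).p = one s.1 i := by rw [← hst]; exact (h.off i (Or.inl hi)).symm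
    rw [Function.comp_apply, e2]
    cases one s.1 i <;> rfl
  rw [hz] at hlen
  simp only [List.length_cons, List.length_nil] at hlen
  have h3 := co_add_cz (one s.1) 0 q
  have h4 : tNum s (zero n) p = (m + r + 1 + K.length).choose (r + 1) := by exact_mod_cast h0
  rw [h4]
  congr 1
  omega

end Values

/-! ### Triangularity of `t` by a parity count of colours -/

section Triangular

/-- The colours of the states. -/
def cols (w : List (Sym ℕ)) : List ℕ := w.filterMap fun x => match x with
  | I c => some c
  | _ => none

theorem cols_cons (x : Sym ℕ) (w : List (Sym ℕ)) : cols (x :: w) = cols [x] ++ cols w := by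
  rw [cols, cols, cols, ← List.filterMap_append]
  rfl

/-- Edges meeting at a vertex have one colour, and there are two of them, so each colour is
preserved modulo 2; `S` and `E` contribute nothing. -/
theorem Half.count_cols {w T : List (Sym ℕ)} {k : Option ℕ} (h : Half w k T) (c : ℕ) :
    Even ((cols T).count c + (cols w).count c + k.toList.count c) := by
  induction w generalizing k T with
  | nil =>
    rw [show T = [carrySym k] from h]
    cases k <;> simp [cols, ← two_mul]
  | cons x w ih =>
    obtain ⟨hh, v, t, T', h1, h2, rfl, h3⟩ := half_cons.1 h
    have h4 := ih h3
    have e1 : Even ((cols [x]).count c + hh.toList.count c + v.toList.count c) := by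
      cases x with
      | S => obtain ⟨rfl, rfl⟩ := h1; simp [cols]
      | I d => obtain ⟨rfl, rfl⟩ | ⟨rfl, rfl⟩ := h1 <;> simp [cols, ← two_mul]
      | E => obtain ⟨d, rfl, rfl⟩ := h1; simp [cols, ← two_mul]
    have e2 : Even ((cols [t]).count c + hh.toList.count c + k.toList.count c) := by
      cases hh <;> cases k
      · rw [show t = _ from h2]; simp [cols]
      · rw [show t = _ from h2]; simp [cols, ← two_mul]
      · rw [show t = _ from h2]; simp [cols, ← two_mul]
      · rw [h2.2, h2.1]; simp [cols, ← two_mul]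
    rw [cols_cons t, cols_cons x, List.count_append, List.count_append]
    rw [Nat.even_iff] at *
    omega

theorem Line.count_cols {st : Stp ℕ} {W O W' : List (Sym ℕ)} (h : Line st W O W') (c : ℕ) :
    Even ((cols W').count c + (cols W).count c + [st.b].count c +
      (if st.s then [st.l] else []).count c) := by
  obtain ⟨h1, T, h2, h3⟩ := h
  have h1 := h1.count_cols c
  have h2 := h2.count_cols c
  have e : cols (O ++ [E]) = cols O := by simp [cols]
  rw [e] at h1
  simp only [Option.toList_none, Option.toList_some, List.count_nil] at h1 h2
  unfold Fin' at h3
  split_ifs at h3 with hs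
  · obtain ⟨V, rfl, rfl⟩ := h3
    have e1 : cols (V ++ [E]) = cols V := by simp [cols]
    have e2 : cols (V ++ [I st.l]) = cols V ++ [st.l] := by simp [cols]
    rw [e1] at h2
    rw [e2, if_pos hs, List.count_append]
    rw [Nat.even_iff] at *
    omega
  · rw [if_neg hs, h3.1, List.count_nil]
    rw [Nat.even_iff] at *
    omega

theorem cols_length_add_wts (w : List (Sym ℕ)) : (cols w).length + wts w ≤ 2 * w.length := by
  induction w with
  | nil => simp [cols, wts]
  | cons x w ih =>
    rw [cols_cons, List.length_append]
    simp only [wts, List.map_cons, List.sum_cons, List.length_cons] at ih ⊢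
    cases x <;> simp [cols, Sym.wt] at ih ⊢ <;> omega

variable {N : ℕ} {s p : ℕ → Bool}

/-- The colours of the paths that start on the left boundary. -/
def leftCols (N : ℕ) (s : ℕ → Bool) (k : ℕ) : List ℕ := ((List.range k).filter s).map (N + ·)

theorem leftCols_succ (k : ℕ) :
    leftCols N s (k + 1) = leftCols N s k ++ if s k then [N + k] else [] := by
  rw [leftCols, List.range_succ, List.filter_append, List.map_append, leftCols]
  cases h : s k <;> simp [h]

theorem leftCols_length (k : ℕ) : (leftCols N s k).length = co s 0 k := by
  rw [leftCols, List.length_map, co, ← Finset.range_eq_Ico]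
  have e1 : ((Finset.range k).filter fun j => s j = true).card =
    ((List.range k).filter fun j => decide (s j = true)).length := rfl
  rw [e1]
  simp

/-- On the word of length `k`, each pending arc or left path appears an odd number of times, so
there are at least `cz p 0 k - co p 0 k + co s 0 k` letters `I`. The weight is `k + co s 0 k`, and
letters `I` plus weight amount to at most `2k`. -/
theorem co_le_of_mem_runs (hd : ∀ k ≤ N, co p 0 k ≤ cz p 0 k)
    {u : List (List (Sym Unit) × List (Sym Unit))}
    (hu : u ∈ Runs ((List.range N).map (steps N s p)) []) (k : ℕ) (hk : k ≤ N) :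
    co s 0 k ≤ co p 0 k := by
  obtain ⟨Os, Ws, h0, h1, -, -⟩ := mem_runs_range.1 hu
  have hW : ∀ k ≤ N, (Ws k).length = k ∧ wts (Ws k) = k + co s 0 k ∧
      ∀ c, Even ((cols (Ws k)).count c + (stackP p k ++ leftCols N s k).count c) := by
    intro k
    induction k with
    | zero => simp [h0, wts, co_self, cols, stackP, leftCols]
    | succ k ih =>
      intro hk
      obtain ⟨i1, i2, i3⟩ := ih (by omega)
      have hl := h1 k (by omega)
      refine ⟨by rw [hl.length.2, i1], ?_, fun c => ?_⟩
      · rw [hl.wts_eq, i2, co_succ s k.zero_le]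
        simp only [steps]
        omega
      · have h2 := hl.count_cols c
        have h3 := i3 c
        rw [leftCols_succ]
        simp only [List.count_append] at h3 ⊢
        have e : Even ((stackP p (k + 1)).count c + (stackP p k).count c + [lbl p k].count c) := by
          cases hp : p k
          · rw [stackP_false hp, ← List.singleton_append, List.count_append]
            simp only [lbl, hp, Bool.false_eq_true, if_false]
            rw [Nat.even_iff]
            omega
          · obtain ⟨P, hP⟩ := stackP_ne_nil hd (k := k) (by omega) hp
            have hP' : stackP p (k + 1) = P := by rw [stackP_true hp, hP]; rfl
            rw [hP', hP, ← List.singleton_append, List.count_append]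
            rw [Nat.even_iff]
            omega
        have h2 : Even ((cols (Ws (k + 1))).count c + (cols (Ws k)).count c +
          [lbl p k].count c + (if s k then [N + k] else []).count c) := h2
        rw [Nat.even_iff] at h2 h3 e ⊢
        omega
  obtain ⟨i1, i2, i3⟩ := hW k hk
  have hnd : (stackP p k ++ leftCols N s k).Nodup := by
    rw [List.nodup_append']
    refine ⟨(stackP_pairwise k).imp fun h => ne_of_gt h, ?_, fun x hx hx' => ?_⟩
    · exact (List.nodup_range.filter _).map fun a b h => by simpa using h
    · have := lt_of_mem_stackP hx
      simp only [leftCols, List.mem_map] at hx'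
      obtain ⟨y, -, rfl⟩ := hx'
      omega
  have hsub : stackP p k ++ leftCols N s k ⊆ cols (Ws k) := by
    intro c hc
    have := i3 c
    rw [List.count_eq_one_of_mem hnd hc] at this
    refine List.count_pos_iff.1 ?_
    rw [Nat.even_iff] at this
    omega
  have h2 := (hnd.subperm hsub).length_le
  have h3 := cols_length_add_wts (Ws k)
  rw [List.length_append, leftCols_length] at h2
  have h4 := stackP_length hd hk
  have h5 := co_add_cz p 0 k
  omega

theorem co_le_of_tNum_ne_zero {n : ℕ} {s p : D n} (h : tNum s (zero n) p ≠ 0) (k : ℕ)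
    (hk : k ≤ 2 * n) : co (one s.1) 0 k ≤ co (one p.1) 0 k := by
  have h1 := tNum_eq_encard s p
  obtain ⟨u, hu⟩ : (Runs ((List.range (2 * n)).map
      (steps (2 * n) (one s.1) (one p.1))) []).Nonempty := by
    rw [← Set.encard_ne_zero, ← h1]
    exact_mod_cast h
  exact co_le_of_mem_runs p.prefix_le hu k hk

end Triangular

end TFPL

namespace TFPL

/-! ### Diagrams through prefix counts -/

section Prefix

variable {p : ℕ → Bool}

theorem co_add (p : ℕ → Bool) {i j k : ℕ} (h1 : i ≤ j) (h2 : j ≤ k) :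
    co p i j + co p j k = co p i k := by
  rw [co, co, co, ← Finset.Ico_union_Ico_eq_Ico h1 h2, Finset.filter_union,
    Finset.card_union_of_disjoint]
  exact Finset.disjoint_filter_filter (Finset.Ico_disjoint_Ico_consecutive i j k)

theorem cz_add (p : ℕ → Bool) {i j k : ℕ} (h1 : i ≤ j) (h2 : j ≤ k) :
    cz p i j + cz p j k = cz p i k := by
  rw [cz, cz, cz, ← Finset.Ico_union_Ico_eq_Ico h1 h2, Finset.filter_union,
    Finset.card_union_of_disjoint]
  exact Finset.disjoint_filter_filter (Finset.Ico_disjoint_Ico_consecutive i j k)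

theorem letters_true {k k' : ℕ} (h : k ≤ k') (he : co p 0 k' = co p 0 k + (k' - k)) :
    ∀ i, k ≤ i → i < k' → p i = true := by
  have h1 := co_add p k.zero_le h
  have h2 := co_add_cz p k k'
  have h3 : cz p k k' = 0 := by omega
  intro i hi hi'
  by_contra hp
  rw [cz, Finset.card_eq_zero, Finset.filter_eq_empty_iff] at h3
  exact h3 (Finset.mem_Ico.2 ⟨hi, hi'⟩) (by simpa using hp)

theorem letters_false {k k' : ℕ} (h : k ≤ k') (he : co p 0 k' = co p 0 k) :
    ∀ i, k ≤ i → i < k' → p i = false := by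
  have h1 := co_add p k.zero_le h
  have h3 : co p k k' = 0 := by omega
  intro i hi hi'
  by_contra hp
  rw [co, Finset.card_eq_zero, Finset.filter_eq_empty_iff] at h3
  exact h3 (Finset.mem_Ico.2 ⟨hi, hi'⟩) (by simpa using hp)

theorem co_congr {p' : ℕ → Bool} {i k : ℕ} (h : ∀ j, i ≤ j → j < k → p j = p' j) :
    co p i k = co p' i k := by
  rw [co, co]
  congr 1
  refine Finset.filter_congr fun j hj => ?_
  rw [Finset.mem_Ico] at hj
  rw [h j hj.1 hj.2]

variable {n : ℕ}

/-- The number of `1`s among the first `k` letters. -/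
def ones (w : D n) (k : ℕ) : ℕ := co (one w.1) 0 k

theorem ones_zero (w : D n) : ones w 0 = 0 := co_self _ _

theorem ones_succ (w : D n) (k : ℕ) : ones w (k + 1) = ones w k + (one w.1 k).toNat :=
  co_succ _ k.zero_le

theorem ones_mono (w : D n) : Monotone (ones w) :=
  monotone_nat_of_le_succ fun k => by rw [ones_succ]; omega

theorem ones_two_mul (w : D n) : ones w (2 * n) = n := D.count w

theorem ones_of_le (w : D n) {k : ℕ} (hk : 2 * n ≤ k) : ones w k = n := by
  induction k, hk using Nat.le_induction with
  | base => exact ones_two_mul w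
  | succ k hk ih =>
    rw [ones_succ, ih, one, dif_neg (by omega)]
    rfl

theorem le_add_ones (w : D n) {k : ℕ} (hk : k ≤ 2 * n) : k ≤ n + ones w k := by
  have h1 := co_add_cz (one w.1) 0 k
  have h2 := cz_add (one w.1) k.zero_le hk
  have h3 := co_add_cz (one w.1) 0 (2 * n)
  have h4 := D.count w
  rw [ones]
  omega

theorem two_mul_ones_le (w : D n) (k : ℕ) : 2 * ones w k ≤ k := by
  by_cases hk : k ≤ 2 * n
  · have h1 := co_add_cz (one w.1) 0 k
    have h2 := w.prefix_le k hk
    rw [ones]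
    omega
  · rw [ones_of_le w (by omega)]
    omega

theorem D.ext_ones {s t : D n} (h : ∀ k, ones s k = ones t k) : s = t := by
  refine Subtype.ext (funext fun i => ?_)
  have h1 := ones_succ s i
  have h2 := ones_succ t i
  rw [h, h] at h1
  have h3 : (one s.1 i).toNat = (one t.1 i).toNat := by omega
  cases hs : one s.1 i <;> cases ht : one t.1 i <;> rw [hs, ht] at h3 <;> simp at h3
  · rw [(one_fin_false _ _).1 hs, (one_fin_false _ _).1 ht]
  · rw [(one_fin _ _).1 hs, (one_fin _ _).1 ht]

theorem exists_one_of_lt_ones (w : D n) {c m : ℕ} (h : c < ones w m) :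
    ∃ i < m, one w.1 i = true ∧ ones w i = c := by
  induction m with
  | zero => simp [ones_zero] at h
  | succ m ih =>
    by_cases hm : c < ones w m
    · obtain ⟨i, hi, h⟩ := ih hm
      exact ⟨i, by omega, h⟩
    · rw [ones_succ] at h
      refine ⟨m, by omega, ?_⟩
      cases hp : one w.1 m
      · rw [hp] at h; simp at h; omega
      · rw [hp] at h; simp at h ⊢; omega

theorem countAfter_zero (w : D n) (i : Fin (2 * n)) :
    countAfter w.1 0 i = cz (one w.1) (i + 1) (2 * n) := by
  rw [← card_filter_zero w.1 le_rfl, countAfter]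
  congr 1
  ext j
  simp only [Finset.mem_filter, Finset.mem_univ, true_and]
  refine ⟨fun h => ⟨h.1, j.isLt, h.2⟩, fun h => ⟨h.1, h.2.2⟩⟩

/-- The cells with `c - r` fixed form a diagonal that meets the lattice path after `k = n + c - r`
letters. For `r` too large the truncated difference is `0` and both sides are false. -/
theorem mem_diagram (w : D n) (r c : ℕ) : (r, c) ∈ diagram w.1 ↔ c < ones w (n + c - r) := by
  have hcz : ∀ i < 2 * n, one w.1 i = true →
      ones w i + (n - cz (one w.1) (i + 1) (2 * n)) = i := by
    intro i hi hp
    have h1 := co_add_cz (one w.1) 0 (i + 1)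
    have h2 := cz_add (one w.1) (i + 1).zero_le hi
    have h3 := co_add_cz (one w.1) 0 (2 * n)
    have h4 := D.count w
    have h5 := ones_succ w i
    rw [hp] at h5
    simp only [ones, Bool.toNat_true] at h5 ⊢
    omega
  have hle : ∀ i, cz (one w.1) (i + 1) (2 * n) ≤ n := by
    intro i
    by_cases hi : i + 1 ≤ 2 * n
    · have h2 := cz_add (one w.1) (i + 1).zero_le hi
      have h3 := co_add_cz (one w.1) 0 (2 * n)
      have h4 := D.count w
      omega
    · rw [cz, Finset.Ico_eq_empty (by omega)]
      simp
  rw [diagram, Finset.mem_filter]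
  constructor
  · rintro ⟨-, i, h1, h2, h3⟩
    rw [countBefore_one _ i.isLt.le] at h2
    rw [countAfter_zero] at h3
    have hp := (one_fin w.1 i).2 h1
    have h4 := hcz i i.isLt hp
    have h5 : ones w i = c := h2
    have h6 : i.val + 1 ≤ n + c - r := by
      have := hle i
      dsimp only at h3
      omega
    have h7 := ones_mono w h6
    rw [ones_succ, hp] at h7
    simp at h7
    omega
  · intro h
    obtain ⟨i, hi, hp, hc⟩ := exists_one_of_lt_ones w h
    have hi' : i < 2 * n := by
      by_contra hi'
      simp [one, hi'] at hp
    have h1 := hcz i hi' hp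
    have h2 := hle i
    refine ⟨?_, ⟨i, hi'⟩, (one_fin w.1 ⟨i, hi'⟩).1 hp, ?_, ?_⟩
    · simp only [Finset.mem_product, Finset.mem_range]
      omega
    · rw [countBefore_one _ hi'.le]
      exact hc
    · rw [countAfter_zero]
      dsimp only
      omega

/-- The order on words in terms of prefixes. -/
def Le (s t : D n) : Prop := ∀ k, ones s k ≤ ones t k

theorem diagLE_iff {s t : D n} : DiagLE s.1 t.1 ↔ Le s t := by
  constructor
  · intro h k
    by_contra hlt
    obtain ⟨c, hc⟩ : ∃ c, ones s k = c + 1 := ⟨ones s k - 1, by omega⟩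
    by_cases hk : k ≤ n + c
    · have h1 := h ((mem_diagram s (n + c - k) c).2 (by
        rw [show n + c - (n + c - k) = k by omega]; omega))
      rw [mem_diagram, show n + c - (n + c - k) = k by omega] at h1
      omega
    · by_cases hk' : k ≤ 2 * n
      · have := le_add_ones t hk'
        omega
      · rw [ones_of_le s (by omega), ones_of_le t (by omega)] at hlt
        omega
  · rintro h ⟨r, c⟩ hx
    rw [mem_diagram] at hx ⊢
    exact hx.trans_le (h _)

theorem mem_skew {s t : D n} {r c : ℕ} : (r, c) ∈ skew t.1 s.1 ↔
    ones s (n + c - r) ≤ c ∧ c < ones t (n + c - r) := by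
  rw [skew, Finset.mem_sdiff, mem_diagram, mem_diagram, not_lt, and_comm]

theorem cell_mem_skew {s t : D n} {k c : ℕ} (h1 : ones s k ≤ c) (h2 : c < ones t k) :
    (n + c - k, c) ∈ skew t.1 s.1 ∧ k ≤ n + c := by
  have hk : k ≤ n + c := by
    by_cases hk : k ≤ 2 * n
    · have := le_add_ones s hk
      omega
    · rw [ones_of_le s (by omega)] at h1
      rw [ones_of_le t (by omega)] at h2
      omega
  rw [mem_skew, show n + c - (n + c - k) = k by omega]
  exact ⟨⟨h1, h2⟩, hk⟩

/-- Cells of the skew shape are pairs of a diagonal `k` and a column `c`; the strip condition says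
that a column meets only one diagonal. -/
theorem isHorizontalStrip_iff {s t : D n} : IsHorizontalStrip s.1 t.1 ↔ Le s t ∧
    ∀ k k' c, ones s k ≤ c → c < ones t k → ones s k' ≤ c → c < ones t k' → k = k' := by
  rw [IsHorizontalStrip, diagLE_iff]
  refine and_congr_right fun _ => ⟨fun h k k' c h1 h2 h3 h4 => ?_, ?_⟩
  · obtain ⟨h5, h6⟩ := cell_mem_skew h1 h2
    obtain ⟨h7, h8⟩ := cell_mem_skew h3 h4
    have := congrArg Prod.fst (h _ h5 _ h7 rfl)
    dsimp only at this
    omega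
  · rintro h ⟨r, c⟩ hx ⟨r', c'⟩ hy hc
    dsimp only at hc
    subst hc
    rw [mem_skew] at hx hy
    have := h _ _ c hx.1 hx.2 hy.1 hy.2
    have h1 := ones_mono t (show n + c - r ≤ n + c - r from le_rfl)
    have h2 : n + c - r ≠ 0 := fun h => by rw [h, ones_zero, ones_zero] at hx; omega
    have h3 : n + c - r' ≠ 0 := fun h => by rw [h, ones_zero, ones_zero] at hy; omega
    rw [Prod.mk.injEq]
    exact ⟨by omega, rfl⟩

end Prefix

/-! ### Skew shapes in one row or one column are bumps -/

section Shapes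

variable {n : ℕ}

theorem Bump.co_eq {N : ℕ} {s p : ℕ → Bool} {q a : ℕ} {e : Bool} (h : Bump N s p q a e) (k : ℕ) :
    co p 0 k = co s 0 k + if q < k ∧ k ≤ q + a then 1 else 0 := by
  induction k with
  | zero => simp [co_self]
  | succ k ih =>
    have ha := h.pos
    rw [co_succ p k.zero_le, co_succ s k.zero_le, ih]
    by_cases h1 : k < q
    · rw [h.off k (Or.inl h1), if_neg (by omega), if_neg (by omega)]
      omega
    by_cases h2 : k = q
    · subst h2
      rw [h.first.1, h.first.2, if_neg (by omega), if_pos (by omega)]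
      rfl
    by_cases h3 : k < q + a
    · rw [(h.mid k (by omega) h3).1, (h.mid k (by omega) h3).2, if_pos (by omega),
        if_pos (by omega)]
      omega
    by_cases h4 : k = q + a
    · subst h4
      rw [h.last.1, h.last.2, if_pos (by omega), if_neg (by omega)]
      rfl
    · rw [h.off k (Or.inr (by omega)), if_neg (by omega), if_neg (by omega)]
      omega

theorem Bump.ones_eq {s p : D n} {q a : ℕ} {e : Bool}
    (h : Bump (2 * n) (one s.1) (one p.1) q a e) (k : ℕ) :
    ones p k = ones s k + if q < k ∧ k ≤ q + a then 1 else 0 := h.co_eq k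

theorem letters_of_ones {s p : D n} {k d d' : ℕ} (h : ones p k = ones s k + d)
    (h' : ones p (k + 1) = ones s (k + 1) + d') :
    (one p.1 k).toNat + d = (one s.1 k).toNat + d' := by
  rw [ones_succ, ones_succ] at h'
  omega

theorem exists_bump {s p : D n} (h1 : Le s p) (h2 : ∀ k, ones p k ≤ ones s k + 1)
    (h3 : ∃ k, ones s k < ones p k) {e : Bool}
    (h4 : ∀ k k', k < k' → ones s k < ones p k → ones s k' < ones p k' →
      ∀ i, k ≤ i → i < k' → one s.1 i = e ∧ one p.1 i = e) :
    ∃ q a, Bump (2 * n) (one s.1) (one p.1) q a e := by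
  classical
  have hbd : ∀ k, ones s k < ones p k → k < 2 * n := by
    intro k hk
    by_contra hk'
    rw [ones_of_le s (by omega), ones_of_le p (by omega)] at hk
    omega
  obtain ⟨k0, hk0, hmin⟩ : ∃ k, ones s k < ones p k ∧ ∀ j < k, ¬ ones s j < ones p j :=
    ⟨Nat.find h3, Nat.find_spec h3, fun j hj => Nat.find_min h3 hj⟩
  obtain ⟨k1, hk1, hmax⟩ : ∃ k, ones s k < ones p k ∧ ∀ j, k < j → ¬ ones s j < ones p j := by
    refine ⟨Nat.findGreatest (fun k => ones s k < ones p k) (2 * n),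
      Nat.findGreatest_spec (P := fun k => ones s k < ones p k) (hbd k0 hk0).le hk0,
      fun j hj hj' => ?_⟩
    exact Nat.findGreatest_is_greatest (P := fun k => ones s k < ones p k) hj (hbd j hj').le hj'
  have h01 : k0 ≤ k1 := by
    by_contra h
    exact hmax k0 (by omega) hk0
  have hk0' : k0 ≠ 0 := by
    rintro rfl
    rw [ones_zero, ones_zero] at hk0
    omega
  obtain ⟨q, rfl⟩ : ∃ q, k0 = q + 1 := ⟨k0 - 1, by omega⟩
  have hone : ∀ k, ones s k < ones p k → ones p k = ones s k + 1 := fun k hk => by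
    have := h2 k
    omega
  have hzero : ∀ k, ¬ ones s k < ones p k → ones p k = ones s k + 0 := fun k hk => by
    have := h1 k
    omega
  have hoff : ∀ i, ¬ ones s i < ones p i → ¬ ones s (i + 1) < ones p (i + 1) →
      one s.1 i = one p.1 i := by
    intro i hi hi'
    have := letters_of_ones (hzero i hi) (hzero (i + 1) hi')
    cases h : one s.1 i <;> cases h' : one p.1 i <;> rw [h, h'] at this <;> simp at this ⊢
  refine ⟨q, k1 - q, by omega, ?_, ?_, fun i hi hi' => ?_, ?_, ?_⟩
  · have := hbd k1 hk1
    omega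
  · have := letters_of_ones (hzero q (hmin q (by omega))) (hone _ hk0)
    cases h : one s.1 q <;> cases h' : one p.1 q <;> rw [h, h'] at this <;> simp at this ⊢
  · exact h4 (q + 1) k1 (by omega) hk0 hk1 i (by omega) (by omega)
  · rw [show q + (k1 - q) = k1 by omega]
    have := letters_of_ones (hone k1 hk1) (hzero _ (hmax (k1 + 1) (by omega)))
    cases h : one s.1 k1 <;> cases h' : one p.1 k1 <;> rw [h, h'] at this <;> simp at this ⊢
  · rintro i (hi | hi)
    · exact hoff i (hmin i (by omega)) (hmin (i + 1) (by omega))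
    · exact hoff i (hmax i (by omega)) (hmax (i + 1) (by omega))

theorem exists_mem_of_card_pos {s p : D n} (h : 0 < (skew p.1 s.1).card) :
    ∃ k, ones s k < ones p k := by
  obtain ⟨⟨r, c⟩, hx⟩ := Finset.card_pos.1 h
  rw [mem_skew] at hx
  exact ⟨_, hx.1.trans_lt hx.2⟩

theorem exists_bump_row {s p : D n} (h1 : Le s p) {r : ℕ} (hr : ∀ x ∈ skew p.1 s.1, x.1 = r)
    (h0 : 0 < (skew p.1 s.1).card) : ∃ q a, Bump (2 * n) (one s.1) (one p.1) q a true := by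
  have h2 : ∀ k, ones p k ≤ ones s k + 1 := by
    intro k
    by_contra hk
    obtain ⟨h3, h4⟩ := cell_mem_skew (s := s) (t := p) (k := k) le_rfl (by omega)
    obtain ⟨h5, h6⟩ := cell_mem_skew (s := s) (t := p) (k := k) (c := ones s k + 1) (by omega)
      (by omega)
    have h7 := hr _ h3
    have h8 := hr _ h5
    dsimp only at h7 h8
    omega
  refine exists_bump h1 h2 (exists_mem_of_card_pos h0) fun k k' hk h3 h4 => ?_
  obtain ⟨h5, h6⟩ := cell_mem_skew (s := s) (t := p) (k := k) le_rfl h3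
  obtain ⟨h7, h8⟩ := cell_mem_skew (s := s) (t := p) (k := k') le_rfl h4
  have h9 := hr _ h5
  have h10 := hr _ h7
  dsimp only at h9 h10
  have h11 := h2 k
  have h12 := h2 k'
  have h13 := letters_true (p := one s.1) hk.le (show ones s k' = ones s k + (k' - k) by omega)
  have h14 := letters_true (p := one p.1) hk.le (show ones p k' = ones p k + (k' - k) by omega)
  exact fun i hi hi' => ⟨h13 i hi hi', h14 i hi hi'⟩

theorem exists_bump_col {s p : D n} (h1 : Le s p) {c : ℕ} (hc : ∀ x ∈ skew p.1 s.1, x.2 = c)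
    (h0 : 0 < (skew p.1 s.1).card) : ∃ q a, Bump (2 * n) (one s.1) (one p.1) q a false := by
  have h2 : ∀ k, ones p k ≤ ones s k + 1 := by
    intro k
    by_contra hk
    obtain ⟨h3, h4⟩ := cell_mem_skew (s := s) (t := p) (k := k) le_rfl (by omega)
    obtain ⟨h5, h6⟩ := cell_mem_skew (s := s) (t := p) (k := k) (c := ones s k + 1) (by omega)
      (by omega)
    have h7 := hc _ h3
    have h8 := hc _ h5
    dsimp only at h7 h8
    omega
  refine exists_bump h1 h2 (exists_mem_of_card_pos h0) fun k k' hk h3 h4 => ?_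
  have h5 := hc _ (cell_mem_skew (s := s) (t := p) (k := k) le_rfl h3).1
  have h7 := hc _ (cell_mem_skew (s := s) (t := p) (k := k') le_rfl h4).1
  dsimp only at h5 h7
  have h11 := h2 k
  have h12 := h2 k'
  have h13 := letters_false (p := one s.1) hk.le (show ones s k' = ones s k by omega)
  have h14 := letters_false (p := one p.1) hk.le (show ones p k' = ones p k by omega)
  exact fun i hi hi' => ⟨h13 i hi hi', h14 i hi hi'⟩

/-- Each of the diagonals `q + 1, …, q + a` contains one cell and no other diagonal contains any. -/
theorem Bump.card_eq {s p : D n} {q a : ℕ} {e : Bool}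
    (h : Bump (2 * n) (one s.1) (one p.1) q a e) : (skew p.1 s.1).card = a := by
  have h1 : skew p.1 s.1 = (Finset.Ioc q (q + a)).image fun k => (n + ones s k - k, ones s k) := by
    ext ⟨r, c⟩
    rw [Finset.mem_image]
    constructor
    · intro hx
      rw [mem_skew, h.ones_eq] at hx
      split_ifs at hx with h1
      · refine ⟨_, Finset.mem_Ioc.2 h1, ?_⟩
        have : ones s (n + c - r) = c := by omega
        rw [Prod.mk.injEq, this]
        omega
      · omega
    · rintro ⟨k, hk, hx⟩
      rw [← hx]
      refine (cell_mem_skew le_rfl ?_).1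
      rw [h.ones_eq, if_pos (Finset.mem_Ioc.1 hk)]
      omega
  rw [h1, Finset.card_image_of_injOn, Nat.card_Ioc]
  · omega
  · intro k hk k' hk' hkk
    rw [Prod.mk.injEq] at hkk
    have h3 : ∀ k ∈ Finset.Ioc q (q + a), k ≤ n + ones s k := fun k hk =>
      (cell_mem_skew (s := s) (t := p) le_rfl (by
        rw [h.ones_eq, if_pos (Finset.mem_Ioc.1 hk)]; omega)).2
    have h4 := h3 k hk
    have h5 := h3 k' hk'
    omega

end Shapes

end TFPL

namespace TFPL

/-! ### The chain of words inside a bump -/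

variable {n : ℕ}

theorem exists_word (p : ℕ → Bool) (h : ∀ k ≤ 2 * n, 2 * co p 0 k ≤ k) (h' : co p 0 (2 * n) = n) :
    ∃ w : D n, ∀ i < 2 * n, one w.1 i = p i := by
  set w : Word n := fun i => if p i then 1 else 0 with hw
  have h1 : ∀ i < 2 * n, one w i = p i := by
    intro i hi
    cases hp : p i <;> simp [one, hi, hw, hp]
  have h2 : ∀ k ≤ 2 * n, co (one w) 0 k = co p 0 k := fun k hk =>
    co_congr fun j _ hj => h1 j (by omega)
  refine ⟨⟨w, ?_, fun k hk => ?_⟩, h1⟩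
  · have h3 := co_add_cz (one w) 0 (2 * n)
    have h4 := h2 _ le_rfl
    rw [countBefore_one _ le_rfl, countBefore_zero _ le_rfl]
    omega
  · have h3 := co_add_cz (one w) 0 k
    have h4 := h2 k hk
    have h5 := h k hk
    rw [countBefore_one _ hk, countBefore_zero _ hk]
    omega

theorem one_of_le (w : Word n) {i : ℕ} (hi : 2 * n ≤ i) : one w i = false :=
  dif_neg (by omega)

theorem exists_word_of_bump {p : ℕ → Bool} {t : D n} {q a : ℕ} {e : Bool}
    (h : Bump (2 * n) p (one t.1) q a e) :
    ∃ w : D n, ∀ i, one w.1 i = p i := by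
  have hl := h.lt
  obtain ⟨w, hw⟩ := exists_word (n := n) p (fun k _ => by
    have h1 := h.co_eq k
    have h2 : 2 * co (one t.1) 0 k ≤ k := two_mul_ones_le t k
    omega) (by
    have h1 := h.co_eq (2 * n)
    rw [if_neg (by omega), D.count] at h1
    omega)
  refine ⟨w, fun i => ?_⟩
  by_cases hi : i < 2 * n
  · exact hw i hi
  · rw [one_of_le _ (by omega), h.off i (by omega), one_of_le _ (by omega)]

theorem Bump.le {s p : D n} {q a : ℕ} {e : Bool} (h : Bump (2 * n) (one s.1) (one p.1) q a e) :
    Le s p := fun k => by rw [h.ones_eq]; omega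

theorem Bump.ne {s p : D n} {q a : ℕ} {e : Bool} (h : Bump (2 * n) (one s.1) (one p.1) q a e) :
    s ≠ p := by
  rintro rfl
  have := h.first
  rw [this.1] at this
  exact absurd this.2 (by simp)

theorem Le.refl (s : D n) : Le s s := fun _ => le_rfl

theorem Le.trans {s t p : D n} (h : Le s t) (h' : Le t p) : Le s p := fun k => (h k).trans (h' k)

theorem Le.antisymm {s t : D n} (h : Le s t) (h' : Le t s) : s = t :=
  D.ext_ones fun k => (h k).antisymm (h' k)

/-- The words between the two words of a bump form a chain. -/
theorem Bump.exists_chain {s p : D n} {q a : ℕ} {e : Bool}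
    (h : Bump (2 * n) (one s.1) (one p.1) q a e) :
    ∃ l : ℕ → D n, l 0 = s ∧ l a = p ∧
      (∀ i j, i < j → j ≤ a → Bump (2 * n) (one (l i).1) (one (l j).1)
        (if e then q + i else q + a - j) (j - i) e) ∧
      ∀ w, Le s w → Le w p → ∃ j ≤ a, w = l j := by
  classical
  have hpos := h.pos
  have hlt := h.lt
  -- Inside the bump a word has one letter different from `e`: a `0` moving right for a row, a `1`
  -- moving left for a column. Its position indexes the chain.
  set m : ℕ → ℕ → Bool := fun j i => if q ≤ i ∧ i ≤ q + a then
    (if i = (if e then q + j else q + a - j) then !e else e) else one s.1 i with hm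
  have h0 : m 0 = one s.1 := by
    funext i
    by_cases hi : q ≤ i ∧ i ≤ q + a
    · obtain rfl | h1 := hi.1.eq_or_lt
      · have := h.first.1
        cases e <;> simp [hm, this] <;> omega
      · obtain rfl | h2 := hi.2.eq_or_lt
        · have := h.last.1
          cases e <;> simp [hm, this] <;> omega
        · have := (h.mid i h1 h2).1
          cases e <;> simp [hm, this] <;> omega
    · simp only [hm, if_neg hi]
  have ha : m a = one p.1 := by
    funext i
    by_cases hi : q ≤ i ∧ i ≤ q + a
    · obtain rfl | h1 := hi.1.eq_or_lt
      · have := h.first.2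
        cases e <;> simp [hm, this] <;> omega
      · obtain rfl | h2 := hi.2.eq_or_lt
        · have := h.last.2
          cases e <;> simp [hm, this] <;> omega
        · have := (h.mid i h1 h2).2
          cases e <;> simp [hm, this, hi.1, hi.2] <;> omega
    · simp only [hm, if_neg hi]
      exact h.off i (by omega)
  have hb : ∀ i j, i < j → j ≤ a → Bump (2 * n) (m i) (m j)
      (if e then q + i else q + a - j) (j - i) e := by
    intro i j hij hj
    cases e
    · simp only [hm, Bool.false_eq_true, if_false, Bool.not_false]
      refine ⟨by omega, by omega, ⟨?_, ?_⟩, fun k hk hk' => ⟨?_, ?_⟩, ⟨?_, ?_⟩, fun k hk => ?_⟩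
      · rw [if_pos (by omega), if_neg (by omega)]
      · rw [if_pos (by omega), if_pos (by omega)]
      · rw [if_pos (by omega), if_neg (by omega)]
      · rw [if_pos (by omega), if_neg (by omega)]
      · rw [if_pos (by omega), if_pos (by omega)]
      · rw [if_pos (by omega), if_neg (by omega)]
      · rw [if_neg (show k ≠ q + a - i by omega), if_neg (show k ≠ q + a - j by omega)]
    · simp only [hm, if_true, Bool.not_true]
      refine ⟨by omega, by omega, ⟨?_, ?_⟩, fun k hk hk' => ⟨?_, ?_⟩, ⟨?_, ?_⟩, fun k hk => ?_⟩
      · rw [if_pos (by omega), if_pos rfl]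
      · rw [if_pos (by omega), if_neg (by omega)]
      · rw [if_pos (by omega), if_neg (by omega)]
      · rw [if_pos (by omega), if_neg (by omega)]
      · rw [if_pos (by omega), if_neg (by omega)]
      · rw [if_pos (by omega), if_pos (by omega)]
      · rw [if_neg (show k ≠ q + i by omega), if_neg (show k ≠ q + j by omega)]
  have hw : ∀ j, ∃ w : D n, j ≤ a → one w.1 = m j := by
    intro j
    by_cases hj : j < a
    · have h1 := hb j a hj le_rfl
      rw [ha] at h1
      obtain ⟨w, hw⟩ := exists_word_of_bump h1
      exact ⟨w, fun _ => funext hw⟩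
    · exact ⟨p, fun hj' => by rw [show j = a by omega, ha]⟩
  choose l hl using hw
  have hlb : ∀ i j, i < j → j ≤ a → Bump (2 * n) (one (l i).1) (one (l j).1)
      (if e then q + i else q + a - j) (j - i) e := fun i j hij hj => by
    rw [hl i (by omega), hl j hj]
    exact hb i j hij hj
  have hl0 : l 0 = s := D.ext_ones fun k => by rw [ones, ones, hl 0 a.zero_le, h0]
  have hla : l a = p := D.ext_ones fun k => by rw [ones, ones, hl a le_rfl, ha]
  refine ⟨l, hl0, hla, hlb, fun w hsw hwp => ?_⟩
  -- The diagonal of the cell added as number `i` along the chain; `hcl` says that a word containing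
  -- cell `i + 1` also contains cell `i`.
  set g : ℕ → ℕ := fun i => if e then q + i else q + a + 1 - i with hg
  have hcl : ∀ i, 0 < i → i < a → ones s (g (i + 1)) < ones w (g (i + 1)) →
      ones s (g i) < ones w (g i) := by
    intro i hi hia hs
    cases e
    · simp only [hg, Bool.false_eq_true, if_false] at hs ⊢
      rw [show q + a + 1 - (i + 1) = q + a - i by omega] at hs
      rw [show q + a + 1 - i = q + a - i + 1 by omega, ones_succ, ones_succ,
        (h.mid (q + a - i) (by omega) (by omega)).1]
      simp only [Bool.toNat_false]
      omega
    · simp only [hg, if_true] at hs ⊢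
      rw [← add_assoc, ones_succ, ones_succ, (h.mid (q + i) (by omega) (by omega)).1] at hs
      have := Bool.toNat_le (one w.1 (q + i))
      simp only [Bool.toNat_true] at hs
      omega
  have hdown : ∀ i j, i ≤ j → 0 < i → j ≤ a → ones s (g j) < ones w (g j) →
      ones s (g i) < ones w (g i) := by
    intro i j hij hi
    induction j, hij using Nat.le_induction with
    | base => exact fun _ h => h
    | succ j hij ih => exact fun hj h => ih (by omega) (hcl j (by omega) (by omega) h)
  set P : ℕ → Prop := fun i => ones s (g i) < ones w (g i) with hP
  set j := Nat.findGreatest P a with hj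
  have hja : j ≤ a := Nat.findGreatest_le a
  have hiff : ∀ i, 0 < i → i ≤ a → (ones s (g i) < ones w (g i) ↔ i ≤ j) := by
    intro i hi hia
    refine ⟨fun h1 => Nat.le_findGreatest (P := P) hia h1, fun h1 => ?_⟩
    exact hdown i j h1 hi hja (Nat.findGreatest_of_ne_zero (P := P) hj.symm (by omega))
  refine ⟨j, hja, D.ext_ones fun k => ?_⟩
  have h1 := hsw k
  have h2 := hwp k
  rw [h.ones_eq] at h2
  have h3 : ones (l j) k = ones s k + if (if e then q < k ∧ k ≤ q + j else
      q + a - j < k ∧ k ≤ q + a) then 1 else 0 := by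
    obtain h0 | h0 := Nat.eq_zero_or_pos j
    · rw [h0, hl0, if_neg (by cases e <;> simp), add_zero]
    · rw [(hlb 0 j h0 hja).ones_eq, hl0]
      cases e
      · simp only [Bool.false_eq_true, if_false]
        rw [show q + a - j + (j - 0) = q + a by omega]
      · simp only [if_true, add_zero, Nat.sub_zero]
  rw [h3]
  by_cases hk : q < k ∧ k ≤ q + a
  · rw [if_pos hk] at h2
    cases e
    · have h4 := hiff (q + a + 1 - k) (by omega) (by omega)
      simp only [hg, Bool.false_eq_true, if_false] at h4 ⊢
      rw [show q + a + 1 - (q + a + 1 - k) = k by omega] at h4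
      split_ifs with h5 <;> omega
    · have h4 := hiff (k - q) (by omega) (by omega)
      simp only [hg, if_true] at h4 ⊢
      rw [show q + (k - q) = k by omega] at h4
      split_ifs with h5 <;> omega
  · rw [if_neg hk] at h2
    rw [if_neg (by cases e <;> simp <;> omega)]
    omega

end TFPL

namespace TFPL

/-! ### Horizontal strips and pairs of disconnected cells -/

variable {n : ℕ}

theorem isHorizontalStrip_self (s : D n) : IsHorizontalStrip s.1 s.1 := by
  rw [isHorizontalStrip_iff]
  exact ⟨Le.refl s, fun k _ c h1 h2 => by omega⟩

theorem ones_lt_of_one {s : D n} {k k' : ℕ} (hk : one s.1 k = true) (h : k < k') :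
    ones s k < ones s k' := by
  have h1 := ones_mono s (show k + 1 ≤ k' from h)
  rw [ones_succ, hk] at h1
  exact h1

theorem Bump.isHorizontalStrip_of_row {s p : D n} {q a : ℕ}
    (h : Bump (2 * n) (one s.1) (one p.1) q a true) : IsHorizontalStrip s.1 p.1 := by
  have key : ∀ k k', k < k' → q < k ∧ k ≤ q + a → q < k' ∧ k' ≤ q + a →
      ones s k < ones s k' := fun k k' hkk hk hk' =>
    ones_lt_of_one (h.mid k hk.1 (by omega)).1 hkk
  rw [isHorizontalStrip_iff]
  refine ⟨h.le, fun k k' c h1 h2 h3 h4 => ?_⟩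
  rw [h.ones_eq] at h2 h4
  split_ifs at h2 h4 with h5 h6 <;> try omega
  obtain h7 | h7 | h7 := lt_trichotomy k k'
  · have := key k k' h7 h5 h6
    omega
  · exact h7
  · have := key k' k h7 h6 h5
    omega

theorem Bump.isHorizontalStrip_iff_of_col {s p : D n} {q a : ℕ}
    (h : Bump (2 * n) (one s.1) (one p.1) q a false) : IsHorizontalStrip s.1 p.1 ↔ a = 1 := by
  have hpos := h.pos
  rw [isHorizontalStrip_iff]
  constructor
  · rintro ⟨-, h1⟩
    by_contra ha
    have h2 := h.ones_eq (q + 1)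
    have h3 := h.ones_eq (q + 2)
    rw [if_pos (by omega)] at h2 h3
    have h4 : ones s (q + 2) = ones s (q + 1) := by
      rw [ones_succ s (q + 1), (h.mid (q + 1) (by omega) (by omega)).1]
      rfl
    have := h1 (q + 1) (q + 2) (ones s (q + 1)) le_rfl (by omega) (by omega) (by omega)
    omega
  · rintro rfl
    refine ⟨h.le, fun k k' c h1 h2 h3 h4 => ?_⟩
    rw [h.ones_eq] at h2 h4
    split_ifs at h2 h4 <;> omega

/-- Two cells on one diagonal would force a third on the next diagonal. On consecutive diagonals
their columns would be equal or consecutive, and the cells would share an edge. -/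
theorem exists_two_cells {s p : D n} (hle : Le s p) {x y : ℕ × ℕ} (hxy : x ≠ y)
    (hadj : ¬ AdjacentCells x y) (hs : skew p.1 s.1 = {x, y}) :
    ∃ k k', (k + 2 ≤ k' ∨ k' + 2 ≤ k) ∧
      ∀ m, ones p m = ones s m + if m = k ∨ m = k' then 1 else 0 := by
  obtain ⟨r, c⟩ := x
  obtain ⟨r', c'⟩ := y
  have hx : (r, c) ∈ skew p.1 s.1 := by rw [hs]; simp
  have hy : (r', c') ∈ skew p.1 s.1 := by rw [hs]; simp
  rw [mem_skew] at hx hy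
  have hcell : ∀ k d, ones s k ≤ d → d < ones p k →
      k ≤ n + d ∧ ((n + d - k = r ∧ d = c) ∨ (n + d - k = r' ∧ d = c')) := by
    intro k d h1 h2
    obtain ⟨h3, h4⟩ := cell_mem_skew h1 h2
    rw [hs] at h3
    simp only [Finset.mem_insert, Finset.mem_singleton, Prod.mk.injEq] at h3
    exact ⟨h4, h3⟩
  have h0 : ∀ k, ones s k < ones p k → k ≠ 0 := by
    rintro k hk rfl
    rw [ones_zero, ones_zero] at hk
    omega
  have hk0 := h0 _ (hx.1.trans_lt hx.2)
  have hk0' := h0 _ (hy.1.trans_lt hy.2)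
  set k := n + c - r with hk
  set k' := n + c' - r' with hk'
  have hmem : ∀ m, ones s m < ones p m → m = k ∨ m = k' := by
    intro m hm
    have := hcell m _ le_rfl hm
    omega
  have hne : k ≠ k' := by
    intro hkk
    have h1 := hle (k + 1)
    have h2 : ¬ ones s (k + 1) < ones p (k + 1) := fun h => by
      have := hmem _ h
      omega
    rw [ones_succ, ones_succ] at h2
    have h3 := Bool.toNat_le (one s.1 k)
    rw [← hkk] at hy
    apply hxy
    rw [Prod.mk.injEq]
    omega
  have hone : ∀ m, m = k ∨ m = k' → ones p m = ones s m + 1 := by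
    intro m hm
    have h1 : ones s m < ones p m := by
      obtain rfl | rfl := hm
      · omega
      · omega
    by_contra h2
    have h3 := hcell m _ le_rfl h1
    have h4 := hcell m (ones s m + 1) (by omega) (by omega)
    omega
  have hsep : ∀ m m', m = k ∧ m' = k' ∨ m = k' ∧ m' = k → m + 1 ≠ m' := by
    rintro m m' hm rfl
    have h1 := hone m (by omega)
    have h2 := hone (m + 1) (by omega)
    have h3 := hcell m _ le_rfl (by omega : ones s m < ones p m)
    have h4 := hcell (m + 1) _ le_rfl (by omega : ones s (m + 1) < ones p (m + 1))
    have h5 := ones_succ s m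
    have h6 := Bool.toNat_le (one s.1 m)
    apply hadj
    simp only [AdjacentCells]
    omega
  refine ⟨k, k', ?_, fun m => ?_⟩
  · have h1 := hsep k k' (by omega)
    have h2 := hsep k' k (by omega)
    omega
  · split_ifs with hm
    · exact hone m hm
    · have h1 := hle m
      have h2 : ¬ ones s m < ones p m := fun h => hm (hmem m h)
      omega

/-- Two words whose diagrams differ by one cell. -/
theorem bump_of_ones {s p : D n} {k : ℕ}
    (h : ∀ m, ones p m = ones s m + if m = k then 1 else 0) (e : Bool) :
    0 < k ∧ Bump (2 * n) (one s.1) (one p.1) (k - 1) 1 e := by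
  have h0 : k ≠ 0 := by
    rintro rfl
    have := h 0
    simp [ones_zero] at this
  have h1 : k < 2 * n := by
    by_contra hk
    have := h k
    rw [ones_of_le s (by omega), ones_of_le p (by omega)] at this
    simp at this
  have hl := fun i => letters_of_ones (h i) (h (i + 1))
  refine ⟨by omega, by omega, by omega, ?_, fun i hi hi' => by omega, ?_, fun i hi => ?_⟩
  · have := hl (k - 1)
    rw [if_neg (by omega), if_pos (by omega)] at this
    cases h : one s.1 (k - 1) <;> cases h' : one p.1 (k - 1) <;> rw [h, h'] at this <;>
      simp at this ⊢
  · have := hl (k - 1 + 1)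
    rw [if_pos (by omega), if_neg (by omega)] at this
    cases h : one s.1 (k - 1 + 1) <;> cases h' : one p.1 (k - 1 + 1) <;> rw [h, h'] at this <;>
      simp at this ⊢
  · have := hl i
    rw [if_neg (by omega), if_neg (by omega)] at this
    cases h : one s.1 i <;> cases h' : one p.1 i <;> rw [h, h'] at this <;>
      simp at this ⊢

theorem exists_intermediate {s p : D n} {k k' : ℕ} (hk : k + 2 ≤ k' ∨ k' + 2 ≤ k)
    (h : ∀ m, ones p m = ones s m + if m = k ∨ m = k' then 1 else 0) :
    ∃ w : D n, (∀ m, ones w m = ones s m + if m = k then 1 else 0) ∧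
      ∀ m, ones p m = ones w m + if m = k' then 1 else 0 := by
  have h0 : k ≠ 0 := by
    rintro rfl
    have := h 0
    simp [ones_zero] at this
  have h1 : k < 2 * n := by
    by_contra hk
    have := h k
    rw [ones_of_le s (by omega), ones_of_le p (by omega)] at this
    simp at this
  -- Adding the cell on diagonal `k` exchanges the letters `k - 1` and `k`; these are not touched by
  -- the other cell, as its diagonal is at distance at least two.
  set f : ℕ → Bool := fun i => if i + 1 = k ∨ i = k then one p.1 i else one s.1 i with hf
  have hl := fun i => letters_of_ones (h i) (h (i + 1))
  have hco : ∀ m, co f 0 m = ones s m + if m = k then 1 else 0 := by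
    intro m
    induction m with
    | zero => rw [co_self, ones_zero, if_neg (by omega)]
    | succ m ih =>
      rw [co_succ f m.zero_le, ih, ones_succ]
      have h2 := hl m
      by_cases h3 : m + 1 = k ∨ m = k
      · simp only [hf, if_pos h3]
        split_ifs at h2 ⊢ <;> omega
      · simp only [hf, if_neg h3]
        split_ifs at h2 ⊢ <;> omega
  obtain ⟨w, hw⟩ := exists_word (n := n) f (fun m _ => by
    have h2 := hco m
    have h3 := h m
    have h4 := two_mul_ones_le p m
    split_ifs at h2 h3 <;> omega) (by
    rw [hco, if_neg (by omega), ones_two_mul, add_zero])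
  have hw' : ∀ m, ones w m = ones s m + if m = k then 1 else 0 := by
    intro m
    by_cases hm : m ≤ 2 * n
    · rw [← hco m]
      exact co_congr fun j _ hj => hw j (by omega)
    · rw [ones_of_le w (by omega), ones_of_le s (by omega), if_neg (by omega), add_zero]
  refine ⟨w, hw', fun m => ?_⟩
  rw [h, hw']
  split_ifs <;> omega

/-- The letter of `s` that follows a diagonal containing a cell is a `1`, because the next diagonal
contains none; hence the two columns differ. -/
theorem isHorizontalStrip_of_two_cells {s p : D n} {k k' : ℕ}
    (hk : k + 2 ≤ k' ∨ k' + 2 ≤ k)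
    (h : ∀ m, ones p m = ones s m + if m = k ∨ m = k' then 1 else 0) :
    IsHorizontalStrip s.1 p.1 := by
  have key : ∀ m m', (m = k ∨ m = k') → (m' = k ∨ m' = k') → m < m' → ones s m < ones s m' := by
    intro m m' hm hm' hlt
    refine ones_lt_of_one ?_ hlt
    have := letters_of_ones (h m) (h (m + 1))
    rw [if_pos hm, if_neg (by omega)] at this
    cases h : one s.1 m <;> rw [h] at this <;> simp at this ⊢
  rw [isHorizontalStrip_iff]
  refine ⟨fun m => by rw [h]; omega, fun m m' c h1 h2 h3 h4 => ?_⟩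
  rw [h] at h2 h4
  split_ifs at h2 h4 with h5 h6 <;> try omega
  obtain h7 | h7 | h7 := lt_trichotomy m m'
  · have := key m m' h5 h6 h7
    omega
  · exact h7
  · have := key m' m h6 h5 h7
    omega

end TFPL

namespace TFPL

/-! ### Solving `t c = b t` -/

open Matrix

variable {n : ℕ}

theorem tMatrix_self (s : D n) : tMatrix n s s = 1 := by
  rw [tMatrix, of_apply, tNum_self, Nat.cast_one]

theorem le_of_tMatrix_ne_zero {s p : D n} (h : tMatrix n s p ≠ 0) : Le s p := by
  have h0 : tNum s (zero n) p ≠ 0 := by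
    rw [tMatrix, of_apply] at h
    exact_mod_cast h
  intro k
  by_cases hk : k ≤ 2 * n
  · exact co_le_of_tNum_ne_zero h0 k hk
  · rw [ones_of_le s (by omega), ones_of_le p (by omega)]

theorem tMatrix_bump {s p : D n} {q a : ℕ} {e : Bool}
    (h : Bump (2 * n) (one s.1) (one p.1) q a e) :
    tMatrix n s p = ((2 * n - 2 - ones s q).choose a : ℕ) := by
  rw [tMatrix, of_apply, tNum_bump h, ones]

theorem bMatrix_of_strip {s p : D n} (h : IsHorizontalStrip s.1 p.1) : bMatrix n s p = 1 := by
  rw [bMatrix, of_apply, if_pos h]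

theorem bMatrix_of_not_strip {s p : D n} (h : ¬ IsHorizontalStrip s.1 p.1) :
    bMatrix n s p = 0 := by
  rw [bMatrix, of_apply, if_neg h]

theorem le_of_bMatrix_ne_zero {s p : D n} (h : bMatrix n s p ≠ 0) : Le s p := by
  by_contra hle
  refine h (bMatrix_of_not_strip fun hs => hle ?_)
  exact (isHorizontalStrip_iff.1 hs).1

/-- The matrix `t` is unitriangular: a vector vanishes on an upper set as soon as its image does. -/
theorem eq_zero_of_tMatrix_mulVec {v : D n → ℂ} {Q : D n → Prop}
    (hQ : ∀ s t, Q s → Le s t → Q t) (h : ∀ s, Q s → (tMatrix n *ᵥ v) s = 0) :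
    ∀ s, Q s → v s = 0 := by
  classical
  by_contra! hne
  obtain ⟨s0, hs0⟩ := hne
  -- The sum of the prefix counts is strictly increasing for the order, so its maximum singles out a
  -- maximal word of the support inside `Q`.
  obtain ⟨s, hs, hmax⟩ := Finset.exists_max_image
    (Finset.univ.filter fun s => Q s ∧ v s ≠ 0)
    (fun s => ∑ k ∈ Finset.range (2 * n), ones s k) ⟨s0, by simpa using hs0⟩
  rw [Finset.mem_filter] at hs
  have h1 := h s hs.2.1
  rw [mulVec, dotProduct, Finset.sum_eq_single s, tMatrix_self, one_mul] at h1
  · exact hs.2.2 h1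
  · intro t _ hts
    by_contra hne
    have hT := le_of_tMatrix_ne_zero (left_ne_zero_of_mul hne)
    have hm := hmax t (Finset.mem_filter.2
      ⟨Finset.mem_univ _, hQ s t hs.2.1 hT, right_ne_zero_of_mul hne⟩)
    obtain ⟨k, hk⟩ : ∃ k, ones s k ≠ ones t k := by
      by_contra! hall
      exact hts (D.ext_ones hall).symm
    have hk' : k < 2 * n := by
      by_contra hk'
      rw [ones_of_le s (by omega), ones_of_le t (by omega)] at hk
      exact hk rfl
    have := Finset.sum_lt_sum (fun k _ => hT k)
      ⟨k, Finset.mem_range.2 hk', lt_of_le_of_ne (hT k) hk⟩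
    omega
  · exact fun h => absurd (Finset.mem_univ s) h

theorem isUnit_tMatrix (n : ℕ) : IsUnit (tMatrix n) := by
  rw [← mulVec_injective_iff_isUnit]
  intro v w h
  funext s
  refine sub_eq_zero.1 (eq_zero_of_tMatrix_mulVec (v := v - w) (Q := fun _ => True)
    (fun _ _ h _ => h) (fun s _ => ?_) s trivial)
  rw [mulVec_sub, sub_eq_zero.2 h]
  rfl

theorem tMatrix_mul_cMatrix (n : ℕ) : tMatrix n * cMatrix n = bMatrix n * tMatrix n := by
  rw [cMatrix, mul_assoc, mul_nonsing_inv_cancel_left]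
  exact (isUnit_iff_isUnit_det _).1 (isUnit_tMatrix n)

/-- The words not below `p` form an upper set on which column `p` of `b t` vanishes, so column `p`
of `c` vanishes there too. -/
theorem le_of_cMatrix_ne_zero {s p : D n} (h : cMatrix n s p ≠ 0) : Le s p := by
  by_contra hle
  refine h (eq_zero_of_tMatrix_mulVec (v := fun t => cMatrix n t p) (Q := fun t => ¬ Le t p)
    (fun s t h1 h2 h3 => h1 (h2.trans h3)) (fun t ht => ?_) s hle)
  have h1 := congrFun (congrFun (tMatrix_mul_cMatrix n) t) p
  rw [mul_apply, mul_apply] at h1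
  rw [mulVec, dotProduct, h1]
  refine Finset.sum_eq_zero fun w _ => ?_
  by_contra hne
  exact ht ((le_of_bMatrix_ne_zero (left_ne_zero_of_mul hne)).trans
    (le_of_tMatrix_ne_zero (right_ne_zero_of_mul hne)))

/-- All three matrices are triangular, so only words between `s` and `p` contribute to the entry of
`t c = b t`. -/
theorem sum_interval {s p : D n} {S : Finset (D n)} (hS : ∀ w, Le s w → Le w p → w ∈ S) :
    ∑ w ∈ S, tMatrix n s w * cMatrix n w p = ∑ w ∈ S, bMatrix n s w * tMatrix n w p := by
  have h1 := congrFun (congrFun (tMatrix_mul_cMatrix n) s) p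
  rw [mul_apply, mul_apply] at h1
  rw [Finset.sum_subset S.subset_univ, h1, ← Finset.sum_subset S.subset_univ]
  · intro w _ hw
    by_contra hne
    exact hw (hS w (le_of_bMatrix_ne_zero (left_ne_zero_of_mul hne))
      (le_of_tMatrix_ne_zero (right_ne_zero_of_mul hne)))
  · intro w _ hw
    by_contra hne
    exact hw (hS w (le_of_tMatrix_ne_zero (left_ne_zero_of_mul hne))
      (le_of_cMatrix_ne_zero (right_ne_zero_of_mul hne)))

theorem cMatrix_self (p : D n) : cMatrix n p p = 1 := by
  have h := sum_interval (s := p) (p := p) (S := {p}) fun w h1 h2 =>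
    Finset.mem_singleton.2 (h2.antisymm h1)
  rw [Finset.sum_singleton, Finset.sum_singleton, tMatrix_self,
    bMatrix_of_strip (isHorizontalStrip_self p)] at h
  simpa using h

theorem sum_choose_diagonal (a x : ℕ) (h : a ≤ x) :
    ∑ j ∈ Finset.range (a + 1), (x - j).choose (a - j) = (x + 1).choose a := by
  induction a generalizing x with
  | zero => simp
  | succ a ih =>
    obtain ⟨x, rfl⟩ : ∃ y, x = y + 1 := ⟨x - 1, by omega⟩
    rw [Finset.sum_range_succ', Nat.choose_succ_succ (x + 1) a, ← ih x (by omega)]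
    simp

theorem sum_chain {s p : D n} {q a : ℕ} {e : Bool} {l : ℕ → D n} (h0 : l 0 = s) (ha : l a = p)
    (hl : ∀ i j, i < j → j ≤ a → Bump (2 * n) (one (l i).1) (one (l j).1)
        (if e then q + i else q + a - j) (j - i) e)
    (hw : ∀ w, Le s w → Le w p → ∃ j ≤ a, w = l j) :
    ∑ j ∈ Finset.range (a + 1), tMatrix n (l 0) (l j) * cMatrix n (l j) (l a) =
      ∑ j ∈ Finset.range (a + 1), bMatrix n (l 0) (l j) * tMatrix n (l j) (l a) := by
  classical
  have hinj : Set.InjOn l (Finset.range (a + 1)) := by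
    intro i hi j hj hij
    simp only [Finset.coe_range, Set.mem_Iio] at hi hj
    obtain h | h | h := lt_trichotomy i j
    · exact absurd hij (hl i j h (by omega)).ne
    · exact h
    · exact absurd hij.symm (hl j i h (by omega)).ne
  have h1 := sum_interval (s := l 0) (p := l a) (S := (Finset.range (a + 1)).image l) (by
    intro w h1 h2
    rw [h0] at h1
    rw [ha] at h2
    obtain ⟨j, hj, rfl⟩ := hw w h1 h2
    exact Finset.mem_image_of_mem _ (Finset.mem_range.2 (by omega)))
  rwa [Finset.sum_image hinj, Finset.sum_image hinj] at h1

theorem Bump.ones_row {s p : D n} {q a : ℕ} (h : Bump (2 * n) (one s.1) (one p.1) q a true)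
    {i : ℕ} (hi : i < a) : ones s (q + 1 + i) = ones s q + i := by
  induction i with
  | zero => rw [add_zero, ones_succ, h.first.1]; rfl
  | succ i ih =>
    rw [← add_assoc, ones_succ, ih (by omega), (h.mid _ (by omega) (by omega)).1]
    rfl

/-- In a row, the bump from `l i` starts at letter `q + i`, after `i` further letters `1`, so the
upper index drops by `i`. -/
theorem tMatrix_chain_row {q a : ℕ} {l : ℕ → D n}
    (hl : ∀ i j, i < j → j ≤ a → Bump (2 * n) (one (l i).1) (one (l j).1) (q + i) (j - i) true)
    {i j : ℕ} (hij : i ≤ j) (hj : j ≤ a) :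
    tMatrix n (l i) (l j) = ((2 * n - 2 - ones (l 0) q - i).choose (j - i) : ℕ) := by
  obtain rfl | hij := hij.eq_or_lt
  · simp [tMatrix_self]
  · rw [tMatrix_bump (hl i j hij hj)]
    obtain rfl | hi := i.eq_zero_or_pos
    · simp
    · have h1 := (hl 0 i hi (by omega)).ones_eq (q + i)
      have h2 := Bump.ones_row (hl 0 a (by omega) le_rfl) (i := i - 1) (by omega)
      rw [if_pos (by omega)] at h1
      rw [show q + 0 + 1 + (i - 1) = q + i by omega, add_zero] at h2
      rw [show 2 * n - 2 - ones (l i) (q + i) = 2 * n - 2 - ones (l 0) q - i by omega]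

/-- In a column, only `0`s separate `q` from the start of any bump of the chain, so the upper index
does not change. -/
theorem tMatrix_chain_col {q a : ℕ} {l : ℕ → D n}
    (hl : ∀ i j, i < j → j ≤ a → Bump (2 * n) (one (l i).1) (one (l j).1) (q + a - j) (j - i) false)
    {i j : ℕ} (hij : i ≤ j) (hj : j ≤ a) :
    tMatrix n (l i) (l j) = ((2 * n - 2 - ones (l 0) q).choose (j - i) : ℕ) := by
  obtain rfl | hij := hij.eq_or_lt
  · simp [tMatrix_self]
  · rw [tMatrix_bump (hl i j hij hj)]
    have h0 : ones (l 0) (q + a - j) = ones (l 0) q := by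
      have h := hl 0 a (by omega) le_rfl
      simp only [Nat.add_sub_cancel, Nat.sub_zero] at h
      have key : ∀ m < a, ones (l 0) (q + m) = ones (l 0) q := by
        intro m hm
        induction m with
        | zero => rfl
        | succ m ih =>
          rw [← add_assoc, ones_succ, ih (by omega)]
          obtain rfl | hm' := m.eq_zero_or_pos
          · rw [add_zero, h.first.1]
            rfl
          · rw [(h.mid _ (by omega) (by omega)).1]
            rfl
      rw [show q + a - j = q + (a - j) by omega]
      exact key _ (by omega)
    have h1 : ones (l i) (q + a - j) = ones (l 0) (q + a - j) := by
      obtain rfl | hi := i.eq_zero_or_pos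
      · rfl
      · rw [(hl 0 i hi (by omega)).ones_eq, if_neg (by omega), add_zero]
    rw [h1, h0]

theorem cMatrix_of_bump {s p : D n} {q a : ℕ} {e : Bool}
    (h : Bump (2 * n) (one s.1) (one p.1) q a e) :
    cMatrix n s p = if a = 1 then 1 else 0 := by
  induction a using Nat.strong_induction_on generalizing s q with
  | _ a ih =>
  obtain ⟨l, h0, ha, hl, hw⟩ := h.exists_chain
  have hsum := sum_chain h0 ha hl hw
  have hpos := h.pos
  obtain ⟨b, rfl⟩ : ∃ b, a = b + 1 := ⟨a - 1, by omega⟩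
  -- The unknown entry of `c` is the term at the start of the chain, where `t` is `1`; at the other
  -- end `c` is `1`, and in between the induction hypothesis applies.
  rw [Finset.sum_range_succ', Finset.sum_range_succ, tMatrix_self, cMatrix_self] at hsum
  have hT1 : tMatrix n (l 0) (l b) = ((2 * n - 2 - ones (l 0) q).choose b : ℕ) := by
    cases e
    · simpa using tMatrix_chain_col (by simpa using hl) b.zero_le b.le_succ
    · simpa using tMatrix_chain_row (by simpa using hl) b.zero_le b.le_succ
  have hT2 : tMatrix n (l 0) (l (b + 1)) = ((2 * n - 2 - ones (l 0) q).choose (b + 1) : ℕ) := by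
    cases e
    · simpa using tMatrix_chain_col (by simpa using hl) (b + 1).zero_le le_rfl
    · simpa using tMatrix_chain_row (by simpa using hl) (b + 1).zero_le le_rfl
  have hR : ∑ j ∈ Finset.range (b + 1 + 1), bMatrix n (l 0) (l j) * tMatrix n (l j) (l (b + 1)) =
      ((2 * n - 2 - ones (l 0) q + 1).choose (b + 1) : ℕ) := by
    cases e
    -- In a column only the empty shape and the single cell are horizontal strips, so two terms
    -- survive and Pascal's rule adds them.
    · simp only [Bool.false_eq_true, if_false] at hl
      rw [Finset.sum_range_succ', Finset.sum_range_succ', Finset.sum_eq_zero, zero_add,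
        bMatrix_of_strip (isHorizontalStrip_self _), bMatrix_of_strip, hT2,
        tMatrix_chain_col hl (by omega) le_rfl, Nat.choose_succ_succ]
      · push_cast
        simp
      · exact (hl 0 1 (by omega) (by omega)).isHorizontalStrip_iff_of_col.2 rfl
      · intro j hj
        rw [Finset.mem_range] at hj
        rw [bMatrix_of_not_strip, zero_mul]
        have := (hl 0 (j + 1 + 1) (by omega) (by omega)).isHorizontalStrip_iff_of_col
        rw [this]
        omega
    · simp only [if_true] at hl
      -- In a row every shape is a strip, and the sum runs down a diagonal of Pascal's triangle. The
      -- required inequality is the prefix condition for the top word at the end of its run of `1`s.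
      have hle : b + 1 ≤ 2 * n - 2 - ones (l 0) q := by
        have h1 := hl 0 (b + 1) (by omega) le_rfl
        have h2 := h1.lt
        have h3 := two_mul_ones_le (l (b + 1)) (q + (b + 1))
        have h4 := h1.ones_row (i := b) (by omega)
        rw [h1.ones_eq, if_pos (by omega)] at h3
        rw [show q + 0 + 1 + b = q + (b + 1) by omega, add_zero] at h4
        omega
      rw [← sum_choose_diagonal _ _ hle, Nat.cast_sum]
      refine Finset.sum_congr rfl fun j hj => ?_
      rw [Finset.mem_range] at hj
      rw [tMatrix_chain_row hl (by omega) le_rfl, bMatrix_of_strip, one_mul]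
      obtain rfl | hj := j.eq_zero_or_pos
      · exact isHorizontalStrip_self _
      · exact (hl 0 j hj (by omega)).isHorizontalStrip_of_row
  rw [hR, hT2, Nat.choose_succ_succ] at hsum
  rw [← h0, ← ha]
  obtain rfl | hb := b.eq_zero_or_pos
  · simp at hsum ⊢
    linear_combination hsum
  · obtain ⟨b, rfl⟩ : ∃ c, b = c + 1 := ⟨b - 1, by omega⟩
    -- For at least two cells, the only intermediate word that contributes is the one a single cell
    -- below the top, where `c` is `1`; its term completes Pascal's rule, so the unknown is zero.
    have hc : cMatrix n (l (b + 1)) (l (b + 1 + 1)) = 1 := by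
      have h1 := hl (b + 1) (b + 1 + 1) (by omega) le_rfl
      rw [ha] at h1 ⊢
      rw [ih _ (by omega) h1, if_pos (by omega)]
    rw [Finset.sum_range_succ, Finset.sum_eq_zero, hT1, hc] at hsum
    · rw [if_neg (by omega)]
      push_cast at hsum
      simp at hsum
      linear_combination hsum
    · intro j hj
      rw [Finset.mem_range] at hj
      have h1 := hl (j + 1) (b + 1 + 1) (by omega) le_rfl
      rw [ha] at h1 ⊢
      rw [ih _ (by omega) h1, if_neg (by omega), mul_zero]

/-- The interval is a square `s, u, v, p`. Adding one cell does not change the number of `1`s before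
the other, so opposite sides have equal entries of `t`; the entry at `s, p` occurs on both sides and
is never computed. -/
theorem cMatrix_of_two_cells {s p : D n} {k k' : ℕ} (hk : k + 2 ≤ k' ∨ k' + 2 ≤ k)
    (h : ∀ m, ones p m = ones s m + if m = k ∨ m = k' then 1 else 0) : cMatrix n s p = 1 := by
  classical
  obtain ⟨u, hu, hu'⟩ := exists_intermediate hk h
  obtain ⟨v, hv, hv'⟩ := exists_intermediate (s := s) (p := p) hk.symm fun m => by
    rw [h]; split_ifs <;> omega
  obtain ⟨hk0, b1⟩ := bump_of_ones hu true
  obtain ⟨hk0', b2⟩ := bump_of_ones hv true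
  obtain ⟨-, b3⟩ := bump_of_ones hu' true
  obtain ⟨-, b4⟩ := bump_of_ones hv' true
  have hne : ∀ {w w' : D n} (m), ones w m ≠ ones w' m → w ≠ w' := by
    rintro w _ m h rfl
    exact h rfl
  have huv : u ≠ v := hne k (by rw [hu, hv, if_pos rfl, if_neg (by omega)]; omega)
  have hsp : s ≠ p := hne k (by rw [h, if_pos (Or.inl rfl)]; omega)
  have hsum := sum_interval (s := s) (p := p) (S := {s, u, v, p}) (by
    intro w h1 h2
    have key : ∀ t : D n, (∀ m, m ≠ k → m ≠ k' → ones t m = ones s m) →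
        ones w k = ones t k → ones w k' = ones t k' → w = t := by
      intro t ht h3 h4
      refine D.ext_ones fun m => ?_
      by_cases h5 : m = k
      · rw [h5, h3]
      by_cases h6 : m = k'
      · rw [h6, h4]
      have h7 := h2 m
      rw [h, if_neg (by omega)] at h7
      rw [ht m h5 h6]
      exact le_antisymm h7 (h1 m)
    have h3 := h1 k
    have h4 := h2 k
    have h5 := h1 k'
    have h6 := h2 k'
    rw [h, if_pos (by omega)] at h4 h6
    simp only [Finset.mem_insert, Finset.mem_singleton]
    by_cases h7 : ones w k = ones s k
    · by_cases h8 : ones w k' = ones s k'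
      · exact Or.inl (key s (fun _ _ _ => rfl) h7 h8)
      · refine Or.inr (Or.inr (Or.inl (key v (fun m h9 h10 => ?_) ?_ ?_)))
        · rw [hv, if_neg h10, add_zero]
        · rw [hv, if_neg (by omega), h7, add_zero]
        · rw [hv, if_pos rfl]
          omega
    · by_cases h8 : ones w k' = ones s k'
      · refine Or.inr (Or.inl (key u (fun m h9 h10 => ?_) ?_ ?_))
        · rw [hu, if_neg h9, add_zero]
        · rw [hu, if_pos rfl]
          omega
        · rw [hu, if_neg (by omega), h8, add_zero]
      · refine Or.inr (Or.inr (Or.inr (key p (fun m h9 h10 => ?_) ?_ ?_)))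
        · rw [h, if_neg (by omega), add_zero]
        · rw [h, if_pos (Or.inl rfl)]
          omega
        · rw [h, if_pos (Or.inr rfl)]
          omega)
  have e1 : tMatrix n u p = tMatrix n s v := by
    rw [tMatrix_bump b3, tMatrix_bump b2, hu, if_neg (by omega), add_zero]
  have e2 : tMatrix n v p = tMatrix n s u := by
    rw [tMatrix_bump b4, tMatrix_bump b1, hv, if_neg (by omega), add_zero]
  have hsum' : ∀ f : D n → ℂ, ∑ w ∈ ({s, u, v, p} : Finset (D n)), f w =
      f s + (f u + (f v + f p)) := by
    intro f
    rw [Finset.sum_insert, Finset.sum_insert, Finset.sum_pair b4.ne]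
    · simpa using ⟨huv, b3.ne⟩
    · simpa using ⟨b1.ne, b2.ne, hsp⟩
  rw [hsum', hsum', tMatrix_self, tMatrix_self, cMatrix_self,
    bMatrix_of_strip (isHorizontalStrip_self s), bMatrix_of_strip b1.isHorizontalStrip_of_row,
    bMatrix_of_strip b2.isHorizontalStrip_of_row,
    bMatrix_of_strip (isHorizontalStrip_of_two_cells hk h), cMatrix_of_bump b3, cMatrix_of_bump b4,
    e1, e2] at hsum
  simp at hsum
  linear_combination hsum

end TFPL

theorem mainTheorem8 (n : ℕ) :
    IsUnit (TFPL.tMatrix n) ∧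
    ∀ α π : TFPL.D n, TFPL.DiagLE α.1 π.1 →
      (((TFPL.skew π.1 α.1).card = 1 ∨
          (∃ x y : ℕ × ℕ, x ≠ y ∧ ¬ TFPL.AdjacentCells x y ∧ TFPL.skew π.1 α.1 = {x, y})) →
        TFPL.cMatrix n α π = 1) ∧
      ((2 ≤ (TFPL.skew π.1 α.1).card ∧
          ((∃ r : ℕ, ∀ x ∈ TFPL.skew π.1 α.1, x.1 = r) ∨
            (∃ k : ℕ, ∀ x ∈ TFPL.skew π.1 α.1, x.2 = k))) →
        TFPL.cMatrix n α π = 0) := by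
  refine ⟨TFPL.isUnit_tMatrix n, fun α π hle => ⟨?_, ?_⟩⟩
  · rw [TFPL.diagLE_iff] at hle
    rintro (hc | ⟨x, y, hxy, hadj, hs⟩)
    · obtain ⟨z, hz⟩ := Finset.card_eq_one.1 hc
      obtain ⟨q, a, h⟩ := TFPL.exists_bump_row hle (r := z.1)
        (fun x hx => by rw [hz, Finset.mem_singleton] at hx; rw [hx]) (by omega)
      rw [TFPL.cMatrix_of_bump h, if_pos (h.card_eq.symm.trans hc)]
    · obtain ⟨k, k', hk, h⟩ := TFPL.exists_two_cells hle hxy hadj hs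
      exact TFPL.cMatrix_of_two_cells hk h
  · rw [TFPL.diagLE_iff] at hle
    rintro ⟨hc, ⟨r, hr⟩ | ⟨c, hcol⟩⟩
    · obtain ⟨q, a, h⟩ := TFPL.exists_bump_row hle hr (by omega)
      have := h.card_eq
      rw [TFPL.cMatrix_of_bump h, if_neg (by omega)]
    · obtain ⟨q, a, h⟩ := TFPL.exists_bump_col hle hcol (by omega)
      have := h.card_eq
      rw [TFPL.cMatrix_of_bump h, if_neg (by omega)]
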